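/- **Setting.** Let $\mathcal H_X,\mathcal H_Y$ be real separable Hilbert spaces of dimensions $d_X,d_Y\in\{0,1,\dots\}\cup\{\infty\}$ and let $\mathcal Z$ be a measurable space. Let $\mathcal P_0$ be the set of probability distributions $P$ of $(X,Y,Z)\in\mathcal H_X\times\mathcal H_Y\times\mathcal Z$ with $\mathbb E_P\|X\|<\infty$, $\mathbb E_P\|Y\|<\infty$ such that $X$ and $Y$ are conditionally independent given $Z$, i.e. $\mathbb E_P(\varphi(X)\psi(Y)\mid Z)=\mathbb E_P(\varphi(X)\mid Z)\,\mathbb E_P(\psi(Y)\mid Z)$ almost surely for all bounded Borel functions $\varphi,\psi$. For $P\in\mathcal P_0$ put $f_P(z)=\mathbb E_P(X\mid Z=z)$, $g_P(z)=\mathbb E_P(Y\mid Z=z)$, $\varepsilon_P=X-f_P(Z)$, $\xi_P=Y-g_P(Z)$, and $$u_P(z)=\mathbb E_P(\|\varepsilon_P\|^2\mid Z=z),\qquad v_P(z)=\mathbb E_P(\|\xi_P\|^2\mid Z=z),$$ with values in $[0,\infty]$ and the convention $0\cdot\infty=0$. For $g,h$ in (possibly different) Hilbert spaces, $g\otimes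 h$ denotes the operator $x\mapsto\langle x,g\rangle h$; $\otimes_{\mathrm{HS}}$ denotes the same operation in the Hilbert space $\mathrm{HS}$ of Hilbert–Schmidt operators from $\mathcal H_X$ to $\mathcal H_Y$; $\|\cdot\|_{\mathrm{TR}}$ is the trace norm (the sum of the singular values). Let $\tilde{\mathcal P}_0\subseteq\mathcal P_0$. Let $(x_i,y_i,z_i)_{i\ge1}$ be random elements on a measurable space equipped with probability measures $(\mathbb P_P)_{P\in\tilde{\mathcal P}_0}$ such that, under $\mathbb P_P$, they are i.i.d. with distribution $P$. For each $n$, let $\hat f^{(n)}$ be a regression estimate computed from $(x_i,z_i)_{i\le n}$ and $\hat g^{(n)}$ one computed from $(y_i,z_i)_{i\le n}$. Define the residuals $\hat\varepsilon_i=x_i-\hat f^{(n)}(z_i)$ and $\hat\xi_i=y_i-\hat g^{(n)}(z_i)$ and $$\mathscr R_i=\hat\varepsilon_i\otimes\hat\xi_i,\quad \bar{\mathscr R}=\frac1n\sum_{i=1}^n\mathscr R_i,\quad \mathscr T_n=\sqrt n\,\bar{\mathscr R},\quad \hat{\mathscr C}=\frac1{n-1}\sum_{i=1}^n(\mathscr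 R_i-\bar{\mathscr R})\otimes_{\mathrm{HS}}(\mathscr R_i-\bar{\mathscr R}),$$ and the in-sample mean squared prediction errors $$M^f_{n,P}=\frac1n\sum_{i=1}^n\|f_P(z_i)-\hat f^{(n)}(z_i)\|^2,\qquad \tilde M^f_{n,P}=\frac1n\sum_{i=1}^n\|f_P(z_i)-\hat f^{(n)}(z_i)\|^2\,v_P(z_i),$$ $$M^g_{n,P}=\frac1n\sum_{i=1}^n\|g_P(z_i)-\hat g^{(n)}(z_i)\|^2,\qquad \tilde M^g_{n,P}=\frac1n\sum_{i=1}^n\|g_P(z_i)-\hat g^{(n)}(z_i)\|^2\,u_P(z_i).$$ For nonnegative $D_{n,P}$, write $D_{n,P}\overset{P}{\rightrightarrows}0$ if $\lim_n\sup_{P\in\tilde{\mathcal P}_0}\mathbb P_P(D_{n,P}\ge\delta)=0$ for every $\delta>0$. For random elements $T_n$ and probability measures $\nu_P$ on a separable Hilbert space, write $T_n\overset{\mathcal D}{\rightrightarrows}\nu_P$ if $$\lim_n\sup_{P\in\tilde{\mathcal P}_0}\sup_{\varphi}\Big|\mathbb E_P\varphi(T_n)-\int\varphi\,d\nu_P\Big|=0,$$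 the inner supremum being over all $\varphi$ with values in $[-1,1]$ that are Lipschitz with constant at most $1$. **Theorem.** Assume that 1. $n\,M^f_{n,P}\,M^g_{n,P}\overset{P}{\rightrightarrows}0$; 2. $\tilde M^f_{n,P}\overset{P}{\rightrightarrows}0$ and $\tilde M^g_{n,P}\overset{P}{\rightrightarrows}0$; 3. $\inf_{P\in\tilde{\mathcal P}_0}\mathbb E_P(\|\varepsilon_P\|^2\|\xi_P\|^2)>0$, and $\sup_{P\in\tilde{\mathcal P}_0}\mathbb E_P(\|\varepsilon_P\|^{2+\eta}\|\xi_P\|^{2+\eta})<\infty$ for some $\eta>0$; 4. for some orthonormal bases $(e_{X,i})_{i=1}^{d_X}$ of $\mathcal H_X$ and $(e_{Y,j})_{j=1}^{d_Y}$ of $\mathcal H_Y$, $$\lim_{K\to\infty}\ \sup_{P\in\tilde{\mathcal P}_0}\ \sum_{(i,j):\,i+j\ge K}\mathbb E_P\big(\langle e_{X,i},\varepsilon_P\rangle^2\,\langle e_{Y,j},\xi_P\rangle^2\big)=0,$$ an empty sum being $0$. Put $\mathscr C_P=\mathbb E_P\{(\varepsilon_P\otimes\xi_P)\otimes_{\mathrm{HS}}(\varepsilon_P\otimes\xi_P)\}$.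 Then, for every $P\in\tilde{\mathcal P}_0$, the Gaussian distribution $\mathcal N(0,\mathscr C_P)$ on $\mathrm{HS}$ exists, and $$\mathscr T_n\overset{\mathcal D}{\rightrightarrows}\mathcal N(0,\mathscr C_P)\qquad\text{and}\qquad \|\hat{\mathscr C}-\mathscr C_P\|_{\mathrm{TR}}\overset{P}{\rightrightarrows}0 .$$ -/

import Mathlib

open MeasureTheory ProbabilityTheory Filter Topology
open scoped ENNReal NNReal RealInnerProductSpace

set_option linter.unusedSectionVars false

noncomputable section

namespace GHCM

/-! ### Hilbert--Schmidt operators -/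

section HilbertSchmidt

variable {E F : Type*}
  [NormedAddCommGroup E] [InnerProductSpace ℝ E] [CompleteSpace E]
  [NormedAddCommGroup F] [InnerProductSpace ℝ F] [CompleteSpace F]

/-- The outer product `g ⊗ h` of `g : E` and `h : F`: the operator `x ↦ ⟪x, g⟫ h`. -/
def outer (g : E) (h : F) : E →L[ℝ] F := (innerSL ℝ g).smulRight h

lemma outer_apply (g : E) (h : F) (x : E) : outer g h x = ⟪x, g⟫ • h := by
  simp [outer, real_inner_comm]

variable (E) in
/-- The index set of a fixed orthonormal basis of the Hilbert space `E`. -/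
def basisIndex : Set E := (exists_hilbertBasis ℝ E).choose

variable (E) in
/-- A fixed orthonormal basis of the Hilbert space `E`. -/
def stdBasis : HilbertBasis (basisIndex E) ℝ E := (exists_hilbertBasis ℝ E).choose_spec.choose

lemma tsum_enorm_inner_sq {ι : Type*} (b : HilbertBasis ι ℝ E) (x : E) :
    ∑' i, ‖⟪b i, x⟫‖ₑ ^ 2 = ‖x‖ₑ ^ 2 := by
  have h := b.hasSum_inner_mul_inner x x
  have h' : HasSum (fun i => ⟪b i, x⟫ ^ 2) (‖x‖ ^ 2) := by
    have e0 : (fun i => ⟪b i, x⟫ ^ 2) = fun i => ⟪x, b i⟫ * ⟪b i, x⟫ := by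
      funext i; rw [real_inner_comm (b i) x, sq]
    rw [e0, ← real_inner_self_eq_norm_sq x]
    exact h
  have e1 : ∀ i, ‖⟪b i, x⟫‖ₑ ^ 2 = ENNReal.ofReal (⟪b i, x⟫ ^ 2) := fun i => by
    rw [← sq_abs, ENNReal.ofReal_pow (abs_nonneg _), Real.enorm_eq_ofReal_abs]
  simp_rw [e1]
  rw [← ENNReal.ofReal_tsum_of_nonneg (fun i => sq_nonneg _) h'.summable, h'.tsum_eq,
    ENNReal.ofReal_pow (norm_nonneg _), ofReal_norm]

lemma tsum_enorm_sq_eq_adjoint {ι κ : Type*} (b : HilbertBasis ι ℝ E) (c : HilbertBasis κ ℝ F)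
    (A : E →L[ℝ] F) :
    ∑' i, ‖A (b i)‖ₑ ^ 2 = ∑' j, ‖(ContinuousLinearMap.adjoint A) (c j)‖ₑ ^ 2 := by
  simp_rw [← tsum_enorm_inner_sq c (A (b _)), ← tsum_enorm_inner_sq b (_ : E)]
  rw [ENNReal.tsum_comm]
  refine tsum_congr fun j => tsum_congr fun i => ?_
  rw [ContinuousLinearMap.adjoint_inner_right, real_inner_comm]

/-- The squared Hilbert--Schmidt norm does not depend on the orthonormal basis. -/
lemma tsum_enorm_sq_basis_indep {ι κ : Type*} (b : HilbertBasis ι ℝ E) (c : HilbertBasis κ ℝ E)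
    (A : E →L[ℝ] F) : ∑' i, ‖A (b i)‖ₑ ^ 2 = ∑' j, ‖A (c j)‖ₑ ^ 2 := by
  rw [tsum_enorm_sq_eq_adjoint b (stdBasis F), tsum_enorm_sq_eq_adjoint c (stdBasis F)]

lemma memℓp_two_iff {ι : Type*} (v : ι → F) :
    Memℓp v 2 ↔ ∑' i, ‖v i‖ₑ ^ 2 ≠ ∞ := by
  rw [memℓp_gen_iff (by norm_num)]
  have e1 : ∀ i, ‖v i‖ₑ ^ 2 = ((‖v i‖₊ ^ 2 : ℝ≥0) : ℝ≥0∞) := fun i => by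
    simp [enorm_eq_nnnorm]
  simp_rw [e1]
  rw [ENNReal.tsum_coe_ne_top_iff_summable, ← NNReal.summable_coe]
  simp

variable (E F) in
/-- The bounded operators `A` with `∑ ‖A e_i‖² < ∞` for an orthonormal basis `(e_i)` of `E`
(for the fixed one, hence by `mem_hsSubmodule_iff` for every one). -/
def hsSubmodule : Submodule ℝ (E →L[ℝ] F) where
  carrier := {A | Memℓp (fun i => A (stdBasis E i)) 2}
  add_mem' {A B} hA hB := by
    have := Memℓp.add hA hB
    exact this
  zero_mem' := by
    have : Memℓp (0 : basisIndex E → F) 2 := zero_memℓp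
    exact this
  smul_mem' c A hA := by
    have := Memℓp.const_smul hA c
    exact this

lemma mem_hsSubmodule_iff {ι : Type*} (b : HilbertBasis ι ℝ E) (A : E →L[ℝ] F) :
    A ∈ hsSubmodule E F ↔ ∑' i, ‖A (b i)‖ₑ ^ 2 ≠ ∞ := by
  rw [tsum_enorm_sq_basis_indep b (stdBasis E), ← memℓp_two_iff]; rfl

variable (E F) in
/-- The space of Hilbert--Schmidt operators from `E` to `F`. (A new type, since it carries the
Hilbert--Schmidt norm and not the operator norm.) -/
def HS : Type _ := hsSubmodule E F

instance : AddCommGroup (HS E F) := inferInstanceAs (AddCommGroup (hsSubmodule E F))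
instance : Module ℝ (HS E F) := inferInstanceAs (Module ℝ (hsSubmodule E F))

/-- The bounded operator underlying a Hilbert--Schmidt operator. -/
def HS.toCLM (A : HS E F) : E →L[ℝ] F := A.1

variable (E F) in
/-- The map `A ↦ (A e_i)_i`, along which the Hilbert space structure
`⟪A, B⟫ = ∑ ⟪A e_i, B e_i⟫` is defined. -/
def HS.toLp : HS E F →ₗ[ℝ] lp (fun _ : basisIndex E => F) 2 where
  toFun A := ⟨fun i => A.toCLM (stdBasis E i), A.2⟩
  map_add' _ _ := rfl
  map_smul' _ _ := rfl

lemma HS.toLp_injective : Function.Injective (HS.toLp E F) := by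
  intro A B h
  refine Subtype.ext (ContinuousLinearMap.ext_on (s := Set.range (stdBasis E)) ?_ ?_)
  · have := (stdBasis E).dense_span
    rw [Submodule.dense_iff_topologicalClosure_eq_top]
    exact this
  · rintro _ ⟨i, rfl⟩
    exact congrFun (congrArg (fun v : lp (fun _ : basisIndex E => F) 2 => (v : basisIndex E → F)) h) i

instance : NormedAddCommGroup (HS E F) :=
  NormedAddCommGroup.induced (HS E F) (lp (fun _ : basisIndex E => F) 2) (HS.toLp E F)
    HS.toLp_injective

lemma HS.norm_def (A : HS E F) : ‖A‖ = ‖HS.toLp E F A‖ := rfl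

instance : NormedSpace ℝ (HS E F) where
  norm_smul_le c A := by
    rw [HS.norm_def, HS.norm_def, map_smul]
    exact norm_smul_le c _

instance : InnerProductSpace ℝ (HS E F) where
  inner A B := ⟪HS.toLp E F A, HS.toLp E F B⟫
  norm_sq_eq_re_inner A := by
    rw [HS.norm_def]
    exact norm_sq_eq_re_inner (𝕜 := ℝ) _
  conj_inner_symm A B := inner_conj_symm (𝕜 := ℝ) _ _
  add_left A B C := by rw [map_add]; exact inner_add_left _ _ _
  smul_left A B c := by rw [map_smul]; exact inner_smul_left _ _ _

lemma HS.inner_def (A B : HS E F) : ⟪A, B⟫ = ⟪HS.toLp E F A, HS.toLp E F B⟫ := rfl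

/-- The Hilbert--Schmidt inner product is `∑ ⟪A e_i, B e_i⟫`. -/
lemma HS.inner_eq_tsum (A B : HS E F) :
    ⟪A, B⟫ = ∑' i, ⟪A.toCLM (stdBasis E i), B.toCLM (stdBasis E i)⟫ :=
  lp.inner_eq_tsum _ _

variable (E F) in
/-- `HS.toLp` as an isometry. -/
def HS.toLpₗᵢ : HS E F →ₗᵢ[ℝ] lp (fun _ : basisIndex E => F) 2 where
  toLinearMap := HS.toLp E F
  norm_map' _ := rfl

lemma HS.toLp_surjective : Function.Surjective (HS.toLp E F) := by
  intro v
  have key : ∀ x : E, (Summable fun i => ‖(stdBasis E).repr x i‖ * ‖v i‖) ∧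
      ∑' i, ‖(stdBasis E).repr x i‖ * ‖v i‖ ≤ ‖v‖ * ‖x‖ := fun x => by
    have h1 : Summable fun i => ‖(stdBasis E).repr x i‖ ^ (2 : ℝ) := by
      simpa using (memℓp_gen_iff (p := 2) (by norm_num)).1 (lp.memℓp ((stdBasis E).repr x))
    have h2 : Summable fun i => ‖v i‖ ^ (2 : ℝ) := by
      simpa using (memℓp_gen_iff (p := 2) (by norm_num)).1 (lp.memℓp v)
    have hpq : Real.HolderConjugate 2 2 := Real.holderConjugate_iff.2 ⟨by norm_num, by norm_num⟩
    refine ⟨Real.summable_mul_of_Lp_Lq_of_nonneg hpq (fun i => norm_nonneg _)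
      (fun i => norm_nonneg _) h1 h2, (Real.inner_le_Lp_mul_Lq_tsum_of_nonneg hpq
      (fun i => norm_nonneg _) (fun i => norm_nonneg _) h1 h2).trans (le_of_eq ?_)⟩
    have n1 := lp.norm_eq_tsum_rpow (p := 2) (by norm_num) ((stdBasis E).repr x)
    have n2 := lp.norm_eq_tsum_rpow (p := 2) (by norm_num) v
    rw [LinearIsometryEquiv.norm_map] at n1
    simp only [ENNReal.toReal_ofNat] at n1 n2
    rw [n1, n2, mul_comm]
  have hs : ∀ x : E, Summable fun i => (stdBasis E).repr x i • v i := fun x =>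
    Summable.of_norm (by simpa only [norm_smul] using (key x).1)
  let L : E →ₗ[ℝ] F :=
    { toFun := fun x => ∑' i, (stdBasis E).repr x i • v i
      map_add' := fun x y => by
        rw [← (hs x).tsum_add (hs y)]
        exact tsum_congr fun i => by simp [add_smul]
      map_smul' := fun c x => by
        rw [RingHom.id_apply, ← (hs x).tsum_const_smul]
        exact tsum_congr fun i => by simp [mul_smul] }
  let A : E →L[ℝ] F := L.mkContinuous ‖v‖ fun x => by
    refine (norm_tsum_le_tsum_norm ?_).trans ?_
    · simpa only [norm_smul] using (key x).1
    · simpa only [norm_smul] using (key x).2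
  have hA : ∀ i, A (stdBasis E i) = v i := fun i => by
    classical
    change ∑' j, (stdBasis E).repr (stdBasis E i) j • v j = v i
    rw [tsum_eq_single i]
    · rw [HilbertBasis.repr_self]; simp
    · intro j hj
      rw [HilbertBasis.repr_self]; simp [lp.single_apply, hj]
  refine ⟨⟨A, ?_⟩, ?_⟩
  · change Memℓp (fun i => A (stdBasis E i)) 2
    simp_rw [hA]
    exact lp.memℓp v
  · exact lp.ext (funext hA)

instance : CompleteSpace (HS E F) := by
  have h : IsUniformInducing (HS.toLp E F) := (HS.toLpₗᵢ E F).isometry.isUniformInducing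
  refine (completeSpace_iff_isComplete_range h).2 ?_
  rw [Set.range_eq_univ.2 HS.toLp_surjective]
  exact isComplete_univ

instance : MeasurableSpace (HS E F) := borel _
instance : BorelSpace (HS E F) := ⟨rfl⟩

/-- The outer product `g ⊗ h` as a Hilbert--Schmidt operator. -/
def HS.outer (g : E) (h : F) : HS E F :=
  ⟨GHCM.outer g h, (mem_hsSubmodule_iff (stdBasis E) _).2 (by
    simp_rw [outer_apply, enorm_smul, mul_pow, ENNReal.tsum_mul_right,
      tsum_enorm_inner_sq]
    simp [ENNReal.mul_eq_top])⟩

end HilbertSchmidt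

/-! ### Trace norm -/

section TraceNorm

variable {K : Type*} [NormedAddCommGroup K] [InnerProductSpace ℝ K]

/-- The trace norm of a bounded operator: the supremum of `∑ |⟪A e_i, f_i⟫|` over finite
orthonormal families `(e_i)`, `(f_i)`. By `traceNorm_eq_tsum_singularValues` it is the sum of the
singular values whenever `A` has a singular value decomposition. -/
def traceNorm (A : K →L[ℝ] K) : ℝ≥0∞ :=
  ⨆ (N : ℕ) (e : Fin N → K) (f : Fin N → K) (_ : Orthonormal ℝ e) (_ : Orthonormal ℝ f),
    ∑ i, ‖⟪A (e i), f i⟫‖ₑ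

lemma traceNorm_eq_tsum_singularValues {ι : Type*} (A : K →L[ℝ] K) (e f : ι → K) (s : ι → ℝ≥0)
    (he : Orthonormal ℝ e) (hf : Orthonormal ℝ f)
    (hA : ∀ x, HasSum (fun k => (s k : ℝ) • ⟪e k, x⟫ • f k) (A x)) :
    traceNorm A = ∑' k, (s k : ℝ≥0∞) := by
  classical
  have hAe : ∀ k, A (e k) = (s k : ℝ) • f k := fun k => by
    refine (hA (e k)).unique ?_
    have := hasSum_single (f := fun j => (s j : ℝ) • ⟪e j, e k⟫ • f j) k (fun j hj => by
      simp [orthonormal_iff_ite.1 he, hj])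
    simpa [orthonormal_iff_ite.1 he, he.1 k] using this
  apply le_antisymm
  · refine iSup_le fun N => iSup_le fun u => iSup_le fun w => iSup_le fun hu => iSup_le fun hw => ?_
    have hterm : ∀ i, ‖⟪A (u i), w i⟫‖ₑ
        ≤ ∑' k, (s k : ℝ≥0∞) * ENNReal.ofReal (|⟪u i, e k⟫| * |⟪w i, f k⟫|) := fun i => by
      have h1 : HasSum (fun k => (s k : ℝ) * (⟪e k, u i⟫ * ⟪f k, w i⟫)) ⟪A (u i), w i⟫ := by
        have h := (innerSL ℝ (w i)).hasSum (hA (u i))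
        have h0 : innerSL ℝ (w i) (A (u i)) = ⟪A (u i), w i⟫ := by
          rw [innerSL_apply_apply, real_inner_comm]
        rw [h0] at h
        refine h.congr_fun ?_
        intro k
        simp [real_inner_comm]
      rw [← h1.tsum_eq]
      refine (enorm_tsum_le_tsum_enorm).trans (le_of_eq ?_)
      refine tsum_congr fun k => ?_
      rw [enorm_mul, enorm_mul, real_inner_comm, real_inner_comm (w i),
        ENNReal.ofReal_mul (abs_nonneg _), ← Real.enorm_eq_ofReal_abs, ← Real.enorm_eq_ofReal_abs]
      congr 1
      simp [Real.enorm_eq_ofReal_abs]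
    calc ∑ i, ‖⟪A (u i), w i⟫‖ₑ
        ≤ ∑ i, ∑' k, (s k : ℝ≥0∞) * ENNReal.ofReal (|⟪u i, e k⟫| * |⟪w i, f k⟫|) :=
          Finset.sum_le_sum fun i _ => hterm i
      _ = ∑' k, ∑ i, (s k : ℝ≥0∞) * ENNReal.ofReal (|⟪u i, e k⟫| * |⟪w i, f k⟫|) :=
          (Summable.tsum_finsetSum fun _ _ => ENNReal.summable).symm
      _ ≤ ∑' k, (s k : ℝ≥0∞) := by
          refine ENNReal.tsum_le_tsum fun k => ?_
          rw [← Finset.mul_sum, ← ENNReal.ofReal_sum_of_nonneg fun i _ => by positivity]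
          refine mul_le_of_le_one_right zero_le (ENNReal.ofReal_le_one.2 ?_)
          have b1 := hu.sum_inner_products_le (x := e k) (s := Finset.univ)
          have b2 := hw.sum_inner_products_le (x := f k) (s := Finset.univ)
          rw [he.1 k] at b1
          rw [hf.1 k] at b2
          simp only [Real.norm_eq_abs, sq_abs] at b1 b2
          calc ∑ i, |⟪u i, e k⟫| * |⟪w i, f k⟫|
              ≤ ∑ i, (⟪u i, e k⟫ ^ 2 + ⟪w i, f k⟫ ^ 2) / 2 := by
                refine Finset.sum_le_sum fun i _ => ?_
                rw [← sq_abs ⟪u i, e k⟫, ← sq_abs ⟪w i, f k⟫]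
                nlinarith [sq_nonneg (|⟪u i, e k⟫| - |⟪w i, f k⟫|)]
            _ ≤ 1 := by
                rw [← Finset.sum_div, Finset.sum_add_distrib]
                linarith
  · rw [ENNReal.tsum_eq_iSup_sum]
    refine iSup_le fun t => ?_
    have hinj : Function.Injective fun i : Fin t.card => (t.equivFin.symm i : ι) :=
      Subtype.val_injective.comp t.equivFin.symm.injective
    refine le_trans (le_of_eq ?_) (le_iSup_of_le t.card (le_iSup_of_le
      (fun i => e (t.equivFin.symm i)) (le_iSup_of_le (fun i => f (t.equivFin.symm i))
      (le_iSup_of_le (he.comp _ hinj) (le_iSup_of_le (hf.comp _ hinj) le_rfl)))))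
    rw [← Finset.sum_coe_sort t, ← t.equivFin.symm.sum_comp]
    refine Finset.sum_congr rfl fun i _ => ?_
    rw [hAe, real_inner_smul_left, orthonormal_iff_ite.1 hf, if_pos rfl, mul_one]
    simp

end TraceNorm

/-! ### Uniform stochastic convergence -/

section Convergence

/-- The bounded Lipschitz distance: the supremum of `|∫ φ dμ - ∫ φ dν|` over all
`φ : B → [-1, 1]` that are Lipschitz with constant at most `1`. -/
def dBL {B : Type*} [NormedAddCommGroup B] [MeasurableSpace B] (μ ν : Measure B) : ℝ≥0∞ :=
  ⨆ (φ : B → ℝ) (_ : LipschitzWith 1 φ) (_ : ∀ x, |φ x| ≤ 1),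
    ENNReal.ofReal |∫ x, φ x ∂μ - ∫ x, φ x ∂ν|

variable {Θ Ω : Type*} [MeasurableSpace Ω]

/-- The random variables `T n`, under the measures `Pr θ`, converge in distribution to `ν θ`
uniformly over `θ ∈ S`. -/
def UnifTendstoInDistribution {B : Type*} [NormedAddCommGroup B] [MeasurableSpace B]
    (S : Set Θ) (Pr : Θ → Measure Ω) (T : ℕ → Ω → B) (ν : Θ → Measure B) : Prop :=
  Tendsto (fun n => ⨆ θ ∈ S, dBL ((Pr θ).map (T n)) (ν θ)) atTop (𝓝 0)

/-- The nonnegative random variables `D n θ`, under the measures `Pr θ`, converge to `0` in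
probability uniformly over `θ ∈ S`. -/
def UnifTendstoZeroInProb (S : Set Θ) (Pr : Θ → Measure Ω) (D : ℕ → Θ → Ω → ℝ≥0∞) : Prop :=
  ∀ δ : ℝ, 0 < δ →
    Tendsto (fun n => ⨆ θ ∈ S, Pr θ {ω | ENNReal.ofReal δ ≤ D n θ ω}) atTop (𝓝 0)

/-- Under `Pr`, the `W i` are i.i.d. copies of a random element with distribution `P`. -/
def IsIIDSample {S : Type*} [MeasurableSpace S] (Pr : Measure Ω) (W : ℕ → Ω → S) (P : Measure S) :
    Prop :=
  (∀ i, Measurable (W i)) ∧ iIndepFun W Pr ∧ ∀ i, Pr.map (W i) = P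

end Convergence

/-- `μ` is the Gaussian distribution `N(0, C)` on the Hilbert space `H`. -/
def IsCenteredGaussian {H : Type*} [NormedAddCommGroup H] [InnerProductSpace ℝ H] [CompleteSpace H]
    [MeasurableSpace H] [BorelSpace H] (C : H →L[ℝ] H) (μ : Measure H) : Prop :=
  IsGaussian μ ∧ ∫ x, x ∂μ = 0 ∧ covarianceOperator μ = C

/-! ### The model: conditional means, conditional variances, errors -/

section Model

variable {HX HY 𝒵 : Type*}
  [NormedAddCommGroup HX] [InnerProductSpace ℝ HX] [CompleteSpace HX]
  [SecondCountableTopology HX] [MeasurableSpace HX] [BorelSpace HX]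
  [NormedAddCommGroup HY] [InnerProductSpace ℝ HY] [CompleteSpace HY]
  [SecondCountableTopology HY] [MeasurableSpace HY] [BorelSpace HY]
  [MeasurableSpace 𝒵]

/-- `X` and `Y` are conditionally independent given `Z` when `(X, Y, Z)` has distribution `P`. -/
def CondIndepGiven (P : Measure (HX × HY × 𝒵)) : Prop :=
  ∀ (φ : HX → ℝ) (ψ : HY → ℝ), Measurable φ → Measurable ψ →
    (∃ c, ∀ x, |φ x| ≤ c) → (∃ c, ∀ y, |ψ y| ≤ c) →
    P[fun w => φ w.1 * ψ w.2.1 | MeasurableSpace.comap (fun w => w.2.2) inferInstance] =ᵐ[P]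
      P[fun w => φ w.1 | MeasurableSpace.comap (fun w => w.2.2) inferInstance] *
      P[fun w => ψ w.2.1 | MeasurableSpace.comap (fun w => w.2.2) inferInstance]

/-- The regression function `f_P(z) = E_P(X | Z = z)`. -/
def fReg (P : ProbabilityMeasure (HX × HY × 𝒵)) (z : 𝒵) : HX :=
  ∫ x, x ∂(condDistrib (fun w : HX × HY × 𝒵 => w.1) (fun w => w.2.2) (P : Measure _) z)

/-- The regression function `g_P(z) = E_P(Y | Z = z)`. -/
def gReg (P : ProbabilityMeasure (HX × HY × 𝒵)) (z : 𝒵) : HY :=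
  ∫ y, y ∂(condDistrib (fun w : HX × HY × 𝒵 => w.2.1) (fun w => w.2.2) (P : Measure _) z)

/-- The error `ε_P = X - f_P(Z)`. -/
def eps (P : ProbabilityMeasure (HX × HY × 𝒵)) (w : HX × HY × 𝒵) : HX := w.1 - fReg P w.2.2

/-- The error `ξ_P = Y - g_P(Z)`. -/
def xi (P : ProbabilityMeasure (HX × HY × 𝒵)) (w : HX × HY × 𝒵) : HY := w.2.1 - gReg P w.2.2

/-- The conditional variance `u_P(z) = E_P(‖ε_P‖² | Z = z)`, with values in `[0, ∞]`. -/
def uVar (P : ProbabilityMeasure (HX × HY × 𝒵)) (z : 𝒵) : ℝ≥0∞ :=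
  ∫⁻ x, ‖x - fReg P z‖ₑ ^ 2
    ∂(condDistrib (fun w : HX × HY × 𝒵 => w.1) (fun w => w.2.2) (P : Measure _) z)

/-- The conditional variance `v_P(z) = E_P(‖ξ_P‖² | Z = z)`, with values in `[0, ∞]`. -/
def vVar (P : ProbabilityMeasure (HX × HY × 𝒵)) (z : 𝒵) : ℝ≥0∞ :=
  ∫⁻ y, ‖y - gReg P z‖ₑ ^ 2
    ∂(condDistrib (fun w : HX × HY × 𝒵 => w.2.1) (fun w => w.2.2) (P : Measure _) z)

/-- The covariance operator `C_P = E_P[(ε_P ⊗ ξ_P) ⊗ (ε_P ⊗ ξ_P)]` on the space of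
Hilbert--Schmidt operators from `HX` to `HY`. -/
def covP (P : ProbabilityMeasure (HX × HY × 𝒵)) : HS HX HY →L[ℝ] HS HX HY :=
  ∫ w, outer (HS.outer (eps P w) (xi P w)) (HS.outer (eps P w) (xi P w)) ∂(P : Measure _)

end Model

/-! ### The statistics -/

section Statistics

/-- A regression method: for each `n`, it maps responses `(h_1, …, h_n)` and covariates
`(z_1, …, z_n)` to an estimated regression function. -/
abbrev RegressionMethod (𝒵 H : Type*) := (n : ℕ) → (Fin n → H) → (Fin n → 𝒵) → 𝒵 → H

variable {H 𝒵 : Type*} [NormedAddCommGroup H]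

/-- The fitted values of the regression method are measurable functions of the data. -/
def RegressionMethod.IsMeasurable [MeasurableSpace H] [MeasurableSpace 𝒵]
    (r : RegressionMethod 𝒵 H) : Prop :=
  ∀ (n : ℕ) (i : Fin n), Measurable fun d : (Fin n → H) × (Fin n → 𝒵) => r n d.1 d.2 (d.2 i)

/-- The in-sample mean squared prediction error
`n⁻¹ ∑ ‖h(z_i) - ĥ(z_i)‖²` of the estimate `ĥ` of `h`. -/
def mspe (r : RegressionMethod 𝒵 H) (h : 𝒵 → H) (n : ℕ) (x : Fin n → H) (z : Fin n → 𝒵) : ℝ≥0∞ :=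
  (∑ i, ‖h (z i) - r n x z (z i)‖ₑ ^ 2) / n

/-- The weighted in-sample mean squared prediction error
`n⁻¹ ∑ ‖h(z_i) - ĥ(z_i)‖² a(z_i)` of the estimate `ĥ` of `h`. -/
def wmspe (r : RegressionMethod 𝒵 H) (h : 𝒵 → H) (a : 𝒵 → ℝ≥0∞) (n : ℕ) (x : Fin n → H)
    (z : Fin n → 𝒵) : ℝ≥0∞ :=
  (∑ i, ‖h (z i) - r n x z (z i)‖ₑ ^ 2 * a (z i)) / n

variable {HX HY Ω : Type*}
  [NormedAddCommGroup HX] [InnerProductSpace ℝ HX] [CompleteSpace HX]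
  [NormedAddCommGroup HY] [InnerProductSpace ℝ HY] [CompleteSpace HY]

/-- The first `n` observations `x_1, …, x_n` of the `X`-component. -/
def xData (W : ℕ → Ω → HX × HY × 𝒵) (n : ℕ) (ω : Ω) : Fin n → HX := fun i => (W i ω).1

/-- The first `n` observations `y_1, …, y_n` of the `Y`-component. -/
def yData (W : ℕ → Ω → HX × HY × 𝒵) (n : ℕ) (ω : Ω) : Fin n → HY := fun i => (W i ω).2.1

/-- The first `n` observations `z_1, …, z_n` of the `Z`-component. -/
def zData (W : ℕ → Ω → HX × HY × 𝒵) (n : ℕ) (ω : Ω) : Fin n → 𝒵 := fun i => (W i ω).2.2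

/-- The residual `h_i - ĥ(z_i)`. -/
def resid (r : RegressionMethod 𝒵 H) (n : ℕ) (x : Fin n → H) (z : Fin n → 𝒵) (i : Fin n) : H :=
  x i - r n x z (z i)

variable (fhat : RegressionMethod 𝒵 HX) (ghat : RegressionMethod 𝒵 HY)
  (W : ℕ → Ω → HX × HY × 𝒵)

/-- `R_i = ε̂_i ⊗ ξ̂_i`, the outer product of the `i`th residuals of the two regressions. -/
def scrR (n : ℕ) (ω : Ω) (i : Fin n) : HS HX HY :=
  HS.outer (resid fhat n (xData W n ω) (zData W n ω) i)
    (resid ghat n (yData W n ω) (zData W n ω) i)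

/-- The mean of `R_1, …, R_n`. -/
def scrRbar (n : ℕ) (ω : Ω) : HS HX HY := (n : ℝ)⁻¹ • ∑ i, scrR fhat ghat W n ω i

/-- The operator-valued test statistic: `√n` times the mean of `R_1, …, R_n`. -/
def scrT (n : ℕ) (ω : Ω) : HS HX HY := √(n : ℝ) • scrRbar fhat ghat W n ω

/-- The empirical covariance operator of `R_1, …, R_n`. -/
def scrChat (n : ℕ) (ω : Ω) : HS HX HY →L[ℝ] HS HX HY :=
  ((n : ℝ) - 1)⁻¹ • ∑ i, outer (scrR fhat ghat W n ω i - scrRbar fhat ghat W n ω)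
    (scrR fhat ghat W n ω i - scrRbar fhat ghat W n ω)

end Statistics

/-- The index set `{1, …, d}`, or `{1, 2, …}` if `d = ∞`. -/
abbrev Idx (d : ℕ∞) : Type := {i : ℕ // 1 ≤ i ∧ (i : ℕ∞) ≤ d}

end GHCM

end

noncomputable section

namespace GHCM

/-! ### Algebra and topology of outer products in the Hilbert–Schmidt space. -/

section HilbertSchmidt

variable {E F : Type*}
  [NormedAddCommGroup E] [InnerProductSpace ℝ E] [CompleteSpace E]
  [NormedAddCommGroup F] [InnerProductSpace ℝ F] [CompleteSpace F]

/-! Put `a_i = f_P(z_i) - f̂(z_i)`, `b_i = g_P(z_i) - ĝ(z_i)` and `V_i = ε_i ⊗ ξ_i`. Then `R_i =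
(ε_i + a_i) ⊗ (ξ_i + b_i)`, so `R_i - V_i = a_i ⊗ ξ_i + ε_i ⊗ b_i + a_i ⊗ b_i`. The proof shows that
replacing `R_i` by `V_i` is harmless, and that the i.i.d. elements `V_i` of the separable Hilbert
space `HS` obey a central limit theorem and a trace norm law of large numbers, all uniformly over
the model.

Replacement. By Cauchy–Schwarz the terms `a_i ⊗ b_i` contribute at most `n M^f M^g` to `n⁻¹ ‖∑ (R_i
- V_i)‖²`, up to a constant. In `a_i ⊗ ξ_i` the factor `a_i` is a function of the `x`'s and `z`'s
alone; given these, the `ξ_i` are independent and centred with conditional variances `v_P(z_i)`, so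
the conditional second moment of `n^{-1/2} ∑ a_i ⊗ ξ_i` is the weighted prediction error. This is
carried out without conditioning on part of the sample: conditional independence says exactly that
redrawing `y_i` from its conditional law given `z_i` leaves the law of the sample unchanged
(`lintegral_condDistrib_of_condIndep`, `ResampleInvariant.lintegral_pi`). Redrawing kills the cross
terms and turns `‖ξ_i‖²` into `v_P(z_i)`. As the weighted error is small only in probability,
moments are taken on the event that it is at most `c`, which redrawing preserves
(`UnifTendstoZeroInProb.noise`). The terms `ε_i ⊗ b_i` follow by exchanging `X` and `Y`. The same
argument bounds `n⁻¹ ∑ ‖R_i - V_i‖²`.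

Central limit theorem. The mean of `V_i` vanishes, again by redrawing. The moment bound gives a
rate, the same for all `P`, at which the characteristic functions of the normalized sums approach
`exp (-⟪C_P t, t⟫ / 2)`. The tail condition, read in the basis `e_i ⊗ f_j` of `HS`, makes the laws
of all normalized sums one tight family, hence relatively compact. Limits along ultrafilters of
these laws and of the Gaussian laws have the same characteristic function, hence agree; this yields
uniformity in the bounded Lipschitz distance, and the Gaussian laws themselves arise as such limits
(`UnifCentredMoments.exists_gaussian_limit`).

Covariance. For `V_i ⊗ V_i`, finitely many coordinates obey a weak law by truncation, and the
remaining ones are small in mean in trace norm by the tail condition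
(`UnifCentredMoments.unifTendstoZeroInProb_traceNorm`). The passage to `R_i` and the centring by the
empirical mean cost only vanishing terms. -/

lemma HS.ext_toCLM {A B : HS E F} (h : A.toCLM = B.toCLM) : A = B := Subtype.ext h

lemma HS.toCLM_outer (g : E) (h : F) : (HS.outer g h).toCLM = GHCM.outer g h := rfl

lemma HS.toCLM_sub (A B : HS E F) : (A - B).toCLM = A.toCLM - B.toCLM := rfl

lemma HS.toCLM_add (A B : HS E F) : (A + B).toCLM = A.toCLM + B.toCLM := rfl

lemma HS.outer_add_left (g g' : E) (h : F) :
    HS.outer (g + g') h = HS.outer g h + HS.outer g' h := by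
  refine HS.ext_toCLM (ContinuousLinearMap.ext fun x => ?_)
  simp [HS.toCLM_add, HS.toCLM_outer, outer_apply, inner_add_right, add_smul]

lemma HS.outer_add_right (g : E) (h h' : F) :
    HS.outer g (h + h') = HS.outer g h + HS.outer g h' := by
  refine HS.ext_toCLM (ContinuousLinearMap.ext fun x => ?_)
  simp [HS.toCLM_add, HS.toCLM_outer, outer_apply]

lemma HS.outer_sub_left (g g' : E) (h : F) :
    HS.outer (g - g') h = HS.outer g h - HS.outer g' h := by
  rw [eq_sub_iff_add_eq, ← HS.outer_add_left, sub_add_cancel]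

lemma HS.outer_sub_right (g : E) (h h' : F) :
    HS.outer g (h - h') = HS.outer g h - HS.outer g h' := by
  rw [eq_sub_iff_add_eq, ← HS.outer_add_right, sub_add_cancel]

/-- Expand `g` in the basis that defines the inner product: both sides are `∑ ⟪e_i, g⟫ ⟪A e_i, h⟫`.
-/
lemma HS.inner_outer_right (A : HS E F) (g : E) (h : F) :
    ⟪A, HS.outer g h⟫ = ⟪A.toCLM g, h⟫ := by
  have h1 : HasSum (fun i => ⟪A.toCLM (stdBasis E i), (HS.outer g h).toCLM (stdBasis E i)⟫)
      ⟪A, HS.outer g h⟫ := lp.hasSum_inner (HS.toLp E F A) (HS.toLp E F (HS.outer g h))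
  refine h1.unique ?_
  have h2 := (innerSL ℝ h).hasSum (A.toCLM.hasSum ((stdBasis E).hasSum_repr g))
  simp only [innerSL_apply_apply] at h2
  rw [real_inner_comm]
  refine h2.congr_fun fun i => ?_
  simp [HS.toCLM_outer, outer_apply, HilbertBasis.repr_apply_apply, inner_smul_right,
    real_inner_comm]

lemma HS.inner_outer_outer (g g' : E) (h h' : F) :
    ⟪HS.outer g h, HS.outer g' h'⟫ = ⟪g, g'⟫ * ⟪h, h'⟫ := by
  rw [HS.inner_outer_right, HS.toCLM_outer, outer_apply, inner_smul_left, real_inner_comm]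
  simp

lemma HS.norm_outer (g : E) (h : F) : ‖HS.outer g h‖ = ‖g‖ * ‖h‖ := by
  have h1 : ‖HS.outer g h‖ ^ 2 = (‖g‖ * ‖h‖) ^ 2 := by
    rw [← real_inner_self_eq_norm_sq, HS.inner_outer_outer, real_inner_self_eq_norm_sq,
      real_inner_self_eq_norm_sq, mul_pow]
  exact (pow_left_inj₀ (norm_nonneg _) (by positivity) two_ne_zero).1 h1

lemma HS.enorm_outer (g : E) (h : F) : ‖HS.outer g h‖ₑ = ‖g‖ₑ * ‖h‖ₑ := by
  rw [← ofReal_norm, HS.norm_outer, ENNReal.ofReal_mul (norm_nonneg _), ofReal_norm, ofReal_norm]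

/-- Bilinear splitting into `(g' - g) ⊗ h'` and `g ⊗ (h' - h)`. Measurability of products of random
elements is derived from this continuity through strong measurability, which does not presuppose
that `HS` is separable. -/
lemma HS.continuous_outer : Continuous fun p : E × F => HS.outer p.1 p.2 := by
  rw [continuous_iff_continuousAt]
  rintro ⟨g, h⟩
  rw [ContinuousAt, tendsto_iff_norm_sub_tendsto_zero]
  have hle : ∀ p : E × F, ‖HS.outer p.1 p.2 - HS.outer g h‖ ≤
      ‖p.1 - g‖ * ‖p.2‖ + ‖g‖ * ‖p.2 - h‖ := fun p => by
    rw [← HS.norm_outer, ← HS.norm_outer]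
    refine le_trans (le_of_eq ?_) (norm_add_le _ _)
    rw [HS.outer_sub_left, HS.outer_sub_right, sub_add_sub_cancel]
  refine squeeze_zero (fun _ => norm_nonneg _) hle ?_
  have : Continuous fun p : E × F => ‖p.1 - g‖ * ‖p.2‖ + ‖g‖ * ‖p.2 - h‖ := by fun_prop
  simpa using this.tendsto (g, h)

/-- The operators `e_i ⊗ f_j` form an orthonormal basis of the Hilbert–Schmidt operators. -/
lemma HS.exists_hilbertBasis_outer {ι κ : Type*} (b : HilbertBasis ι ℝ E)
    (c : HilbertBasis κ ℝ F) :
    ∃ B : HilbertBasis (ι × κ) ℝ (HS E F), ∀ p, B p = HS.outer (b p.1) (c p.2) := by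
  classical
  have ho : Orthonormal ℝ fun p : ι × κ => HS.outer (b p.1) (c p.2) := by
    rw [orthonormal_iff_ite]
    rintro ⟨i, j⟩ ⟨i', j'⟩
    rw [HS.inner_outer_outer, orthonormal_iff_ite.1 b.orthonormal,
      orthonormal_iff_ite.1 c.orthonormal]
    by_cases h1 : i = i' <;> by_cases h2 : j = j' <;> simp [h1, h2]
  -- An operator orthogonal to every `e_i ⊗ f_j` has all matrix entries zero, so it kills a basis.
  have hbot : (Submodule.span ℝ (Set.range fun p : ι × κ => HS.outer (b p.1) (c p.2)))ᗮ = ⊥ := by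
    rw [Submodule.eq_bot_iff]
    intro A hA
    have hA' : ∀ i j, ⟪A.toCLM (b i), c j⟫ = 0 := fun i j => by
      rw [← HS.inner_outer_right, real_inner_comm]
      exact hA _ (Submodule.subset_span ⟨(i, j), rfl⟩)
    have hz : ∀ i, A.toCLM (b i) = 0 := fun i => by
      have := c.hasSum_repr (A.toCLM (b i))
      simp_rw [HilbertBasis.repr_apply_apply, real_inner_comm, hA', zero_smul] at this
      exact this.unique hasSum_zero
    refine HS.ext_toCLM (ContinuousLinearMap.ext fun x => ?_)
    have := A.toCLM.hasSum (b.hasSum_repr x)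
    simp only [map_smul, hz, smul_zero] at this
    exact this.unique hasSum_zero
  exact ⟨HilbertBasis.mkOfOrthogonalEqBot ho hbot, fun p => by
    rw [HilbertBasis.coe_mkOfOrthogonalEqBot]⟩

/-- Supplies separability of `HS` from its countable basis of outer products; tightness and weak
convergence there depend on it. -/
lemma secondCountableTopology_of_hilbertBasis {ι : Type*} [Countable ι] (b : HilbertBasis ι ℝ E) :
    SecondCountableTopology E := by
  have h : TopologicalSpace.IsSeparable (Set.univ : Set E) := by
    have h1 := ((Set.countable_range b).isSeparable.span (R := ℝ)).closure
    have h2 := b.dense_span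
    rw [← Submodule.topologicalClosure_coe, h2] at h1
    exact h1
  have := TopologicalSpace.isSeparable_univ_iff.1 h
  exact UniformSpace.secondCountable_of_separable E

lemma enorm_inner_le (x y : E) : ‖⟪x, y⟫‖ₑ ≤ ‖x‖ₑ * ‖y‖ₑ := by
  rw [← ofReal_norm, ← ofReal_norm, ← ofReal_norm, ← ENNReal.ofReal_mul (norm_nonneg _)]
  exact ENNReal.ofReal_le_ofReal (norm_inner_le_norm x y)

end HilbertSchmidt

/-! ### Trace norm estimates. -/

section TraceNorm

variable {K : Type*} [NormedAddCommGroup K] [InnerProductSpace ℝ K]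

lemma traceNorm_le {A : K →L[ℝ] K} {c : ℝ≥0∞}
    (h : ∀ (N : ℕ) (e f : Fin N → K), Orthonormal ℝ e → Orthonormal ℝ f →
      ∑ i, ‖⟪A (e i), f i⟫‖ₑ ≤ c) : traceNorm A ≤ c :=
  iSup_le fun N => iSup_le fun e => iSup_le fun f => iSup_le fun he => iSup_le fun hf =>
    h N e f he hf

lemma le_traceNorm (A : K →L[ℝ] K) {N : ℕ} {e f : Fin N → K} (he : Orthonormal ℝ e)
    (hf : Orthonormal ℝ f) : ∑ i, ‖⟪A (e i), f i⟫‖ₑ ≤ traceNorm A :=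
  le_iSup_of_le N (le_iSup_of_le e (le_iSup_of_le f (le_iSup_of_le he (le_iSup_of_le hf le_rfl))))

lemma traceNorm_add_le (A B : K →L[ℝ] K) : traceNorm (A + B) ≤ traceNorm A + traceNorm B := by
  refine traceNorm_le fun N e f he hf => ?_
  refine le_trans ?_ (add_le_add (le_traceNorm A he hf) (le_traceNorm B he hf))
  rw [← Finset.sum_add_distrib]
  refine Finset.sum_le_sum fun i _ => ?_
  rw [add_apply, inner_add_left]
  exact enorm_add_le _ _

lemma traceNorm_zero : traceNorm (0 : K →L[ℝ] K) = 0 :=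
  le_antisymm (traceNorm_le fun N e f _ _ => by simp) zero_le

lemma traceNorm_smul_le (c : ℝ) (A : K →L[ℝ] K) : traceNorm (c • A) ≤ ‖c‖ₑ * traceNorm A := by
  refine traceNorm_le fun N e f he hf => ?_
  refine le_trans (le_of_eq ?_) (mul_le_mul_right (le_traceNorm A he hf) _)
  rw [Finset.mul_sum]
  refine Finset.sum_congr rfl fun i _ => ?_
  rw [smul_apply, inner_smul_left, enorm_mul]
  simp

lemma traceNorm_sub_le (A B : K →L[ℝ] K) : traceNorm (A - B) ≤ traceNorm A + traceNorm B := by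
  have h := traceNorm_add_le A ((-1 : ℝ) • B)
  have h' := traceNorm_smul_le (-1 : ℝ) B
  rw [neg_one_smul, ← sub_eq_add_neg] at h
  refine h.trans (add_le_add le_rfl ?_)
  simpa using h'

lemma traceNorm_sum_le {ι : Type*} (s : Finset ι) (A : ι → K →L[ℝ] K) :
    traceNorm (∑ i ∈ s, A i) ≤ ∑ i ∈ s, traceNorm (A i) :=
  Finset.le_sum_of_subadditive _ traceNorm_zero.le traceNorm_add_le _ _

variable [CompleteSpace K]

/-- Cauchy–Schwarz over the finite families, then Bessel's inequality for each of them. -/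
lemma traceNorm_outer_le (g h : K) : traceNorm (outer g h) ≤ ‖g‖ₑ * ‖h‖ₑ := by
  refine traceNorm_le fun N e f he hf => ?_
  have h1 : ∑ i, ‖⟪outer g h (e i), f i⟫‖ ≤ ‖g‖ * ‖h‖ := by
    have e1 := he.sum_inner_products_le (x := g) (s := Finset.univ)
    have e2 := hf.sum_inner_products_le (x := h) (s := Finset.univ)
    have e3 : ∀ i, ‖⟪outer g h (e i), f i⟫‖ = ‖⟪e i, g⟫‖ * ‖⟪f i, h⟫‖ := fun i => by
      rw [outer_apply, inner_smul_left, norm_mul, real_inner_comm h]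
      simp
    simp_rw [e3]
    refine (Real.sum_mul_le_sqrt_mul_sqrt _ _ _).trans ?_
    refine mul_le_mul ?_ ?_ (Real.sqrt_nonneg _) (norm_nonneg _)
    · exact Real.sqrt_le_iff.2 ⟨norm_nonneg _, e1⟩
    · exact Real.sqrt_le_iff.2 ⟨norm_nonneg _, e2⟩
  calc ∑ i, ‖⟪outer g h (e i), f i⟫‖ₑ
      = ENNReal.ofReal (∑ i, ‖⟪outer g h (e i), f i⟫‖) := by
        rw [ENNReal.ofReal_sum_of_nonneg fun i _ => norm_nonneg _]
        simp_rw [ofReal_norm]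
    _ ≤ ENNReal.ofReal (‖g‖ * ‖h‖) := ENNReal.ofReal_le_ofReal h1
    _ = ‖g‖ₑ * ‖h‖ₑ := by rw [ENNReal.ofReal_mul (norm_nonneg _), ofReal_norm, ofReal_norm]

lemma outer_sub_left (g g' h : K) : outer (g - g') h = outer g h - outer g' h := by
  ext x; simp [outer_apply, inner_sub_right, sub_smul]

lemma outer_sub_right (g h h' : K) : outer g (h - h') = outer g h - outer g h' := by
  ext x; simp [outer_apply, smul_sub]

lemma outer_smul_left (c : ℝ) (g h : K) : outer (c • g) h = c • outer g h := by
  ext x; simp [outer_apply, inner_smul_right, mul_smul]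

lemma outer_smul_right (c : ℝ) (g h : K) : outer g (c • h) = c • outer g h := by
  ext x; simp [outer_apply, smul_comm c]

lemma outer_sum_left {ι : Type*} (s : Finset ι) (g : ι → K) (h : K) :
    outer (∑ i ∈ s, g i) h = ∑ i ∈ s, outer (g i) h := by
  ext x; simp [outer_apply, inner_sum, Finset.sum_smul]

lemma outer_sum_right {ι : Type*} (s : Finset ι) (g : K) (h : ι → K) :
    outer g (∑ i ∈ s, h i) = ∑ i ∈ s, outer g (h i) := by
  ext x; simp [outer_apply, Finset.smul_sum]

lemma norm_outer_le (g h : K) : ‖outer g h‖ ≤ ‖g‖ * ‖h‖ := by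
  refine ContinuousLinearMap.opNorm_le_bound _ (by positivity) fun x => ?_
  rw [outer_apply, norm_smul]
  have := norm_inner_le_norm (𝕜 := ℝ) x g
  nlinarith [norm_nonneg h, norm_nonneg x, norm_nonneg g]

lemma continuous_outer_self : Continuous fun x : K => outer x x := by
  unfold outer
  fun_prop

/-- Telescoping: `u ⊗ u - w ⊗ w = (u - w) ⊗ u + w ⊗ (u - w)`. -/
lemma traceNorm_outer_self_sub_le (u w : K) :
    traceNorm (outer u u - outer w w) ≤ ‖u - w‖ₑ * (‖u‖ₑ + ‖w‖ₑ) := by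
  have : outer u u - outer w w = outer (u - w) u + outer w (u - w) := by
    rw [outer_sub_left, outer_sub_right]; abel
  rw [this, mul_add, mul_comm _ ‖w‖ₑ]
  exact (traceNorm_add_le _ _).trans
    (add_le_add (traceNorm_outer_le _ _) (traceNorm_outer_le _ _))

/-- The trace norm of an integral of operators is at most the integral of the trace norms. -/
lemma traceNorm_integral_le {α : Type*} [MeasurableSpace α] {μ : Measure α} {A : α → K →L[ℝ] K}
    {G : α → ℝ≥0∞} (hA : Integrable A μ) (hG : ∀ a, traceNorm (A a) ≤ G a) :
    traceNorm (∫ a, A a ∂μ) ≤ ∫⁻ a, G a ∂μ := by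
  refine traceNorm_le fun N e f he hf => ?_
  have hi : ∀ i, Integrable (fun a => ⟪A a (e i), f i⟫) μ := fun i =>
    (hA.apply_continuousLinearMap (e i)).inner_const (f i)
  have h1 : ∀ i, ⟪(∫ a, A a ∂μ) (e i), f i⟫ = ∫ a, ⟪A a (e i), f i⟫ ∂μ := fun i => by
    rw [ContinuousLinearMap.integral_apply hA, real_inner_comm, ← integral_inner]
    · simp_rw [real_inner_comm]
    · exact hA.apply_continuousLinearMap (e i)
  calc ∑ i, ‖⟪(∫ a, A a ∂μ) (e i), f i⟫‖ₑ
      ≤ ∑ i, ∫⁻ a, ‖⟪A a (e i), f i⟫‖ₑ ∂μ := Finset.sum_le_sum fun i _ => by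
        rw [h1]; exact enorm_integral_le_lintegral_enorm _
    _ = ∫⁻ a, ∑ i, ‖⟪A a (e i), f i⟫‖ₑ ∂μ :=
        (lintegral_finsetSum' _ fun i _ => (hi i).1.enorm).symm
    _ ≤ ∫⁻ a, G a ∂μ := lintegral_mono fun a => (le_traceNorm _ he hf).trans (hG a)

end TraceNorm

/-! ### The bounded Lipschitz distance and weak convergence. -/

section Weak

variable {B : Type*} [NormedAddCommGroup B] [MeasurableSpace B] [BorelSpace B]

lemma abs_integral_sub_le_dBL {μ ν : Measure B} {φ : B → ℝ} (h1 : LipschitzWith 1 φ)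
    (h2 : ∀ x, |φ x| ≤ 1) :
    ENNReal.ofReal |∫ x, φ x ∂μ - ∫ x, φ x ∂ν| ≤ dBL μ ν :=
  le_iSup_of_le φ (le_iSup_of_le h1 (le_iSup_of_le h2 le_rfl))

lemma dBL_le {μ ν : Measure B} {c : ℝ≥0∞} (h : ∀ φ : B → ℝ, LipschitzWith 1 φ → (∀ x, |φ x| ≤ 1) →
    ENNReal.ofReal |∫ x, φ x ∂μ - ∫ x, φ x ∂ν| ≤ c) : dBL μ ν ≤ c :=
  iSup_le fun φ => iSup_le fun h1 => iSup_le fun h2 => h φ h1 h2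

lemma dBL_comm (μ ν : Measure B) : dBL μ ν = dBL ν μ := by
  unfold dBL; simp_rw [abs_sub_comm (∫ x, _ ∂μ)]

lemma dBL_triangle (μ ν ρ : Measure B) : dBL μ ρ ≤ dBL μ ν + dBL ν ρ := by
  refine dBL_le fun φ h1 h2 => ?_
  refine le_trans ?_ (add_le_add (abs_integral_sub_le_dBL h1 h2) (abs_integral_sub_le_dBL h1 h2))
  rw [← ENNReal.ofReal_add (abs_nonneg _) (abs_nonneg _)]
  exact ENNReal.ofReal_le_ofReal (abs_sub_le _ _ _)

/-- Shift `φ` to `φ + 1 ≥ 0` and compare level sets: the `ε`-thickening of `{t ≤ φ + 1}` lies in `{t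
≤ φ + 1 + ε}` because `φ` is 1-Lipschitz. The shift of level costs `ε` and the Lévy–Prokhorov error
costs `ε ‖φ + 1‖ ≤ 2 ε`. -/
lemma integral_le_integral_add_of_levyProkhorovEDist_lt (μ ν : Measure B)
    [IsProbabilityMeasure μ] [IsProbabilityMeasure ν] {ε : ℝ} (hε : 0 < ε)
    (h : levyProkhorovEDist μ ν < ENNReal.ofReal ε) {φ : B → ℝ} (h1 : LipschitzWith 1 φ)
    (h2 : ∀ x, |φ x| ≤ 1) : ∫ x, φ x ∂μ ≤ ∫ x, φ x ∂ν + 3 * ε := by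
  have hb : ∀ (c : ℝ) x, ‖φ x + c‖ ≤ 1 + |c| := fun c x =>
    (abs_add_le _ _).trans (add_le_add (h2 x) le_rfl)
  let f : ℝ → BoundedContinuousFunction B ℝ := fun c =>
    BoundedContinuousFunction.ofNormedAddCommGroup (fun x => φ x + c)
      (h1.continuous.add continuous_const) (1 + |c|) (hb c)
  have fa : ∀ c x, f c x = φ x + c := fun _ _ => rfl
  have hlow : ∀ x, -1 ≤ φ x := fun x => (abs_le.1 (h2 x)).1
  have hint : ∀ ρ : Measure B, IsProbabilityMeasure ρ → ∀ c,
      ∫ x, f c x ∂ρ = ∫ x, φ x ∂ρ + c := fun ρ _ c => by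
    have hφ : Integrable φ ρ := by
      exact Integrable.of_bound h1.continuous.measurable.aestronglyMeasurable 1 (ae_of_all _ h2)
    simp_rw [fa]
    rw [integral_add hφ (integrable_const _)]
    simp
  have hn : ‖f 1‖ ≤ 2 := by
    refine (BoundedContinuousFunction.norm_ofNormedAddCommGroup_le _ (by positivity) _).trans ?_
    norm_num
  have hnn : ‖f 1‖ ≤ ‖f (1 + ε)‖ := by
    refine (BoundedContinuousFunction.norm_le (norm_nonneg _)).2 fun x => ?_
    refine le_trans ?_ ((f (1 + ε)).norm_coe_le_norm x)
    rw [fa, fa, Real.norm_of_nonneg (by linarith [hlow x]),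
      Real.norm_of_nonneg (by linarith [hlow x])]
    linarith
  have key := BoundedContinuousFunction.integral_le_of_levyProkhorovEDist_lt μ ν hε h (f 1)
    (ae_of_all _ fun x => by simp only [Pi.zero_apply, fa]; linarith [hlow x])
  -- Monotonicity in `t` gives both measurability and integrability on the bounded range.
  have hanti : ∀ {A : ℝ → Set B}, Antitone A → Integrable (fun t => ν.real (A t))
      (volume.restrict (Set.Ioc 0 ‖f (1 + ε)‖)) := fun {A} hA => by
    have : Antitone fun t => ν.real (A t) := fun s t hst =>
      measureReal_mono (hA hst)
    refine IntegrableOn.mono_set (t := Set.Icc 0 ‖f (1 + ε)‖) ?_ Set.Ioc_subset_Icc_self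
    exact (this.antitoneOn _).integrableOn_isCompact isCompact_Icc
  have hA1 : Antitone fun t : ℝ => Metric.thickening ε {a | t ≤ f 1 a} := fun s t hst =>
    Metric.thickening_subset_of_subset _ fun a (ha : t ≤ _) => hst.trans ha
  have hA2 : Antitone fun t : ℝ => {a | t ≤ f (1 + ε) a} := fun s t hst a (ha : t ≤ _) =>
    hst.trans ha
  have step : ∫ t in Set.Ioc 0 ‖f 1‖, ν.real (Metric.thickening ε {a | t ≤ f 1 a}) ≤
      ∫ x, f (1 + ε) x ∂ν := by
    rw [BoundedContinuousFunction.integral_eq_integral_meas_le (f (1 + ε)) ν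
      (ae_of_all _ fun x => by simp only [Pi.zero_apply, fa]; linarith [hlow x])]
    refine (setIntegral_mono_set (hanti hA1) (ae_of_all _ fun _ => measureReal_nonneg)
      (LE.le.eventuallyLE (Set.Ioc_subset_Ioc_right hnn))).trans ?_
    refine integral_mono (hanti hA1) (hanti hA2) fun t => ?_
    refine measureReal_mono fun x hx => ?_
    obtain ⟨a, ha, hxa⟩ := Metric.mem_thickening_iff.1 hx
    have := h1.dist_le_mul a x
    rw [NNReal.coe_one, one_mul, Real.dist_eq] at this
    have h3 := (abs_le.1 this).2
    rw [dist_comm] at hxa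
    simp only [Set.mem_ofPred_eq, fa] at ha ⊢
    linarith
  rw [hint μ inferInstance] at key
  rw [hint ν inferInstance] at step
  nlinarith

variable [SecondCountableTopology B]

/-- Weak convergence implies convergence in the bounded Lipschitz distance. -/
lemma tendsto_dBL {ι : Type*} {l : Filter ι} {μ : ι → ProbabilityMeasure B}
    {ν : ProbabilityMeasure B} (h : Tendsto μ l (𝓝 ν)) :
    Tendsto (fun i => dBL (μ i : Measure B) (ν : Measure B)) l (𝓝 0) := by
  have h1 : Tendsto (fun i => levyProkhorovEDist (μ i : Measure B) (ν : Measure B)) l (𝓝 0) := by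
    -- On a separable space weak convergence implies convergence in the Lévy–Prokhorov distance.
    have := (LevyProkhorov.continuous_ofMeasure_probabilityMeasure (Ω := B)).tendsto ν |>.comp h
    exact tendsto_iff_edist_tendsto_0.1 this
  rw [ENNReal.tendsto_nhds_zero]
  intro δ hδ
  obtain ⟨ε, hε, hεδ⟩ : ∃ ε : ℝ, 0 < ε ∧ ENNReal.ofReal (3 * ε) ≤ δ := by
    rcases eq_or_ne δ ∞ with rfl | hδt
    · exact ⟨1, one_pos, le_top⟩
    · refine ⟨δ.toReal / 3, by have := ENNReal.toReal_pos hδ.ne' hδt; positivity, ?_⟩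
      rw [mul_div_cancel₀ _ (by norm_num), ENNReal.ofReal_toReal hδt]
  filter_upwards [(tendsto_order.1 h1).2 _ (ENNReal.ofReal_pos.2 hε)] with i hi
  refine dBL_le fun φ hφ1 hφ2 => le_trans (ENNReal.ofReal_le_ofReal ?_) hεδ
  have e1 := integral_le_integral_add_of_levyProkhorovEDist_lt _ _ hε hi hφ1 hφ2
  rw [levyProkhorovEDist_comm] at hi
  have e2 := integral_le_integral_add_of_levyProkhorovEDist_lt _ _ hε hi hφ1 hφ2
  rw [abs_le]
  constructor <;> linarith

/-- The bounded Lipschitz distance between the laws of two random elements that are close in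
probability. -/
lemma dBL_map_le {Ω : Type*} [MeasurableSpace Ω] {μ : Measure Ω} [IsProbabilityMeasure μ]
    {T T' : Ω → B} (hT : Measurable T) (hT' : Measurable T') (δ : ℝ) :
    dBL (μ.map T) (μ.map T') ≤
      ENNReal.ofReal δ + 2 * μ {ω | ENNReal.ofReal δ ≤ ‖T ω - T' ω‖ₑ} := by
  refine dBL_le fun φ h1 h2 => ?_
  have hφm := h1.continuous.measurable
  rw [integral_map hT.aemeasurable hφm.aestronglyMeasurable,
    integral_map hT'.aemeasurable hφm.aestronglyMeasurable]
  have hi : ∀ {S : Ω → B}, Measurable S → Integrable (fun ω => φ (S ω)) μ := fun hS =>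
    Integrable.of_bound (hφm.comp hS).aestronglyMeasurable 1 (ae_of_all _ fun ω => h2 _)
  rw [← integral_sub (hi hT) (hi hT'), ← Real.enorm_eq_ofReal_abs]
  refine (enorm_integral_le_lintegral_enorm _).trans ?_
  set A := {ω | ENNReal.ofReal δ ≤ ‖T ω - T' ω‖ₑ}
  have hA : MeasurableSet A := measurableSet_le measurable_const (hT.sub hT').enorm
  have hle : ∀ ω, ‖φ (T ω) - φ (T' ω)‖ₑ ≤ ENNReal.ofReal δ + A.indicator (fun _ => 2) ω := by
    intro ω
    by_cases hω : ω ∈ A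
    · rw [Set.indicator_of_mem hω]
      refine le_add_left ?_
      rw [Real.enorm_eq_ofReal_abs, show (2 : ℝ≥0∞) = ENNReal.ofReal 2 by simp]
      refine ENNReal.ofReal_le_ofReal ?_
      have := abs_sub (φ (T ω)) (φ (T' ω))
      linarith [h2 (T ω), h2 (T' ω)]
    · rw [Set.indicator_of_notMem hω, add_zero]
      have h3 := h1.edist_le_mul (T ω) (T' ω)
      rw [edist_eq_enorm_sub, edist_eq_enorm_sub, ENNReal.coe_one, one_mul] at h3
      exact h3.trans (not_le.1 hω).le
  refine (lintegral_mono hle).trans ?_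
  rw [lintegral_add_left measurable_const, lintegral_const, measure_univ, mul_one,
    lintegral_indicator_const hA]

end Weak

/-! ### Finite-dimensional projections and tightness. -/

section Projection

variable {H : Type*} [NormedAddCommGroup H] [InnerProductSpace ℝ H]
  {ι : Type*}

/-- The orthogonal projection of `x` on the span of the basis vectors with index in `s`. -/
def basisProj (b : HilbertBasis ι ℝ H) (s : Finset ι) (x : H) : H := ∑ p ∈ s, ⟪b p, x⟫ • b p

lemma continuous_basisProj (b : HilbertBasis ι ℝ H) (s : Finset ι) :
    Continuous (basisProj b s) := by
  unfold basisProj; fun_prop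

variable [CompleteSpace H]

lemma inner_basisProj [DecidableEq ι] (b : HilbertBasis ι ℝ H) (s : Finset ι) (x : H) (p : ι) :
    ⟪b p, basisProj b s x⟫ = if p ∈ s then ⟪b p, x⟫ else 0 := by
  simp [basisProj, inner_sum, inner_smul_right, orthonormal_iff_ite.1 b.orthonormal]

/-- Parseval for the remainder. This converts tail conditions on coordinates into conditions on
projection errors. -/
lemma enorm_sub_basisProj_sq (b : HilbertBasis ι ℝ H) (s : Finset ι) (x : H) :
    ‖x - basisProj b s x‖ₑ ^ 2 = ∑' p : {p // p ∉ s}, ‖⟪b p, x⟫‖ₑ ^ 2 := by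
  classical
  rw [← tsum_enorm_inner_sq b]
  refine (tsum_congr fun p => ?_).trans
    (tsum_subtype {p | p ∉ s} fun p => ‖⟪b p, x⟫‖ₑ ^ 2).symm
  rw [inner_sub_right, inner_basisProj]
  by_cases hp : p ∈ s <;> simp [hp]

lemma enorm_basisProj_le (b : HilbertBasis ι ℝ H) (s : Finset ι) (x : H) :
    ‖basisProj b s x‖ₑ ≤ ‖x‖ₑ := by
  classical
  have : ‖basisProj b s x‖ₑ ^ 2 ≤ ‖x‖ₑ ^ 2 := by
    rw [← tsum_enorm_inner_sq b, ← tsum_enorm_inner_sq b]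
    refine ENNReal.tsum_le_tsum fun p => ?_
    rw [inner_basisProj]
    split_ifs <;> simp
  exact (ENNReal.pow_le_pow_left_iff two_ne_zero).1 this

variable [MeasurableSpace H] [BorelSpace H] [SecondCountableTopology H]

/-- A set of measures with bounded second moments and uniformly small tails of the basis
expansion is tight. -/
lemma isTightMeasureSet_of_basisProj (b : HilbertBasis ι ℝ H) {S : Set (Measure H)} {C : ℝ≥0}
    (hC : ∀ μ ∈ S, ∫⁻ x, ‖x‖ₑ ^ 2 ∂μ ≤ C)
    (htail : ∀ δ : ℝ≥0∞, 0 < δ → ∃ s : Finset ι, ∀ μ ∈ S,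
      ∫⁻ x, ‖x - basisProj b s x‖ₑ ^ 2 ∂μ ≤ δ) :
    IsTightMeasureSet S := by
  rw [isTightMeasureSet_iff_exists_isCompact_measure_compl_le]
  intro ε hε
  have hε2 : ε / 2 ≠ 0 := (ENNReal.half_pos hε.ne').ne'
  -- Markov radius: outside the ball of radius `R` the mass is at most `C / R² ≤ ε / 2`. The choice
  -- `C / e + 1` works because its square dominates `C / e`.
  obtain ⟨R, hR0, hR⟩ : ∃ R : ℝ≥0, 0 < R ∧ (C : ℝ≥0∞) / (R : ℝ≥0∞) ^ 2 ≤ ε / 2 := by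
    rcases eq_or_ne ε ∞ with rfl | hεt
    · exact ⟨1, one_pos, by simp [ENNReal.top_div]⟩
    · have hne : ε / 2 ≠ ∞ := (ENNReal.div_lt_top hεt (by simp)).ne
      lift ε / 2 to ℝ≥0 using hne with e
      have he : 0 < e := pos_iff_ne_zero.2 (by simpa using hε2)
      refine ⟨C / e + 1, by positivity, ?_⟩
      refine ENNReal.div_le_of_le_mul ?_
      norm_cast
      have h1 : C = e * (C / e) := by field_simp
      have h2 : C / e ≤ (C / e + 1) ^ 2 := by nlinarith [zero_le (a := C / e)]
      calc C = e * (C / e) := h1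
        _ ≤ e * (C / e + 1) ^ 2 := by gcongr
  obtain ⟨δ, hδ0, hδ⟩ := ENNReal.exists_pos_sum_of_countable' hε2 ℕ
  have hr : ∀ m : ℕ, ((m : ℝ≥0∞) + 1)⁻¹ ^ 2 ≠ 0 := fun m => by simp
  have hrt : ∀ m : ℕ, ((m : ℝ≥0∞) + 1)⁻¹ ^ 2 ≠ ∞ := fun m => by simp
  -- The projection with index `m` is so accurate that Markov's inequality at level `1 / (m + 1)`
  -- costs at most `δ m`; these costs sum to less than `ε / 2`.
  choose s hs using fun m : ℕ => htail (δ m * ((m : ℝ≥0∞) + 1)⁻¹ ^ 2)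
    (ENNReal.mul_pos (hδ0 m).ne' (hr m))
  -- Bounded, and for every `m` within `1 / (m + 1)` of a finite-dimensional subspace; hence
  -- compact.
  set K : Set H := Metric.closedBall 0 R ∩
    ⋂ m : ℕ, {x | ‖x - basisProj b (s m) x‖ₑ ≤ ((m : ℝ≥0∞) + 1)⁻¹} with hK
  have hcl : IsClosed K := by
    refine Metric.isClosed_closedBall.inter (isClosed_iInter fun m => ?_)
    exact isClosed_le (continuous_id.sub (continuous_basisProj b _)).enorm continuous_const
  refine ⟨K, ?_, fun μ hμ => ?_⟩
  · refine TotallyBounded.isCompact_of_isClosed ?_ hcl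
    rw [Metric.totallyBounded_iff]
    intro e he
    obtain ⟨m, hm⟩ := exists_nat_one_div_lt (half_pos he)
    -- A compact box containing the projections of `K`; an `e / 2`-net of it is an `e`-net of `K`
    -- once the projection error is below `e / 2`.
    set L : Set H := (fun c : s m → ℝ => ∑ p, c p • b p) ''
      (Set.univ.pi fun _ => Set.Icc (-(R : ℝ)) R) with hL
    have hLc : IsCompact L :=
      (isCompact_univ_pi fun _ => isCompact_Icc).image (by fun_prop)
    obtain ⟨t, htf, ht⟩ := Metric.totallyBounded_iff.1 hLc.totallyBounded (e / 2) (half_pos he)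
    refine ⟨t, htf, fun x hx => ?_⟩
    have hxL : basisProj b (s m) x ∈ L := by
      refine ⟨fun p => ⟪b p, x⟫, fun p _ => ?_, ?_⟩
      · have h1 := norm_inner_le_norm (𝕜 := ℝ) (b p) x
        rw [b.orthonormal.1 p, one_mul] at h1
        have h2 : ‖x‖ ≤ R := by simpa using hx.1
        exact abs_le.1 (h1.trans h2)
      · exact Finset.sum_coe_sort (s m) fun p => ⟪b p, x⟫ • b p
    obtain ⟨y, hy, hxy⟩ := Set.mem_iUnion₂.1 (ht hxL)
    refine Set.mem_iUnion₂.2 ⟨y, hy, ?_⟩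
    have h3 : dist x (basisProj b (s m) x) < e / 2 := by
      have h4 : ‖x - basisProj b (s m) x‖ₑ ≤ ((m : ℝ≥0∞) + 1)⁻¹ := Set.mem_iInter.1 hx.2 m
      have h5 : ((m : ℝ≥0∞) + 1)⁻¹ = ENNReal.ofReal (1 / ((m : ℝ) + 1)) := by
        rw [one_div, ENNReal.ofReal_inv_of_pos (by positivity),
          ENNReal.ofReal_add (by positivity) one_pos.le]
        simp
      rw [h5, ← ofReal_norm, ENNReal.ofReal_le_ofReal_iff (by positivity)] at h4
      rw [dist_eq_norm]
      exact h4.trans_lt hm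
    rw [Metric.mem_ball] at hxy ⊢
    linarith [dist_triangle x (basisProj b (s m) x) y]
  · have hsub : Kᶜ ⊆ {x | (R : ℝ≥0∞) ^ 2 ≤ ‖x‖ₑ ^ 2} ∪
        ⋃ m : ℕ, {x | ((m : ℝ≥0∞) + 1)⁻¹ ^ 2 ≤ ‖x - basisProj b (s m) x‖ₑ ^ 2} := by
      intro x hx
      by_contra hcon
      simp only [Set.mem_union, Set.mem_ofPred_eq, Set.mem_iUnion, not_or, not_exists, not_le] at hcon
      refine hx ⟨?_, Set.mem_iInter.2 fun m => ?_⟩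
      · have h1 := (ENNReal.pow_lt_pow_left_iff two_ne_zero).1 hcon.1
        rw [mem_closedBall_zero_iff]
        have h2 : ‖x‖₊ < R := by
          rw [enorm_eq_nnnorm] at h1
          exact_mod_cast h1
        exact_mod_cast h2.le
      · exact ((ENNReal.pow_lt_pow_left_iff two_ne_zero).1 (hcon.2 m)).le
    refine (measure_mono hsub).trans ((measure_union_le _ _).trans ?_)
    rw [← ENNReal.add_halves ε]
    refine add_le_add ?_ ((measure_iUnion_le _).trans ((ENNReal.tsum_le_tsum fun m => ?_).trans
      hδ.le))
    · refine (meas_ge_le_lintegral_div (by fun_prop) (by simpa using hR0.ne') (by simp)).trans ?_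
      exact (ENNReal.div_le_div_right (hC μ hμ) _).trans hR
    · refine (meas_ge_le_lintegral_div ?_ (hr m) (hrt m)).trans ?_
      · exact ((continuous_id.sub (continuous_basisProj b _)).enorm.measurable.pow_const 2).aemeasurable
      · exact ENNReal.div_le_of_le_mul (hs m μ hμ)

end Projection

/-! ### Calculus of uniform convergence in probability. -/

section InProb

variable {Θ Ω : Type*} [MeasurableSpace Ω] {S : Set Θ} {Pr : Θ → Measure Ω}
  {D D' E : ℕ → Θ → Ω → ℝ≥0∞}

namespace UnifTendstoZeroInProb

lemma of_le_eventually (h : UnifTendstoZeroInProb S Pr D')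
    (hle : ∀ᶠ n in atTop, ∀ θ ∈ S, ∀ ω, D n θ ω ≤ D' n θ ω) : UnifTendstoZeroInProb S Pr D := by
  intro δ hδ
  refine tendsto_of_tendsto_of_tendsto_of_le_of_le' tendsto_const_nhds (h δ hδ)
    (Eventually.of_forall fun _ => zero_le) (hle.mono fun n hn => ?_)
  refine iSup₂_mono fun θ hθ => measure_mono fun ω hω => ?_
  exact le_trans hω (hn θ hθ ω)

lemma mono (h : UnifTendstoZeroInProb S Pr D') (hle : ∀ n, ∀ θ ∈ S, ∀ ω, D n θ ω ≤ D' n θ ω) :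
    UnifTendstoZeroInProb S Pr D :=
  h.of_le_eventually (Eventually.of_forall hle)

lemma add (h : UnifTendstoZeroInProb S Pr D) (h' : UnifTendstoZeroInProb S Pr D') :
    UnifTendstoZeroInProb S Pr fun n θ ω => D n θ ω + D' n θ ω := by
  intro δ hδ
  have := (h (δ / 2) (half_pos hδ)).add (h' (δ / 2) (half_pos hδ))
  rw [add_zero] at this
  refine tendsto_of_tendsto_of_tendsto_of_le_of_le tendsto_const_nhds this
    (fun _ => zero_le) fun n => iSup₂_le fun θ hθ => ?_
  refine le_trans ?_ (add_le_add (le_iSup₂ (f := fun θ (_ : θ ∈ S) => Pr θ _) θ hθ)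
    (le_iSup₂ (f := fun θ (_ : θ ∈ S) => Pr θ _) θ hθ))
  refine le_trans (measure_mono fun ω hω => ?_) (measure_union_le _ _)
  by_contra hcon
  simp only [Set.mem_union, Set.mem_ofPred_eq, not_or, not_le] at hcon hω
  refine absurd hω (not_le.2 ?_)
  calc D n θ ω + D' n θ ω < ENNReal.ofReal (δ / 2) + ENNReal.ofReal (δ / 2) :=
        ENNReal.add_lt_add hcon.1 hcon.2
    _ = ENNReal.ofReal δ := by
        rw [← ENNReal.ofReal_add (half_pos hδ).le (half_pos hδ).le, add_halves]

lemma zero : UnifTendstoZeroInProb S Pr fun _ _ _ => 0 := by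
  intro δ hδ
  have : ¬ δ ≤ 0 := not_le.2 hδ
  simp [this]

lemma sum {ι : Type*} (s : Finset ι) {D : ι → ℕ → Θ → Ω → ℝ≥0∞}
    (h : ∀ i ∈ s, UnifTendstoZeroInProb S Pr (D i)) :
    UnifTendstoZeroInProb S Pr fun n θ ω => ∑ i ∈ s, D i n θ ω := by
  classical
  induction s using Finset.induction_on with
  | empty => simpa using zero
  | insert a s ha ih =>
    simp_rw [Finset.sum_insert ha]
    exact (h a (Finset.mem_insert_self _ _)).add
      (ih fun i hi => h i (Finset.mem_insert_of_mem hi))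

lemma const_mul (c : ℝ≥0) (h : UnifTendstoZeroInProb S Pr D) :
    UnifTendstoZeroInProb S Pr fun n θ ω => c * D n θ ω := by
  intro δ hδ
  rcases eq_or_ne c 0 with rfl | hc
  · have : ¬ δ ≤ 0 := not_le.2 hδ
    simp [this]
  · have hc' : (0 : ℝ) < c := by positivity
    refine (h (δ / c) (by positivity)).congr fun n => iSup_congr fun θ => iSup_congr fun _ => ?_
    congr 1
    ext ω
    rw [Set.mem_ofPred_eq, Set.mem_ofPred_eq, ENNReal.ofReal_div_of_pos hc',
      ENNReal.ofReal_coe_nnreal, ENNReal.div_le_iff (by simpa using hc) (by simp), mul_comm]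

/-- Uniform convergence in mean implies uniform convergence in probability; the random variables
need only be small in mean up to remainders that are uniformly small in probability. -/
lemma of_approx (hE : ∀ κ : ℝ≥0, 0 < κ → ∃ D' E : ℕ → Θ → Ω → ℝ≥0∞,
      UnifTendstoZeroInProb S Pr D' ∧ ∀ᶠ n in atTop, ∀ θ ∈ S,
        (∀ ω, D n θ ω ≤ D' n θ ω + E n θ ω) ∧ AEMeasurable (E n θ) (Pr θ) ∧
        ∫⁻ ω, E n θ ω ∂(Pr θ) ≤ κ) :
    UnifTendstoZeroInProb S Pr D := by
  intro δ hδ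
  rw [ENNReal.tendsto_nhds_zero]
  intro ε hε
  have hδ2 : ENNReal.ofReal (δ / 2) ≠ 0 := (ENNReal.ofReal_pos.2 (half_pos hδ)).ne'
  have hpos : 0 < ε / 2 * ENNReal.ofReal (δ / 2) :=
    ENNReal.mul_pos (ENNReal.half_pos hε.ne').ne' hδ2
  -- With mean below `(ε / 2)(δ / 2)`, Markov's inequality at level `δ / 2` costs at most `ε / 2`.
  obtain ⟨κ, hκ0, hκ⟩ := ENNReal.lt_iff_exists_nnreal_btwn.1 hpos
  obtain ⟨D', E, hD', hle⟩ := hE κ (by simpa using hκ0)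
  have h1 := ENNReal.tendsto_nhds_zero.1 (hD' (δ / 2) (half_pos hδ)) (ε / 2)
    (ENNReal.half_pos hε.ne')
  filter_upwards [h1, hle] with n hn hle
  refine iSup₂_le fun θ hθ => ?_
  obtain ⟨hle, hm, hint⟩ := hle θ hθ
  have hsub : {ω | ENNReal.ofReal δ ≤ D n θ ω} ⊆
      {ω | ENNReal.ofReal (δ / 2) ≤ D' n θ ω} ∪ {ω | ENNReal.ofReal (δ / 2) ≤ E n θ ω} := by
    intro ω hω
    by_contra hcon
    simp only [Set.mem_union, Set.mem_ofPred_eq, not_or, not_le] at hcon hω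
    refine absurd (hω.trans (hle ω)) (not_le.2 ?_)
    calc D' n θ ω + E n θ ω < ENNReal.ofReal (δ / 2) + ENNReal.ofReal (δ / 2) :=
          ENNReal.add_lt_add hcon.1 hcon.2
      _ = ENNReal.ofReal δ := by
          rw [← ENNReal.ofReal_add (half_pos hδ).le (half_pos hδ).le, add_halves]
  refine (measure_mono hsub).trans ((measure_union_le _ _).trans ?_)
  rw [← ENNReal.add_halves ε]
  refine add_le_add ((le_iSup₂
    (f := fun θ (_ : θ ∈ S) => Pr θ {ω | ENNReal.ofReal (δ / 2) ≤ D' n θ ω}) θ hθ).trans hn) ?_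
  refine (meas_ge_le_lintegral_div hm hδ2 (by simp)).trans ?_
  exact ENNReal.div_le_of_le_mul (hint.trans hκ.le)

lemma of_lintegral {c : ℕ → ℝ≥0∞} (hc : Tendsto c atTop (𝓝 0))
    (h : ∀ᶠ n in atTop, ∀ θ ∈ S, AEMeasurable (D n θ) (Pr θ) ∧ ∫⁻ ω, D n θ ω ∂(Pr θ) ≤ c n) :
    UnifTendstoZeroInProb S Pr D := by
  refine of_approx fun κ hκ => ⟨fun _ _ _ => 0, D, zero, ?_⟩
  filter_upwards [h, ENNReal.tendsto_nhds_zero.1 hc κ (by simpa using hκ)] with n hn hcn θ hθ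
  exact ⟨fun ω => by simp, (hn θ hθ).1, (hn θ hθ).2.trans hcn⟩

end UnifTendstoZeroInProb

end InProb

/-! ### Second moments of real i.i.d. sums. -/

section ScalarSums

variable {Ω : Type*} [MeasurableSpace Ω] {μ : Measure Ω} [IsProbabilityMeasure μ]

/-- Variances of independent variables add, and centring identifies each `evariance` with a second
moment. -/
lemma lintegral_sum_sq_of_iid {n : ℕ} {X : Fin n → Ω → ℝ} {ρ : Measure ℝ}
    (hXm : ∀ i, Measurable (X i)) (hind : iIndepFun X μ) (hlaw : ∀ i, μ.map (X i) = ρ)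
    (h0 : ∫ x, x ∂ρ = 0) (h2 : MemLp id 2 ρ) :
    ∫⁻ ω, ‖∑ i, X i ω‖ₑ ^ 2 ∂μ = n * ∫⁻ x, ‖x‖ₑ ^ 2 ∂ρ := by
  have hL : ∀ i, MemLp (X i) 2 μ := fun i => by
    have := h2
    rw [← hlaw i] at this
    exact this.comp_of_map (hXm i).aemeasurable
  have hmean : ∀ i, ∫ ω, X i ω ∂μ = 0 := fun i => by
    rw [← h0, ← hlaw i]
    exact (integral_map (f := fun x : ℝ => x) (hXm i).aemeasurable
      measurable_id.aestronglyMeasurable).symm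
  have hev : ∀ i, evariance (X i) μ = ∫⁻ x, ‖x‖ₑ ^ 2 ∂ρ := fun i => by
    rw [evariance, hmean i, ← hlaw i, lintegral_map (by fun_prop) (hXm i)]
    simp
  have hvar := IndepFun.variance_sum (μ := μ) (s := Finset.univ) (fun i _ => hL i)
    (fun i _ j _ hij => hind.indepFun hij)
  have hLs : MemLp (∑ i, X i) 2 μ := memLp_finsetSum' _ fun i _ => hL i
  have hms : ∫ ω, (∑ i, X i) ω ∂μ = 0 := by
    simp only [Finset.sum_apply]
    rw [integral_finsetSum _ fun i _ => (hL i).integrable one_le_two]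
    simp [hmean]
  have h3 : evariance (∑ i, X i) μ = ∫⁻ ω, ‖∑ i, X i ω‖ₑ ^ 2 ∂μ := by
    rw [evariance, hms]; simp
  rw [← h3, ← hLs.ofReal_variance_eq, hvar,
    ENNReal.ofReal_sum_of_nonneg fun i _ => variance_nonneg _ _]
  simp_rw [(hL _).ofReal_variance_eq, hev]
  simp

end ScalarSums

/-! ### Elementary inequalities for characteristic functions. -/

section Taylor

/-- For `|y| ≤ 1` the remainder is cubic, and `|y|³ ≤ |y| ^ (2 + η)` since `η ≤ 1`. For `|y| > 1`
the crude bound `1 + (1 + |y| + y² / 2) ≤ 4 y²` suffices. Only a moment of order `2 + η` is thus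
needed. -/
lemma norm_cexp_sub_taylor_le {η : ℝ} (h0 : 0 < η) (h1 : η ≤ 1) (y : ℝ) :
    ‖Complex.exp (y * Complex.I) - (1 + y * Complex.I - (y : ℂ) ^ 2 / 2)‖ ≤
      4 * |y| ^ (2 + η) := by
  rcases le_or_gt |y| 1 with hy | hy
  · have hn : ‖(y * Complex.I : ℂ)‖ = |y| := by simp
    have h := Complex.exp_bound (x := y * Complex.I) (by rw [hn]; exact hy) (n := 3) (by norm_num)
    rw [hn] at h
    have e1 : ∑ m ∈ Finset.range 3, (y * Complex.I : ℂ) ^ m / (m.factorial : ℂ) =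
        1 + y * Complex.I - (y : ℂ) ^ 2 / 2 := by
      simp [Finset.sum_range_succ, mul_pow, Complex.I_sq, Nat.factorial]
      ring
    rw [e1] at h
    refine h.trans ?_
    have e2 : |y| ^ 3 ≤ |y| ^ (2 + η) := by
      rcases eq_or_lt_of_le (abs_nonneg y) with h00 | h00
      · rw [← h00, Real.zero_rpow (by positivity)]; norm_num
      · rw [← Real.rpow_natCast]
        exact Real.rpow_le_rpow_of_exponent_ge h00 hy (by push_cast; linarith)
    have e3 : (0 : ℝ) ≤ |y| ^ 3 := by positivity
    have e4 : ((Nat.succ 3 : ℕ) : ℝ) * (((Nat.factorial 3 : ℕ) : ℝ) * (3 : ℕ))⁻¹ ≤ 4 := by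
      norm_num [Nat.factorial]
    nlinarith
  · have e1 : ‖Complex.exp (y * Complex.I)‖ = 1 := Complex.norm_exp_ofReal_mul_I y
    have e2 : ‖(1 + y * Complex.I - (y : ℂ) ^ 2 / 2)‖ ≤ 1 + |y| + |y| ^ 2 / 2 := by
      refine (norm_sub_le _ _).trans (add_le_add ((norm_add_le _ _).trans ?_) ?_) <;> simp
    have e3 : |y| ^ 2 ≤ |y| ^ (2 + η) := by
      rw [← Real.rpow_natCast]
      exact Real.rpow_le_rpow_of_exponent_le hy.le (by push_cast; linarith)
    refine (norm_sub_le _ _).trans ?_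
    rw [e1]
    nlinarith

lemma abs_exp_neg_sub_le {s : ℝ} (hs : 0 ≤ s) : |Real.exp (-s) - (1 - s)| ≤ s ^ 2 := by
  have h1 := Real.add_one_le_exp (-s)
  rw [abs_of_nonneg (by linarith)]
  rcases le_or_gt s 1 with h | h
  · have := Real.abs_exp_sub_one_sub_id_le (x := -s) (by rw [abs_neg, abs_of_nonneg hs]; exact h)
    have h3 := (abs_le.1 this).2
    nlinarith
  · have : Real.exp (-s) ≤ 1 := Real.exp_le_one_iff.2 (by linarith)
    nlinarith

/-- Telescoping in the closed unit disc: replacing one factor at a time costs `‖a - b‖` each. -/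
lemma norm_pow_sub_pow_le_mul {a b : ℂ} (ha : ‖a‖ ≤ 1) (hb : ‖b‖ ≤ 1) (n : ℕ) :
    ‖a ^ n - b ^ n‖ ≤ n * ‖a - b‖ := by
  induction n with
  | zero => simp
  | succ n ih =>
    have e : a ^ (n + 1) - b ^ (n + 1) = a ^ n * (a - b) + (a ^ n - b ^ n) * b := by ring
    have ha' : ‖a ^ n‖ ≤ 1 := by rw [norm_pow]; exact pow_le_one₀ (norm_nonneg _) ha
    rw [e]
    refine (norm_add_le _ _).trans ?_
    rw [norm_mul, norm_mul]
    push_cast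
    nlinarith [norm_nonneg (a - b), norm_nonneg (a ^ n - b ^ n)]

end Taylor

/-! ### Covariance operators, normalized sums and their characteristic functions. -/

section Hilbert

variable {H : Type*} [NormedAddCommGroup H] [InnerProductSpace ℝ H] [CompleteSpace H]
  [MeasurableSpace H] [BorelSpace H] [SecondCountableTopology H]

/-- The uncentred covariance operator `∫ x ⊗ x dλ(x)`. -/
def covOp (lam : Measure H) : H →L[ℝ] H := ∫ x, outer x x ∂lam

/-- Uniformly over `θ ∈ S`, the probability measures `lam θ` are centred, have bounded moments of
order `2 + η`, and small tails of the expansion in the orthonormal basis `b`. -/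
structure UnifCentredMoments {Θ ι : Type*} (S : Set Θ) (lam : Θ → Measure H) (η : ℝ) (C : ℝ≥0)
    (b : HilbertBasis ι ℝ H) : Prop where
  prob : ∀ θ ∈ S, IsProbabilityMeasure (lam θ)
  pos : 0 < η
  le_one : η ≤ 1
  mean : ∀ θ ∈ S, ∀ t, ∫ x, ⟪t, x⟫ ∂(lam θ) = 0
  mom : ∀ θ ∈ S, ∫⁻ x, ‖x‖ₑ ^ (2 + η) ∂(lam θ) ≤ C
  tail : ∀ δ : ℝ≥0∞, 0 < δ → ∃ s : Finset ι, ∀ θ ∈ S,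
    ∫⁻ x, ‖x - basisProj b s x‖ₑ ^ 2 ∂(lam θ) ≤ δ

section OneMeasure

variable {lam : Measure H} [IsProbabilityMeasure lam] {η : ℝ} {C : ℝ≥0}

lemma enorm_sq_le_one_add_rpow (h0 : 0 ≤ η) (x : H) : ‖x‖ₑ ^ 2 ≤ 1 + ‖x‖ₑ ^ (2 + η) := by
  rcases le_or_gt ‖x‖ₑ 1 with h | h
  · exact (pow_le_one₀ zero_le h).trans le_self_add
  · rw [← ENNReal.rpow_natCast]
    exact (ENNReal.rpow_le_rpow_of_exponent_le h.le (by push_cast; linarith)).trans le_add_self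

lemma lintegral_enorm_sq_le (h0 : 0 ≤ η) (hC : ∫⁻ x, ‖x‖ₑ ^ (2 + η) ∂lam ≤ C) :
    ∫⁻ x, ‖x‖ₑ ^ 2 ∂lam ≤ (1 + C : ℝ≥0) := by
  refine (lintegral_mono fun x => enorm_sq_le_one_add_rpow h0 x).trans ?_
  rw [lintegral_add_left measurable_const, lintegral_const, measure_univ, mul_one]
  push_cast
  gcongr

lemma memLp_two_of_lintegral {C : ℝ≥0} (hC : ∫⁻ x, ‖x‖ₑ ^ 2 ∂lam ≤ C) : MemLp id 2 lam := by
  refine ⟨measurable_id.aestronglyMeasurable, ?_⟩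
  rw [eLpNorm_lt_top_iff_lintegral_rpow_enorm_lt_top (by norm_num) (by norm_num)]
  simp only [ENNReal.toReal_ofNat, id]
  refine lt_of_le_of_lt (le_of_eq ?_) (hC.trans_lt ENNReal.coe_lt_top)
  simp

lemma memLp_inner (h2 : MemLp id 2 lam) (t : H) : MemLp (fun x => ⟪t, x⟫) 2 lam :=
  h2.const_inner t

lemma integrable_outer_self (h2 : MemLp id 2 lam) : Integrable (fun x : H => outer x x) lam := by
  refine Integrable.mono' h2.integrable_norm_pow' continuous_outer_self.aestronglyMeasurable
    (ae_of_all _ fun x => ?_)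
  refine (norm_outer_le x x).trans (le_of_eq ?_)
  simp [sq]

lemma inner_covOp (h2 : MemLp id 2 lam) (t u : H) :
    ⟪covOp lam t, u⟫ = ∫ x, ⟪t, x⟫ * ⟪u, x⟫ ∂lam := by
  rw [covOp, ContinuousLinearMap.integral_apply (integrable_outer_self h2), real_inner_comm,
    ← integral_inner ((integrable_outer_self h2).apply_continuousLinearMap t)]
  refine integral_congr_ae (ae_of_all _ fun x => ?_)
  simp [outer_apply, inner_smul_right]

lemma traceNorm_covOp_le {C : ℝ≥0} (hC : ∫⁻ x, ‖x‖ₑ ^ 2 ∂lam ≤ C) :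
    traceNorm (covOp lam) ≤ C := by
  refine (traceNorm_integral_le (integrable_outer_self (memLp_two_of_lintegral hC))
    fun x => traceNorm_outer_le x x).trans ?_
  simpa [← sq] using hC

lemma integrable_norm_rpow (h0 : 0 ≤ η) (hC : ∫⁻ x, ‖x‖ₑ ^ (2 + η) ∂lam ≤ C) :
    Integrable (fun x => ‖x‖ ^ (2 + η)) lam ∧ ∫ x, ‖x‖ ^ (2 + η) ∂lam ≤ C := by
  have e : ∀ x : H, ‖‖x‖ ^ (2 + η)‖ₑ = ‖x‖ₑ ^ (2 + η) := fun x => by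
    rw [Real.enorm_of_nonneg (by positivity), ← ENNReal.ofReal_rpow_of_nonneg (norm_nonneg _)
      (by positivity), ofReal_norm]
  have hi : Integrable (fun x => ‖x‖ ^ (2 + η)) lam := by
    refine ⟨(measurable_norm.pow_const _).aestronglyMeasurable, ?_⟩
    rw [HasFiniteIntegral]
    simp_rw [e]
    exact hC.trans_lt ENNReal.coe_lt_top
  refine ⟨hi, ?_⟩
  rw [integral_eq_lintegral_of_nonneg_ae (ae_of_all _ fun x => by positivity) hi.1]
  refine ENNReal.toReal_le_coe_of_le_coe (le_trans (le_of_eq ?_) hC)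
  refine lintegral_congr fun x => ?_
  rw [← e, Real.enorm_of_nonneg (by positivity)]

/-- The second-order expansion of the characteristic function near zero. -/
lemma norm_charFun_smul_sub_le (h0 : 0 < η) (h1 : η ≤ 1)
    (hC : ∫⁻ x, ‖x‖ₑ ^ (2 + η) ∂lam ≤ C) (hmean : ∀ t, ∫ x, ⟪t, x⟫ ∂lam = 0) (t : H) {c : ℝ}
    (hc : 0 ≤ c) :
    ‖charFun lam (c • t) - (1 - c ^ 2 * (⟪covOp lam t, t⟫ : ℝ) / 2 : ℝ)‖ ≤
      4 * (c ^ (2 + η) * ‖t‖ ^ (2 + η) * C) := by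
  have h2 := memLp_two_of_lintegral (lintegral_enorm_sq_le h0.le hC)
  obtain ⟨hi, hiC⟩ := integrable_norm_rpow h0.le hC
  have ht := memLp_inner h2 t
  have i1 : Integrable (fun x => c * ⟪t, x⟫) lam := (ht.integrable one_le_two).const_mul c
  have i2 : Integrable (fun x => (c * ⟪t, x⟫) ^ 2) lam := (ht.const_mul c).integrable_sq
  have j1 : Integrable (fun x => ((c * ⟪t, x⟫ : ℝ) : ℂ) * Complex.I) lam :=
    i1.ofReal.mul_const _
  have j2 : Integrable (fun x => ((c * ⟪t, x⟫ : ℝ) : ℂ) ^ 2 / 2) lam := by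
    have := (i2.ofReal (𝕜 := ℂ)).div_const 2
    simpa using this
  have j3 : Integrable (fun x => 1 + ((c * ⟪t, x⟫ : ℝ) : ℂ) * Complex.I) lam :=
    (integrable_const _).add j1
  have j4 : Integrable (fun x => 1 + ((c * ⟪t, x⟫ : ℝ) : ℂ) * Complex.I -
      ((c * ⟪t, x⟫ : ℝ) : ℂ) ^ 2 / 2) lam := j3.sub j2
  have j0 : Integrable (fun x => Complex.exp ((c * ⟪t, x⟫ : ℝ) * Complex.I)) lam := by
    refine Integrable.of_bound (Measurable.aestronglyMeasurable (by fun_prop)) 1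
      (ae_of_all _ fun x => ?_)
    rw [Complex.norm_exp_ofReal_mul_I]
  have e0 : charFun lam (c • t) = ∫ x, Complex.exp ((c * ⟪t, x⟫ : ℝ) * Complex.I) ∂lam := by
    rw [charFun_apply]
    refine integral_congr_ae (ae_of_all _ fun x => ?_)
    simp [inner_smul_right, real_inner_comm]
  -- The second-order Taylor polynomial is integrated exactly: centring removes the linear term and
  -- the quadratic term is the covariance.
  have e1 : ((1 - c ^ 2 * (⟪covOp lam t, t⟫ : ℝ) / 2 : ℝ) : ℂ) =
      ∫ x, (1 + ((c * ⟪t, x⟫ : ℝ) : ℂ) * Complex.I - ((c * ⟪t, x⟫ : ℝ) : ℂ) ^ 2 / 2) ∂lam := by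
    rw [integral_sub j3 j2, integral_add (integrable_const _) j1,
      integral_mul_const, integral_complex_ofReal, integral_const_mul, hmean, inner_covOp h2]
    have : ∫ x, ((c * ⟪t, x⟫ : ℝ) : ℂ) ^ 2 / 2 ∂lam =
        ((c ^ 2 * (∫ x, ⟪t, x⟫ * ⟪t, x⟫ ∂lam) / 2 : ℝ) : ℂ) := by
      rw [← integral_const_mul, ← integral_div, ← integral_complex_ofReal]
      refine integral_congr_ae (ae_of_all _ fun x => ?_)
      simp only
      push_cast
      ring
    rw [this]
    simp
  rw [e0, e1, ← integral_sub j0 j4]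
  refine (norm_integral_le_of_norm_le ((hi.const_mul (4 * (c ^ (2 + η) * ‖t‖ ^ (2 + η)))))
    (ae_of_all _ fun x => (norm_cexp_sub_taylor_le h0 h1 _).trans ?_)).trans ?_
  · rw [mul_assoc 4]
    refine mul_le_mul_of_nonneg_left ?_ (by norm_num)
    rw [← Real.mul_rpow hc (norm_nonneg _), ← Real.mul_rpow (by positivity) (norm_nonneg _)]
    refine Real.rpow_le_rpow (abs_nonneg _) ?_ (by positivity)
    rw [abs_mul, abs_of_nonneg hc, mul_assoc]
    exact mul_le_mul_of_nonneg_left (abs_real_inner_le_norm t x) hc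
  · rw [integral_const_mul, mul_assoc 4]
    gcongr

/-- Nonnegativity keeps the Gaussian factor in the unit disc; the upper bound makes the error rate
depend on the measure only through its moment bound. -/
lemma inner_covOp_self_bounds {C : ℝ≥0} (hC : ∫⁻ x, ‖x‖ₑ ^ 2 ∂lam ≤ C) (t : H) :
    0 ≤ ⟪covOp lam t, t⟫ ∧ ⟪covOp lam t, t⟫ ≤ ‖t‖ ^ 2 * C := by
  have h2 := memLp_two_of_lintegral hC
  rw [inner_covOp h2]
  refine ⟨integral_nonneg fun x => mul_self_nonneg _, ?_⟩
  have hi : Integrable (fun x : H => ‖x‖ ^ 2) lam := by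
    simpa using h2.integrable_norm_pow'
  have hle : ∫ x, ‖x‖ ^ 2 ∂lam ≤ C := by
    rw [integral_eq_lintegral_of_nonneg_ae (ae_of_all _ fun x => by positivity) hi.1]
    refine ENNReal.toReal_le_coe_of_le_coe (le_trans (le_of_eq ?_) hC)
    refine lintegral_congr fun x => ?_
    rw [ENNReal.ofReal_pow (norm_nonneg _), ofReal_norm]
  calc ∫ x, ⟪t, x⟫ * ⟪t, x⟫ ∂lam ≤ ∫ x, ‖t‖ ^ 2 * ‖x‖ ^ 2 ∂lam := by
        refine integral_mono (by simpa [sq] using (memLp_inner h2 t).integrable_sq)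
          (hi.const_mul _) fun x => ?_
        have := abs_real_inner_le_norm t x
        simp only
        rw [← sq, ← sq_abs, ← mul_pow]
        gcongr
    _ ≤ ‖t‖ ^ 2 * C := by rw [integral_const_mul]; gcongr

end OneMeasure

section IID

variable {Ω : Type*} [MeasurableSpace Ω] {μ : Measure Ω} [IsProbabilityMeasure μ]
  {V : ℕ → Ω → H} {lam : Measure H} [IsProbabilityMeasure lam] {η : ℝ} {C : ℝ≥0}

/-- The normalized sum `n^{-1/2} ∑_{i < n} V_i`. -/
def normSum (V : ℕ → Ω → H) (n : ℕ) (ω : Ω) : H := (√(n : ℝ))⁻¹ • ∑ i : Fin n, V i ω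

lemma measurable_normSum (hV : ∀ i, Measurable (V i)) (n : ℕ) : Measurable (normSum V n) := by
  unfold normSum; fun_prop

lemma IsIIDSample.comp {T T' : Type*} [MeasurableSpace T] [MeasurableSpace T'] {W : ℕ → Ω → T}
    {P : Measure T} (h : IsIIDSample μ W P) {f : T → T'} (hf : Measurable f) :
    IsIIDSample μ (fun i ω => f (W i ω)) (P.map f) :=
  ⟨fun i => hf.comp (h.1 i), h.2.1.comp (fun _ => f) fun _ => hf, fun i => by
    rw [← h.2.2 i, Measure.map_map hf (h.1 i)]; rfl⟩

lemma IsIIDSample.isProbabilityMeasure {T : Type*} [MeasurableSpace T] {W : ℕ → Ω → T}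
    {P : Measure T} (h : IsIIDSample μ W P) : IsProbabilityMeasure P := by
  rw [← h.2.2 0]
  exact Measure.isProbabilityMeasure_map (h.1 0).aemeasurable

lemma IsIIDSample.iIndepFun_fin {T : Type*} [MeasurableSpace T] {W : ℕ → Ω → T}
    {P : Measure T} (h : IsIIDSample μ W P) (n : ℕ) : iIndepFun (fun i : Fin n => W i) μ :=
  h.2.1.precomp Fin.val_injective

lemma lintegral_inner_sum_sq (hV : IsIIDSample μ V lam) (h2 : MemLp id 2 lam)
    (hmean : ∀ t, ∫ x, ⟪t, x⟫ ∂lam = 0) (n : ℕ) (t : H) :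
    ∫⁻ ω, ‖⟪t, ∑ i : Fin n, V i ω⟫‖ₑ ^ 2 ∂μ = n * ∫⁻ x, ‖⟪t, x⟫‖ₑ ^ 2 ∂lam := by
  have hm : Measurable fun x : H => ⟪t, x⟫ := by fun_prop
  have hV' := hV.comp hm
  have h := lintegral_sum_sq_of_iid (μ := μ) (X := fun (i : Fin n) ω => ⟪t, V i ω⟫)
    (ρ := lam.map fun x => ⟪t, x⟫) (fun i => hV'.1 i) (hV'.iIndepFun_fin n)
    (fun i => hV'.2.2 i)
    (by
      exact (integral_map (f := fun x : ℝ => x) hm.aemeasurable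
        measurable_id.aestronglyMeasurable).trans (hmean t))
    ((memLp_map_measure_iff measurable_id.aestronglyMeasurable hm.aemeasurable).2
      (memLp_inner h2 t))
  rw [lintegral_map (by fun_prop) hm] at h
  simpa [inner_sum] using h

/-- An equality for `n > 0`; the inequality also covers `n = 0`, where the sum is zero. -/
lemma lintegral_inner_normSum_sq (hV : IsIIDSample μ V lam) (h2 : MemLp id 2 lam)
    (hmean : ∀ t, ∫ x, ⟪t, x⟫ ∂lam = 0) (n : ℕ) (t : H) :
    ∫⁻ ω, ‖⟪t, normSum V n ω⟫‖ₑ ^ 2 ∂μ ≤ ∫⁻ x, ‖⟪t, x⟫‖ₑ ^ 2 ∂lam := by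
  rcases Nat.eq_zero_or_pos n with rfl | hn
  · simp [normSum]
  · have hn' : (0 : ℝ) < n := by exact_mod_cast hn
    have e : ∀ ω, ‖⟪t, normSum V n ω⟫‖ₑ ^ 2 =
        (n : ℝ≥0∞)⁻¹ * ‖⟪t, ∑ i : Fin n, V i ω⟫‖ₑ ^ 2 := fun ω => by
      rw [normSum, inner_smul_right, enorm_mul, mul_pow]
      congr 1
      rw [Real.enorm_of_nonneg (by positivity), ← ENNReal.ofReal_pow (by positivity), inv_pow,
        Real.sq_sqrt hn'.le, ENNReal.ofReal_inv_of_pos hn']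
      simp
    simp_rw [e]
    rw [lintegral_const_mul' _ _ (by simpa using hn.ne'), lintegral_inner_sum_sq hV h2 hmean,
      ← mul_assoc, ENNReal.inv_mul_cancel (by simpa using hn.ne') (by simp), one_mul]

/-- By Parseval and Tonelli the claim splits into coordinates, none of whose second moments grows
under normalized summation. Tails of one summand therefore control those of all normalized sums,
which yields tightness. -/
lemma lintegral_sub_basisProj_normSum_le {ι : Type*} [Countable ι] (b : HilbertBasis ι ℝ H)
    (s : Finset ι) (hV : IsIIDSample μ V lam) (h2 : MemLp id 2 lam)
    (hmean : ∀ t, ∫ x, ⟪t, x⟫ ∂lam = 0) (n : ℕ) :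
    ∫⁻ ω, ‖normSum V n ω - basisProj b s (normSum V n ω)‖ₑ ^ 2 ∂μ ≤
      ∫⁻ x, ‖x - basisProj b s x‖ₑ ^ 2 ∂lam := by
  simp_rw [enorm_sub_basisProj_sq]
  have hm := measurable_normSum hV.1 n
  rw [lintegral_tsum fun p => by fun_prop, lintegral_tsum fun p => by fun_prop]
  exact ENNReal.tsum_le_tsum fun p => lintegral_inner_normSum_sq hV h2 hmean n _

lemma lintegral_normSum_sq_le {ι : Type*} [Countable ι] (b : HilbertBasis ι ℝ H)
    (hV : IsIIDSample μ V lam) (h2 : MemLp id 2 lam)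
    (hmean : ∀ t, ∫ x, ⟪t, x⟫ ∂lam = 0) (n : ℕ) :
    ∫⁻ ω, ‖normSum V n ω‖ₑ ^ 2 ∂μ ≤ ∫⁻ x, ‖x‖ₑ ^ 2 ∂lam := by
  -- The empty index set projects to zero.
  simpa [basisProj] using lintegral_sub_basisProj_normSum_le b ∅ hV h2 hmean n

lemma charFun_normSum (hV : IsIIDSample μ V lam) (n : ℕ) (t : H) :
    charFun (μ.map (normSum V n)) t = charFun lam ((√(n : ℝ))⁻¹ • t) ^ n := by
  have h := iIndepFun.charFun_map_fun_sum_eq_prod (X := fun i : Fin n => V i)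
    (fun i => (hV.1 i).aemeasurable) (hV.iIndepFun_fin n)
  simp_rw [hV.2.2] at h
  have hm : Measurable fun ω => ∑ i : Fin n, V i ω := Finset.measurable_sum _ fun i _ => hV.1 i
  have e : charFun (μ.map (normSum V n)) t =
      charFun (μ.map fun ω => ∑ i : Fin n, V i ω) ((√(n : ℝ))⁻¹ • t) := by
    rw [charFun_apply, charFun_apply,
      integral_map (measurable_normSum hV.1 n).aemeasurable
        (Measurable.aestronglyMeasurable (by fun_prop)),
      integral_map hm.aemeasurable (Measurable.aestronglyMeasurable (by fun_prop))]
    simp [normSum, inner_smul_left, inner_smul_right]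
  rw [e, h]
  simp

/-- The rate at which the characteristic functions of normalized sums approach those of the
Gaussian limit. -/
def charFunRate (η : ℝ) (C : ℝ≥0) (r : ℝ) (n : ℕ) : ℝ :=
  n * (4 * ((√(n : ℝ))⁻¹ ^ (2 + η) * r ^ (2 + η) * C) +
    ((√(n : ℝ))⁻¹ ^ 2 * (r ^ 2 * (1 + C)) / 2) ^ 2)

lemma tendsto_charFunRate (h0 : 0 < η) (C : ℝ≥0) (r : ℝ) :
    Tendsto (charFunRate η C r) atTop (𝓝 0) := by
  have hs : Tendsto (fun n : ℕ => (√(n : ℝ))⁻¹) atTop (𝓝 0) :=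
    tendsto_inv_atTop_zero.comp (Real.tendsto_sqrt_atTop.comp tendsto_natCast_atTop_atTop)
  -- After multiplication by `n` the two error terms have orders `n^{-η/2}` and `n⁻¹`.
  have h1 : Tendsto (fun n : ℕ => 4 * ((√(n : ℝ))⁻¹ ^ η * r ^ (2 + η) * C) +
      (√(n : ℝ))⁻¹ ^ 2 * ((r ^ 2 * (1 + C)) / 2) ^ 2) atTop (𝓝 0) := by
    have h2 : Tendsto (fun n : ℕ => (√(n : ℝ))⁻¹ ^ η) atTop (𝓝 0) := by
      have := hs.rpow_const (p := η) (Or.inr h0.le)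
      rwa [Real.zero_rpow h0.ne'] at this
    have h3 := (((h2.mul_const (r ^ (2 + η))).mul_const (C : ℝ)).const_mul 4).add
      ((hs.pow 2).mul_const (((r ^ 2 * (1 + C)) / 2) ^ 2))
    simpa using h3
  refine h1.congr' ?_
  filter_upwards [eventually_gt_atTop 0] with n hn
  have hn' : (0 : ℝ) < n := by exact_mod_cast hn
  have hi : 0 < (√(n : ℝ))⁻¹ := by positivity
  have hq : (√(n : ℝ))⁻¹ ^ 2 = (n : ℝ)⁻¹ := by rw [inv_pow, Real.sq_sqrt hn'.le]
  have hp : (√(n : ℝ))⁻¹ ^ (2 + η) = (n : ℝ)⁻¹ * (√(n : ℝ))⁻¹ ^ η := by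
    rw [Real.rpow_add hi, ← hq, ← Real.rpow_natCast]; norm_num
  rw [charFunRate, hp, hq]
  field_simp

/-- Both quantities are `n`th powers of numbers in the unit disc, namely the characteristic function
at `t / √n` and `exp (-σ / (2 n))`. Telescoping leaves `n` times the difference of single factors,
and each factor is compared with `1 - σ / (2 n)`. -/
lemma norm_charFun_normSum_sub_le (hV : IsIIDSample μ V lam) (h0 : 0 < η) (h1 : η ≤ 1)
    (hC : ∫⁻ x, ‖x‖ₑ ^ (2 + η) ∂lam ≤ C) (hmean : ∀ t, ∫ x, ⟪t, x⟫ ∂lam = 0) {n : ℕ} (hn : 0 < n)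
    (t : H) :
    ‖charFun (μ.map (normSum V n)) t - Complex.exp (-(⟪covOp lam t, t⟫ / 2 : ℝ))‖ ≤
      charFunRate η C ‖t‖ n := by
  have hn' : (0 : ℝ) < n := by exact_mod_cast hn
  obtain ⟨s0, s1⟩ := inner_covOp_self_bounds (lintegral_enorm_sq_le h0.le hC) t
  set σ : ℝ := ⟪covOp lam t, t⟫
  set c : ℝ := (√(n : ℝ))⁻¹ with hcdef
  have hc : 0 ≤ c := by positivity
  have hq : c ^ 2 = (n : ℝ)⁻¹ := by rw [hcdef, inv_pow, Real.sq_sqrt hn'.le]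
  have hb : Complex.exp (-(σ / 2 : ℝ)) = ((Real.exp (-(c ^ 2 * σ / 2)) : ℝ) : ℂ) ^ n := by
    rw [← Complex.ofReal_pow, ← Real.exp_nat_mul, hq, ← Complex.ofReal_neg, ← Complex.ofReal_exp]
    congr 2
    field_simp
  rw [charFun_normSum hV, hb]
  have hb1 : ‖((Real.exp (-(c ^ 2 * σ / 2)) : ℝ) : ℂ)‖ ≤ 1 := by
    rw [Complex.norm_real, Real.norm_of_nonneg (Real.exp_pos _).le]
    exact Real.exp_le_one_iff.2 (neg_nonpos.2 (by positivity))
  refine (norm_pow_sub_pow_le_mul (norm_charFun_le_one _) hb1 n).trans ?_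
  rw [charFunRate]
  refine mul_le_mul_of_nonneg_left ?_ hn'.le
  refine (norm_sub_le_norm_sub_add_norm_sub _
    (((1 - c ^ 2 * σ / 2 : ℝ)) : ℂ) _).trans (add_le_add
      (norm_charFun_smul_sub_le h0 h1 hC hmean t hc) ?_)
  rw [← Complex.ofReal_sub, Complex.norm_real, Real.norm_eq_abs, abs_sub_comm]
  refine (abs_exp_neg_sub_le (by positivity)).trans ?_
  push_cast at s1
  gcongr

end IID

end Hilbert

/-! ### The uniform central limit theorem. -/

section GaussianLimit

variable {H : Type*} [NormedAddCommGroup H] [InnerProductSpace ℝ H] [CompleteSpace H]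
  [MeasurableSpace H] [BorelSpace H] [SecondCountableTopology H]

/-- A probability measure with characteristic function `exp (-⟪C t, t⟫ / 2)`, where `C` is the
covariance operator of a measure with finite second moment, is `N(0, C)`. -/
lemma isCenteredGaussian_of_charFun {lam ν : Measure H} [IsProbabilityMeasure lam]
    [IsProbabilityMeasure ν] (h2 : MemLp id 2 lam)
    (h : ∀ t, charFun ν t = Complex.exp (-(⟪covOp lam t, t⟫ / 2 : ℝ))) :
    IsCenteredGaussian (covOp lam) ν := by
  let f : H →L[ℝ] H →L[ℝ] ℝ := (innerSL ℝ).comp (covOp lam)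
  have hf : ∀ t u, f t u = ⟪covOp lam t, u⟫ := fun _ _ => rfl
  have hpos : f.toBilinForm.IsPosSemidef := by
    refine ⟨⟨fun x y => ?_⟩, ⟨fun x => ?_⟩⟩
    · simp only [ContinuousLinearMap.toBilinForm_apply, hf, inner_covOp h2, mul_comm]
    · simp only [ContinuousLinearMap.toBilinForm_apply, hf, inner_covOp h2]
      exact integral_nonneg fun z => mul_self_nonneg _
  have hchar : ∀ t, charFun ν t = Complex.exp ((⟪t, (0 : H)⟫ : ℝ) * Complex.I - (f t t : ℝ) / 2) := by
    intro t
    rw [h, hf, inner_zero_right]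
    congr 1
    push_cast
    ring
  have hG : IsGaussian ν := isGaussian_iff_gaussian_charFun.2 ⟨0, f, hpos, hchar⟩
  obtain ⟨hm, hcov⟩ := gaussian_charFun_congr 0 f hpos hchar
  refine ⟨hG, hm.symm, ContinuousLinearMap.ext fun t => ext_inner_right ℝ fun u => ?_⟩
  have hL : MemLp id 2 ν := IsGaussian.memLp_two_id
  have hid : ν[id] = 0 := hm.symm
  rw [covarianceOperator_inner hL, ← hf, hcov, covarianceBilin_apply hL, hid]
  simp

lemma tendsto_charFun {α : Type*} {l : Filter α} {ρ : α → ProbabilityMeasure H}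
    {ν : ProbabilityMeasure H} (h : Tendsto ρ l (𝓝 ν)) (t : H) :
    Tendsto (fun a => charFun (ρ a : Measure H) t) l (𝓝 (charFun (ν : Measure H) t)) := by
  rw [ProbabilityMeasure.tendsto_iff_forall_integral_rclike_tendsto ℂ] at h
  simp_rw [charFun_eq_integral_innerProbChar]
  exact h (BoundedContinuousFunction.innerProbChar t)

/-- Uniformity is tested along sequences of parameters, so that the law may vary with `n` in
compactness arguments. -/
lemma tendsto_iSup_of_forall_seq {Θ : Type*} {S : Set Θ} {d : ℕ → Θ → ℝ≥0∞}
    (h : ∀ θ : ℕ → Θ, (∀ n, θ n ∈ S) → Tendsto (fun n => d n (θ n)) atTop (𝓝 0)) :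
    Tendsto (fun n => ⨆ θ ∈ S, d n θ) atTop (𝓝 0) := by
  classical
  rcases S.eq_empty_or_nonempty with rfl | ⟨θ₀, hθ₀⟩
  · simp
  rw [ENNReal.tendsto_nhds_zero]
  intro ε hε
  -- A violating parameter whenever there is one; `θ₀` is only a default.
  let θ : ℕ → Θ := fun n => if hn : ∃ θ ∈ S, ε < d n θ then hn.choose else θ₀
  have hθ : ∀ n, θ n ∈ S := fun n => by
    by_cases hn : ∃ θ ∈ S, ε < d n θ
    · simp only [θ, dif_pos hn]; exact hn.choose_spec.1
    · simp only [θ, dif_neg hn]; exact hθ₀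
  filter_upwards [ENNReal.tendsto_nhds_zero.1 (h θ hθ) ε hε] with n hn
  refine iSup₂_le fun θ' hθ' => ?_
  by_contra hcon
  have hex : ∃ θ ∈ S, ε < d n θ := ⟨θ', hθ', not_le.1 hcon⟩
  have : ε < d n (θ n) := by
    simp only [θ, dif_pos hex]; exact hex.choose_spec.2
  exact absurd hn (not_le.2 this)

variable {Θ Ω ι : Type*} [MeasurableSpace Ω] [Countable ι] {S : Set Θ} {Pr : Θ → Measure Ω}
  {V : Θ → ℕ → Ω → H} {lam : Θ → Measure H} {η : ℝ} {C : ℝ≥0} {b : HilbertBasis ι ℝ H}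

/-- The **uniform central limit theorem** in a separable Hilbert space. -/
theorem UnifCentredMoments.exists_gaussian_limit (h : UnifCentredMoments S lam η C b)
    (hPr : ∀ θ ∈ S, IsProbabilityMeasure (Pr θ))
    (hV : ∀ θ ∈ S, IsIIDSample (Pr θ) (V θ) (lam θ)) :
    ∃ N : Θ → Measure H, (∀ θ ∈ S, IsCenteredGaussian (covOp (lam θ)) (N θ)) ∧
      Tendsto (fun n => ⨆ θ ∈ S, dBL ((Pr θ).map (normSum (V θ) n)) (N θ)) atTop (𝓝 0) := by
  have hsq : ∀ θ ∈ S, ∫⁻ x, ‖x‖ₑ ^ 2 ∂(lam θ) ≤ (1 + C : ℝ≥0) := fun θ hθ =>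
    have := h.prob θ hθ
    lintegral_enorm_sq_le h.pos.le (h.mom θ hθ)
  have hL2 : ∀ θ ∈ S, MemLp id 2 (lam θ) := fun θ hθ =>
    have := h.prob θ hθ
    memLp_two_of_lintegral (hsq θ hθ)
  -- All `n` and all `θ` at once: a single tight family gives the compactness needed for uniformity.
  set 𝒮 : Set (ProbabilityMeasure H) :=
    {ρ | ∃ n, ∃ θ ∈ S, (ρ : Measure H) = (Pr θ).map (normSum (V θ) n)}
  have htight : IsTightMeasureSet {((μ : ProbabilityMeasure H) : Measure H) | μ ∈ 𝒮} := by
    have hmap : ∀ θ ∈ S, ∀ n (G : H → ℝ≥0∞), Measurable G →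
        ∫⁻ x, G x ∂((Pr θ).map (normSum (V θ) n)) = ∫⁻ ω, G (normSum (V θ) n ω) ∂(Pr θ) :=
      fun θ hθ n G hG => lintegral_map hG (measurable_normSum (hV θ hθ).1 n)
    refine isTightMeasureSet_of_basisProj b (C := 1 + C) ?_ fun δ hδ => ?_
    · rintro _ ⟨ρ, ⟨n, θ, hθ, hρ⟩, rfl⟩
      have := h.prob θ hθ
      have := hPr θ hθ
      rw [hρ, hmap θ hθ n _ (by fun_prop)]
      exact (lintegral_normSum_sq_le b (hV θ hθ) (hL2 θ hθ) (h.mean θ hθ) n).trans (hsq θ hθ)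
    · obtain ⟨s, hs⟩ := h.tail δ hδ
      refine ⟨s, ?_⟩
      rintro _ ⟨ρ, ⟨n, θ, hθ, hρ⟩, rfl⟩
      have := h.prob θ hθ
      have := hPr θ hθ
      rw [hρ, hmap θ hθ n (fun x => ‖x - basisProj b s x‖ₑ ^ 2)
        ((continuous_id.sub (continuous_basisProj b s)).enorm.measurable.pow_const 2)]
      exact (lintegral_sub_basisProj_normSum_le b s (hV θ hθ) (hL2 θ hθ) (h.mean θ hθ) n).trans
        (hs θ hθ)
  have hcomp := isCompact_closure_of_isTightMeasureSet htight
  -- Ultrafilters play the part of subsequences: along one, every sequence in the compact closure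
  -- converges.
  have hlim : ∀ (U : Ultrafilter ℕ) (ρ : ℕ → ProbabilityMeasure H), (∀ n, ρ n ∈ closure 𝒮) →
      ∃ ν ∈ closure 𝒮, Tendsto ρ U (𝓝 ν) := fun U ρ hρ =>
    hcomp.ultrafilter_le_nhds' (U.map ρ) (Filter.mem_map.2 (Filter.univ_mem' hρ))
  have hchar : ∀ (θ : ℕ → Θ), (∀ n, θ n ∈ S) → ∀ t, Tendsto (fun n =>
      charFun ((Pr (θ n)).map (normSum (V (θ n)) n)) t -
        Complex.exp (-(⟪covOp (lam (θ n)) t, t⟫ / 2 : ℝ))) atTop (𝓝 0) := fun θ hθ t => by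
    refine squeeze_zero_norm' ?_ (tendsto_charFunRate h.pos C ‖t‖)
    filter_upwards [eventually_gt_atTop 0] with n hn
    have := h.prob _ (hθ n)
    have := hPr _ (hθ n)
    exact norm_charFun_normSum_sub_le (hV _ (hθ n)) h.pos h.le_one (h.mom _ (hθ n))
      (h.mean _ (hθ n)) hn t
  have hmk : ∀ n, ∀ θ ∈ S, ∃ ρ ∈ 𝒮, (ρ : Measure H) = (Pr θ).map (normSum (V θ) n) :=
    fun n θ hθ => by
      have := hPr θ hθ
      exact ⟨⟨_, Measure.isProbabilityMeasure_map
        (measurable_normSum (hV θ hθ).1 n).aemeasurable⟩, ⟨n, θ, hθ, rfl⟩, rfl⟩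
  -- Existence of the Gaussian law: a limit of normalized sums for fixed `θ`. That it lies in
  -- `closure 𝒮` is kept, since the Gaussian laws must later have limits along ultrafilters too.
  have hex : ∀ θ ∈ S, ∃ ν ∈ closure 𝒮, ∀ t,
      charFun (ν : Measure H) t = Complex.exp (-(⟪covOp (lam θ) t, t⟫ / 2 : ℝ)) := by
    intro θ hθ
    choose ρ hρ hρe using fun n => hmk n θ hθ
    obtain ⟨ν, hν, hlimν⟩ := hlim (Ultrafilter.of atTop) ρ fun n => subset_closure (hρ n)
    refine ⟨ν, hν, fun t => tendsto_nhds_unique (tendsto_charFun hlimν t) ?_⟩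
    have h1 := (hchar (fun _ => θ) (fun _ => hθ) t).mono_left (Ultrafilter.of_le atTop)
    simp_rw [hρe]
    simpa using h1.add_const (Complex.exp (-(⟪covOp (lam θ) t, t⟫ / 2 : ℝ)))
  have : Nonempty (ProbabilityMeasure H) := ⟨⟨Measure.dirac 0, inferInstance⟩⟩
  choose! N hN hNchar using hex
  refine ⟨fun θ => (N θ : Measure H), fun θ hθ => ?_, tendsto_iSup_of_forall_seq fun θ hθ => ?_⟩
  · have := h.prob θ hθ
    exact isCenteredGaussian_of_charFun (hL2 θ hθ) (hNchar θ hθ)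
  · choose ρ hρ hρe using fun n => hmk n (θ n) (hθ n)
    rw [tendsto_iff_ultrafilter]
    intro U hU
    -- Both the laws and their Gaussian counterparts converge along `U`. The rate for characteristic
    -- functions forces the limits to agree, so the triangle inequality through that limit finishes.
    obtain ⟨ν, -, hν⟩ := hlim U ρ fun n => subset_closure (hρ n)
    obtain ⟨ν', -, hν'⟩ := hlim U (fun n => N (θ n)) fun n => hN _ (hθ n)
    have heq' : (ν : Measure H) = (ν' : Measure H) := by
      refine Measure.ext_of_charFun (funext fun t => ?_)
      refine sub_eq_zero.1 (tendsto_nhds_unique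
        ((tendsto_charFun hν t).sub (tendsto_charFun hν' t)) ?_)
      simp_rw [hρe, hNchar _ (hθ _)]
      exact (hchar θ hθ t).mono_left hU
    have heq : ν = ν' := Subtype.ext heq'
    subst heq
    have h1 := (tendsto_dBL hν).add (tendsto_dBL hν')
    rw [add_zero] at h1
    refine tendsto_of_tendsto_of_tendsto_of_le_of_le tendsto_const_nhds h1
      (fun _ => zero_le) fun n => ?_
    have := dBL_triangle (ρ n : Measure H) ν (N (θ n))
    rw [dBL_comm (ν : Measure H)] at this
    rwa [hρe] at this ⊢

end GaussianLimit

/-! ### Auxiliary inequalities and empirical averages. -/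

lemma ENNReal_mul_le_add_sq (a b : ℝ≥0∞) {c : ℝ≥0} (hc : 0 < c) :
    a * b ≤ c * a ^ 2 + (c⁻¹ : ℝ≥0) * b ^ 2 := by
  have h0 : (c : ℝ≥0∞) ≠ 0 := by simpa using hc.ne'
  -- Young's inequality without subtraction: the larger of `b` and `c * a` absorbs the product.
  rcases le_total b (c * a) with h | h
  · refine le_add_right ?_
    calc a * b ≤ a * (c * a) := by gcongr
      _ = c * a ^ 2 := by ring
  · refine le_add_left ?_
    have h' : a ≤ (c⁻¹ : ℝ≥0) * b := by
      rw [ENNReal.coe_inv hc.ne']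
      calc a = (c : ℝ≥0∞)⁻¹ * (c * a) := by
            rw [← mul_assoc, ENNReal.inv_mul_cancel h0 (by simp), one_mul]
        _ ≤ (c : ℝ≥0∞)⁻¹ * b := by gcongr
    calc a * b ≤ ((c⁻¹ : ℝ≥0) * b) * b := by gcongr
      _ = (c⁻¹ : ℝ≥0) * b ^ 2 := by ring

lemma enorm_natCast_inv (n : ℕ) (hn : n ≠ 0) : ‖((n : ℝ)⁻¹)‖ₑ = (n : ℝ≥0∞)⁻¹ := by
  have hn' : (0 : ℝ) < n := by positivity
  rw [Real.enorm_of_nonneg (by positivity), ENNReal.ofReal_inv_of_pos hn']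
  simp

section Calculus

variable {Θ Ω : Type*} [MeasurableSpace Ω] {S : Set Θ} {Pr : Θ → Measure Ω}
  {D : ℕ → Θ → Ω → ℝ≥0∞}

lemma UnifTendstoZeroInProb.of_sq (h : UnifTendstoZeroInProb S Pr fun n θ ω => D n θ ω ^ 2) :
    UnifTendstoZeroInProb S Pr D := by
  intro δ hδ
  refine (h (δ ^ 2) (by positivity)).congr fun n => iSup_congr fun θ => iSup_congr fun _ => ?_
  congr 1
  ext ω
  rw [Set.mem_ofPred_eq, Set.mem_ofPred_eq, ENNReal.ofReal_pow hδ.le,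
    ENNReal.pow_le_pow_left_iff two_ne_zero]

end Calculus

section Average

variable {Ω T : Type*} [MeasurableSpace Ω] [MeasurableSpace T] {μ : Measure Ω}
  {W : ℕ → Ω → T} {P : Measure T}

/-- The mean of an empirical average. -/
lemma IsIIDSample.lintegral_average_le (h : IsIIDSample μ W P) {G : T → ℝ≥0∞} (hG : Measurable G)
    (n : ℕ) : ∫⁻ ω, (n : ℝ≥0∞)⁻¹ * ∑ i : Fin n, G (W i ω) ∂μ ≤ ∫⁻ x, G x ∂P := by
  have hm : ∀ i : Fin n, Measurable fun ω => G (W i ω) := fun i => hG.comp (h.1 i)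
  rw [lintegral_const_mul _ (Finset.measurable_sum _ fun i _ => hm i),
    lintegral_finsetSum _ fun i _ => hm i]
  have e : ∀ i : Fin n, ∫⁻ ω, G (W i ω) ∂μ = ∫⁻ x, G x ∂P := fun i => by
    rw [← h.2.2 i, lintegral_map hG (h.1 i)]
  simp_rw [e]
  rcases Nat.eq_zero_or_pos n with rfl | hn
  · simp
  · rw [Finset.sum_const, Finset.card_univ, Fintype.card_fin, nsmul_eq_mul, ← mul_assoc,
      ENNReal.inv_mul_cancel (by simpa using hn.ne') (by simp), one_mul]

end Average

/-! ### A uniform weak law for real variables. -/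

section ScalarLLN

variable {Θ Ω : Type*} [MeasurableSpace Ω] {S : Set Θ} {Pr : Θ → Measure Ω}
  {Y : Θ → ℕ → Ω → ℝ} {ρ : Θ → Measure ℝ}

/-- The second moment of the centred average is at most `(2 τ)² / n`, whatever the law. -/
lemma unifTendstoZeroInProb_average_of_bounded {f : ℝ → ℝ} (hf : Measurable f) {τ : ℝ}
    (hfτ : ∀ y, |f y| ≤ τ) (hPr : ∀ θ ∈ S, IsProbabilityMeasure (Pr θ))
    (hY : ∀ θ ∈ S, IsIIDSample (Pr θ) (Y θ) (ρ θ)) :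
    UnifTendstoZeroInProb S Pr fun n θ ω =>
      ‖(n : ℝ)⁻¹ * ∑ i : Fin n, (f (Y θ i ω) - ∫ y, f y ∂(ρ θ))‖ₑ := by
  refine UnifTendstoZeroInProb.of_sq (UnifTendstoZeroInProb.of_lintegral
    (c := fun n : ℕ => ENNReal.ofReal ((2 * τ) ^ 2) / n)
    (by
      have h := ENNReal.Tendsto.const_div (a := ENNReal.ofReal ((2 * τ) ^ 2))
        ENNReal.tendsto_nat_nhds_top (Or.inr ENNReal.ofReal_ne_top)
      rwa [ENNReal.div_top] at h) ?_)
  filter_upwards [eventually_gt_atTop 0] with n hn θ hθ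
  have := hPr θ hθ
  have := (hY θ hθ).isProbabilityMeasure
  have hfi : Integrable f (ρ θ) := Integrable.of_bound hf.aestronglyMeasurable τ (ae_of_all _ hfτ)
  set m := ∫ y, f y ∂(ρ θ)
  have hm : |m| ≤ τ := by
    have := norm_integral_le_of_norm_le_const (μ := ρ θ) (f := f) (C := τ) (ae_of_all _ hfτ)
    simpa using this
  have hg : Measurable fun y => f y - m := hf.sub_const m
  have hb : ∀ y, |f y - m| ≤ 2 * τ := fun y => by
    have := abs_sub (f y) m
    linarith [hfτ y]
  have hX := (hY θ hθ).comp hg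
  refine ⟨?_, ?_⟩
  · have : Measurable fun ω => ∑ i : Fin n, (f (Y θ i ω) - m) :=
      Finset.measurable_sum _ fun i _ => hX.1 i
    exact ((this.const_mul _).enorm.pow_const 2).aemeasurable
  · have hmean : ∫ x, x ∂((ρ θ).map fun y => f y - m) = 0 := by
      refine (integral_map (f := fun x : ℝ => x) hg.aemeasurable
        measurable_id.aestronglyMeasurable).trans ?_
      rw [integral_sub hfi (integrable_const _)]
      simp [m]
    have hL : MemLp id 2 ((ρ θ).map fun y => f y - m) :=
      (memLp_map_measure_iff measurable_id.aestronglyMeasurable hg.aemeasurable).2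
        (MemLp.of_bound hg.aestronglyMeasurable (2 * τ) (ae_of_all _ hb))
    have h := lintegral_sum_sq_of_iid (n := n) (fun i => hX.1 i) (hX.iIndepFun_fin n)
      (fun i => hX.2.2 i) hmean hL
    simp_rw [enorm_mul, mul_pow, enorm_natCast_inv n hn.ne']
    rw [lintegral_const_mul' _ _ (by simpa using hn.ne'), h, lintegral_map (by fun_prop) hg]
    have hle : ∫⁻ y, ‖f y - m‖ₑ ^ 2 ∂(ρ θ) ≤ ENNReal.ofReal ((2 * τ) ^ 2) := by
      refine (lintegral_mono fun y => ?_).trans (b := ∫⁻ _, ENNReal.ofReal ((2 * τ) ^ 2) ∂(ρ θ)) ?_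
      · rw [Real.enorm_eq_ofReal_abs, ← ENNReal.ofReal_pow (abs_nonneg _)]
        exact ENNReal.ofReal_le_ofReal (pow_le_pow_left₀ (abs_nonneg _) (hb y) 2)
      · simp
    have hn0 : (n : ℝ≥0∞) ≠ 0 := by simpa using hn.ne'
    calc (n : ℝ≥0∞)⁻¹ ^ 2 * (n * ∫⁻ y, ‖f y - m‖ₑ ^ 2 ∂(ρ θ))
        = ((n : ℝ≥0∞)⁻¹ * n) * ((∫⁻ y, ‖f y - m‖ₑ ^ 2 ∂(ρ θ)) * (n : ℝ≥0∞)⁻¹) := by ring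
      _ = (∫⁻ y, ‖f y - m‖ₑ ^ 2 ∂(ρ θ)) / n := by
          rw [ENNReal.inv_mul_cancel hn0 (by simp), one_mul, div_eq_mul_inv]
      _ ≤ ENNReal.ofReal (2 ^ 2 * τ ^ 2) / n := by
          rw [← mul_pow]; exact ENNReal.div_le_div_right hle _

/-- A weak law of large numbers, uniform over laws with bounded moments of order `1 + γ`. -/
lemma unifTendstoZeroInProb_average {γ : ℝ} (hγ : 0 < γ) {C : ℝ≥0}
    (hPr : ∀ θ ∈ S, IsProbabilityMeasure (Pr θ))
    (hY : ∀ θ ∈ S, IsIIDSample (Pr θ) (Y θ) (ρ θ))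
    (hC : ∀ θ ∈ S, ∫⁻ y, ‖y‖ₑ ^ (1 + γ) ∂(ρ θ) ≤ C) :
    UnifTendstoZeroInProb S Pr fun n θ ω =>
      ‖(n : ℝ)⁻¹ * ∑ i : Fin n, Y θ i ω - ∫ y, y ∂(ρ θ)‖ₑ := by
  refine UnifTendstoZeroInProb.of_approx fun κ hκ => ?_
  -- Truncation level at which the part beyond `τ` has mean at most `κ / 2` under every law.
  obtain ⟨τ, hτ0, hτ⟩ : ∃ τ : ℝ, 0 < τ ∧ ENNReal.ofReal (τ ^ (-γ)) * C ≤ κ / 2 := by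
    have h1 : Tendsto (fun τ : ℝ => τ ^ (-γ) * C) atTop (𝓝 0) := by
      simpa using (tendsto_rpow_neg_atTop hγ).mul_const (C : ℝ)
    have h2 : ∀ᶠ τ : ℝ in atTop, τ ^ (-γ) * C < κ / 2 :=
      (tendsto_order.1 h1).2 _ (by positivity)
    obtain ⟨τ, hτ, hτ0⟩ := (h2.and (eventually_gt_atTop 0)).exists
    refine ⟨τ, hτ0, ?_⟩
    have h3 := ENNReal.ofReal_le_ofReal hτ.le
    rw [ENNReal.ofReal_mul (by positivity), ENNReal.ofReal_coe_nnreal,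
      ENNReal.ofReal_div_of_pos two_pos, ENNReal.ofReal_coe_nnreal] at h3
    simpa using h3
  set f : ℝ → ℝ := fun y => if |y| ≤ τ then y else 0
  have hf : Measurable f :=
    Measurable.ite (measurableSet_le (by fun_prop) measurable_const) measurable_id measurable_const
  have hfτ : ∀ y, |f y| ≤ τ := fun y => by
    by_cases hy : |y| ≤ τ <;> simp [f, hy, hτ0.le]
  -- The truncated part lives on `|y| > τ`, where `1 ≤ (|y| / τ) ^ γ`.
  have hg : ∀ y, ‖y - f y‖ₑ ≤ ENNReal.ofReal (τ ^ (-γ)) * ‖y‖ₑ ^ (1 + γ) := fun y => by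
    by_cases hy : |y| ≤ τ
    · simp [f, hy]
    · have hlt : τ < |y| := not_le.1 hy
      have hy0 : 0 < |y| := hτ0.trans hlt
      simp only [f, hy, if_false, sub_zero]
      rw [Real.enorm_eq_ofReal_abs, ENNReal.ofReal_rpow_of_pos hy0,
        ← ENNReal.ofReal_mul (by positivity)]
      refine ENNReal.ofReal_le_ofReal ?_
      rw [Real.rpow_add hy0, Real.rpow_one, Real.rpow_neg hτ0.le, ← div_eq_inv_mul,
        le_div_iff₀ (by positivity)]
      exact mul_le_mul_of_nonneg_left (Real.rpow_le_rpow hτ0.le hlt.le hγ.le) hy0.le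
  -- The remainder enters twice, in the empirical mean and in the true mean, with `κ / 2` for each.
  refine ⟨_, fun n θ ω => (n : ℝ≥0∞)⁻¹ * ∑ i : Fin n, ‖Y θ i ω - f (Y θ i ω)‖ₑ +
    ∫⁻ y, ‖y - f y‖ₑ ∂(ρ θ), unifTendstoZeroInProb_average_of_bounded hf hfτ hPr hY, ?_⟩
  filter_upwards [eventually_gt_atTop 0] with n hn θ hθ
  have := hPr θ hθ
  have := (hY θ hθ).isProbabilityMeasure
  have hgm : Measurable fun y => ‖y - f y‖ₑ := (measurable_id.sub hf).enorm
  have hgint : ∫⁻ y, ‖y - f y‖ₑ ∂(ρ θ) ≤ κ / 2 := by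
    refine (lintegral_mono hg).trans ?_
    rw [lintegral_const_mul _ (by fun_prop)]
    exact (mul_le_mul_right (hC θ hθ) _).trans hτ
  have hYm := (hY θ hθ).1
  refine ⟨fun ω => ?_, ?_, ?_⟩
  · have hfi : Integrable f (ρ θ) :=
      Integrable.of_bound hf.aestronglyMeasurable τ (ae_of_all _ hfτ)
    have hgi : Integrable (fun y => y - f y) (ρ θ) :=
      ⟨(measurable_id.sub hf).aestronglyMeasurable, hgint.trans_lt
        (ENNReal.div_lt_top (by simp) (by simp))⟩
    have hyi : ∫ y, y ∂(ρ θ) = ∫ y, f y ∂(ρ θ) + ∫ y, (y - f y) ∂(ρ θ) := by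
      rw [← integral_add hfi hgi]
      simp
    have hn' : (n : ℝ) ≠ 0 := by positivity
    have e : (n : ℝ)⁻¹ * ∑ i : Fin n, Y θ i ω - ∫ y, y ∂(ρ θ) =
        (n : ℝ)⁻¹ * ∑ i : Fin n, (f (Y θ i ω) - ∫ y, f y ∂(ρ θ)) +
          ((n : ℝ)⁻¹ * ∑ i : Fin n, (Y θ i ω - f (Y θ i ω)) - ∫ y, (y - f y) ∂(ρ θ)) := by
      rw [hyi, Finset.sum_sub_distrib, Finset.sum_sub_distrib]
      simp only [Finset.sum_const, Finset.card_univ, Fintype.card_fin, nsmul_eq_mul]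
      field_simp
      ring
    rw [e]
    refine (enorm_add_le _ _).trans (add_le_add le_rfl ((enorm_sub_le).trans
      (add_le_add ?_ (enorm_integral_le_lintegral_enorm _))))
    rw [enorm_mul, enorm_natCast_inv n hn.ne']
    gcongr
    exact enorm_sum_le _ _
  · have : Measurable fun ω => ∑ i : Fin n, ‖Y θ i ω - f (Y θ i ω)‖ₑ :=
      Finset.measurable_sum _ fun i _ => hgm.comp (hYm i)
    fun_prop
  · rw [lintegral_add_right _ measurable_const, lintegral_const, measure_univ, mul_one,
      ← ENNReal.add_halves (κ : ℝ≥0∞)]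
    exact add_le_add (((hY θ hθ).lintegral_average_le hgm n).trans hgint) hgint

end ScalarLLN

/-! ### The uniform law of large numbers in trace norm. -/

section TraceLLN

lemma integral_sum_smul_const {α κ B : Type*} [NormedAddCommGroup B] [NormedSpace ℝ B]
    [CompleteSpace B] [MeasurableSpace α] {ρ : Measure α} (s : Finset κ) (c : κ → α → ℝ)
    (L : κ → B) (hc : ∀ k, Integrable (c k) ρ) :
    Integrable (fun x => ∑ k ∈ s, c k x • L k) ρ ∧
      ∫ x, ∑ k ∈ s, c k x • L k ∂ρ = ∑ k ∈ s, (∫ x, c k x ∂ρ) • L k := by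
  refine ⟨integrable_finsetSum s fun p _ => (hc p).smul_const _, ?_⟩
  rw [integral_finsetSum s fun p _ => (hc p).smul_const _]
  exact Finset.sum_congr rfl fun q _ => integral_smul_const _ _

variable {H : Type*} [NormedAddCommGroup H] [InnerProductSpace ℝ H] [CompleteSpace H]
  [MeasurableSpace H] [BorelSpace H] [SecondCountableTopology H]

lemma outer_basisProj_self {ι : Type*} (b : HilbertBasis ι ℝ H) (s : Finset ι) (x : H) :
    outer (basisProj b s x) (basisProj b s x) =
      ∑ p ∈ s, ∑ q ∈ s, (⟪b p, x⟫ * ⟪b q, x⟫) • outer (b p) (b q) := by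
  unfold basisProj
  rw [outer_sum_left]
  refine Finset.sum_congr rfl fun p _ => ?_
  rw [outer_sum_right]
  refine Finset.sum_congr rfl fun q _ => ?_
  rw [outer_smul_left, outer_smul_right, smul_smul]

variable {Θ Ω ι : Type*} [MeasurableSpace Ω] [Countable ι] {S : Set Θ} {Pr : Θ → Measure Ω}
  {V : Θ → ℕ → Ω → H} {lam : Θ → Measure H} {η : ℝ} {C : ℝ≥0} {b : HilbertBasis ι ℝ H}

/-- The scalar law with `γ = η / 2`: a product of two coordinates is at most `‖x‖²`, so its moment
of order `1 + η / 2` is one of order `2 + η` of the norm. -/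
lemma UnifCentredMoments.unifTendstoZeroInProb_coord (h : UnifCentredMoments S lam η C b)
    (hPr : ∀ θ ∈ S, IsProbabilityMeasure (Pr θ))
    (hV : ∀ θ ∈ S, IsIIDSample (Pr θ) (V θ) (lam θ)) (p q : ι) :
    UnifTendstoZeroInProb S Pr fun n θ ω =>
      ‖(n : ℝ)⁻¹ * ∑ i : Fin n, ⟪b p, V θ i ω⟫ * ⟪b q, V θ i ω⟫ -
        ∫ x, ⟪b p, x⟫ * ⟪b q, x⟫ ∂(lam θ)‖ₑ := by
  have hm : Measurable fun x : H => ⟪b p, x⟫ * ⟪b q, x⟫ := by fun_prop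
  have key := unifTendstoZeroInProb_average (S := S) (Pr := Pr)
    (Y := fun θ i ω => ⟪b p, V θ i ω⟫ * ⟪b q, V θ i ω⟫)
    (ρ := fun θ => (lam θ).map fun x => ⟪b p, x⟫ * ⟪b q, x⟫) (half_pos h.pos) (C := C) hPr
    (fun θ hθ => have := hPr θ hθ; (hV θ hθ).comp hm) (fun θ hθ => ?_)
  · refine key.mono fun n θ hθ ω => le_of_eq ?_
    congr 2
    exact (integral_map (f := fun x : ℝ => x) hm.aemeasurable
      measurable_id.aestronglyMeasurable).symm
  · rw [lintegral_map (by fun_prop) hm]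
    refine (lintegral_mono fun x => ?_).trans (h.mom θ hθ)
    have hle : ∀ r, ‖⟪b r, x⟫‖ₑ ≤ ‖x‖ₑ := fun r => by
      have := enorm_inner_le (b r) x
      rwa [← ofReal_norm (b r), b.orthonormal.1 r, ENNReal.ofReal_one, one_mul] at this
    have h1 : ‖⟪b p, x⟫ * ⟪b q, x⟫‖ₑ ≤ ‖x‖ₑ ^ (2 : ℝ) := by
      rw [enorm_mul, ENNReal.rpow_two, sq]
      exact mul_le_mul' (hle p) (hle q)
    have hp := h.pos
    refine (ENNReal.rpow_le_rpow h1 (by positivity)).trans (le_of_eq ?_)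
    rw [← ENNReal.rpow_mul]
    congr 1
    ring

/-- The trace norm error of approximating `x ⊗ x` by its projection. -/
lemma traceNorm_outer_self_sub_basisProj_le (b : HilbertBasis ι ℝ H) (s : Finset ι) (x : H) :
    traceNorm (outer x x - outer (basisProj b s x) (basisProj b s x)) ≤
      2 * (‖x‖ₑ * ‖x - basisProj b s x‖ₑ) := by
  refine (traceNorm_outer_self_sub_le _ _).trans ?_
  calc ‖x - basisProj b s x‖ₑ * (‖x‖ₑ + ‖basisProj b s x‖ₑ)
      ≤ ‖x - basisProj b s x‖ₑ * (‖x‖ₑ + ‖x‖ₑ) := by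
        gcongr; exact enorm_basisProj_le b s x
    _ = 2 * (‖x‖ₑ * ‖x - basisProj b s x‖ₑ) := by ring

lemma integral_outer_basisProj_self {ρ : Measure H} [IsProbabilityMeasure ρ] (hL2 : MemLp id 2 ρ)
    (b : HilbertBasis ι ℝ H) (s : Finset ι) :
    Integrable (fun x => outer (basisProj b s x) (basisProj b s x)) ρ ∧
    ∫ x, outer (basisProj b s x) (basisProj b s x) ∂ρ =
      ∑ p ∈ s, ∑ q ∈ s, (∫ x, ⟪b p, x⟫ * ⟪b q, x⟫ ∂ρ) • outer (b p) (b q) := by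
  have hc : ∀ k : ι × ι, Integrable (fun x => ⟪b k.1, x⟫ * ⟪b k.2, x⟫) ρ :=
    fun k => (memLp_inner hL2 (b k.1)).integrable_mul (memLp_inner hL2 (b k.2))
  simp_rw [outer_basisProj_self, ← Finset.sum_product']
  exact integral_sum_smul_const (s ×ˢ s) (fun (k : ι × ι) (x : H) => ⟪b k.1, x⟫ * ⟪b k.2, x⟫)
    (fun k : ι × ι => outer (b k.1) (b k.2)) hc

lemma smul_sum_outer_basisProj_self {n : ℕ} (b : HilbertBasis ι ℝ H) (s : Finset ι) (c : ℝ)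
    (v : Fin n → H) :
    c • ∑ i, outer (basisProj b s (v i)) (basisProj b s (v i)) =
      ∑ p ∈ s, ∑ q ∈ s, (c * ∑ i, ⟪b p, v i⟫ * ⟪b q, v i⟫) • outer (b p) (b q) := by
  simp_rw [outer_basisProj_self, Finset.smul_sum]
  rw [Finset.sum_comm]
  refine Finset.sum_congr rfl fun p _ => ?_
  rw [Finset.sum_comm]
  refine Finset.sum_congr rfl fun q _ => ?_
  rw [Finset.mul_sum, Finset.sum_smul]
  exact Finset.sum_congr rfl fun i _ => smul_smul _ _ _

/-- Compare both operators with their projections. The projected difference is a finite combination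
of rank-one operators of trace norm at most one, with scalar coefficients; the remainders are
averages of pointwise projection errors. -/
lemma traceNorm_average_sub_covOp_le {ρ : Measure H} [IsProbabilityMeasure ρ] (hL2 : MemLp id 2 ρ)
    (b : HilbertBasis ι ℝ H) (s : Finset ι) {n : ℕ} (hn : n ≠ 0) (v : Fin n → H) :
    traceNorm ((n : ℝ)⁻¹ • ∑ i, outer (v i) (v i) - covOp ρ) ≤
      ∑ p ∈ s, ∑ q ∈ s, ‖(n : ℝ)⁻¹ * ∑ i, ⟪b p, v i⟫ * ⟪b q, v i⟫ -
        ∫ x, ⟪b p, x⟫ * ⟪b q, x⟫ ∂ρ‖ₑ +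
      ((n : ℝ≥0∞)⁻¹ * ∑ i, 2 * (‖v i‖ₑ * ‖v i - basisProj b s (v i)‖ₑ) +
        ∫⁻ x, 2 * (‖x‖ₑ * ‖x - basisProj b s x‖ₑ) ∂ρ) := by
  obtain ⟨hi1, hint⟩ := integral_outer_basisProj_self hL2 b s
  have hi2 := integrable_outer_self hL2
  have e1 : ∑ p ∈ s, ∑ q ∈ s, ((n : ℝ)⁻¹ * ∑ i, ⟪b p, v i⟫ * ⟪b q, v i⟫ -
        ∫ x, ⟪b p, x⟫ * ⟪b q, x⟫ ∂ρ) • outer (b p) (b q) =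
      (n : ℝ)⁻¹ • ∑ i, outer (basisProj b s (v i)) (basisProj b s (v i)) -
        ∫ x, outer (basisProj b s x) (basisProj b s x) ∂ρ := by
    simp_rw [sub_smul, Finset.sum_sub_distrib]
    rw [smul_sum_outer_basisProj_self, hint]
  have e2 : (n : ℝ)⁻¹ • ∑ i, outer (v i) (v i) - covOp ρ =
      ((n : ℝ)⁻¹ • ∑ i, outer (basisProj b s (v i)) (basisProj b s (v i)) -
        ∫ x, outer (basisProj b s x) (basisProj b s x) ∂ρ) +
      ((n : ℝ)⁻¹ • ∑ i, (outer (v i) (v i) - outer (basisProj b s (v i)) (basisProj b s (v i))) -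
        ∫ x, (outer x x - outer (basisProj b s x) (basisProj b s x)) ∂ρ) := by
    rw [integral_sub hi2 hi1, Finset.sum_sub_distrib, smul_sub, covOp]
    abel
  rw [e2]
  refine (traceNorm_add_le _ _).trans (add_le_add ?_ ((traceNorm_sub_le _ _).trans
    (add_le_add ?_ (traceNorm_integral_le (hi2.sub hi1)
      (traceNorm_outer_self_sub_basisProj_le b s)))))
  · rw [← e1]
    refine (traceNorm_sum_le _ _).trans (Finset.sum_le_sum fun p _ =>
      (traceNorm_sum_le _ _).trans (Finset.sum_le_sum fun q _ => ?_))
    refine (traceNorm_smul_le _ _).trans ?_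
    refine (mul_le_mul_right (traceNorm_outer_le _ _) _).trans (le_of_eq ?_)
    rw [← ofReal_norm (b p), ← ofReal_norm (b q), b.orthonormal.1 p, b.orthonormal.1 q]
    simp
  · refine (traceNorm_smul_le _ _).trans ?_
    rw [enorm_natCast_inv n hn]
    gcongr
    exact (traceNorm_sum_le _ _).trans (Finset.sum_le_sum fun i _ =>
      traceNorm_outer_self_sub_basisProj_le b s _)

/-- The **uniform law of large numbers** for `V_i ⊗ V_i` in trace norm. -/
theorem UnifCentredMoments.unifTendstoZeroInProb_traceNorm (h : UnifCentredMoments S lam η C b)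
    (hPr : ∀ θ ∈ S, IsProbabilityMeasure (Pr θ))
    (hV : ∀ θ ∈ S, IsIIDSample (Pr θ) (V θ) (lam θ)) :
    UnifTendstoZeroInProb S Pr fun n θ ω =>
      traceNorm ((n : ℝ)⁻¹ • ∑ i : Fin n, outer (V θ i ω) (V θ i ω) - covOp (lam θ)) := by
  refine UnifTendstoZeroInProb.of_approx fun κ hκ => ?_
  -- Balances Young's inequality: `c (1 + C) = κ / 8`, and tails below `c κ / 8` contribute another
  -- `κ / 8`; doubled, they sum to `κ / 2`.
  set c : ℝ≥0 := κ / (8 * (1 + C)) with hc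
  have hc0 : 0 < c := by positivity
  obtain ⟨s, hs⟩ := h.tail ((c * (κ / 8) : ℝ≥0) : ℝ≥0∞) (by
    rw [ENNReal.coe_pos]; positivity)
  set G : H → ℝ≥0∞ := fun x => 2 * (‖x‖ₑ * ‖x - basisProj b s x‖ₑ) with hG
  have hπ : Measurable (basisProj b s) := (continuous_basisProj b s).measurable
  have hGm : Measurable G := by
    have : Measurable fun x : H => ‖x - basisProj b s x‖ₑ := (measurable_id.sub hπ).enorm
    fun_prop
  have hGint : ∀ θ ∈ S, ∫⁻ x, G x ∂(lam θ) ≤ κ / 2 := fun θ hθ => by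
    have := h.prob θ hθ
    have hB := lintegral_enorm_sq_le h.pos.le (h.mom θ hθ)
    have hm2 : Measurable fun x : H => ‖x - basisProj b s x‖ₑ ^ 2 :=
      (measurable_id.sub hπ).enorm.pow_const 2
    calc ∫⁻ x, G x ∂(lam θ)
        ≤ ∫⁻ x, 2 * (c * ‖x‖ₑ ^ 2 + (c⁻¹ : ℝ≥0) * ‖x - basisProj b s x‖ₑ ^ 2) ∂(lam θ) :=
          lintegral_mono fun x => mul_le_mul_right (ENNReal_mul_le_add_sq _ _ hc0) _
      _ = 2 * (c * ∫⁻ x, ‖x‖ₑ ^ 2 ∂(lam θ) +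
            (c⁻¹ : ℝ≥0) * ∫⁻ x, ‖x - basisProj b s x‖ₑ ^ 2 ∂(lam θ)) := by
          rw [lintegral_const_mul _ (by fun_prop), lintegral_add_left (by fun_prop),
            lintegral_const_mul _ (by fun_prop), lintegral_const_mul _ hm2]
      _ ≤ 2 * (c * (1 + C : ℝ≥0) + (c⁻¹ : ℝ≥0) * (c * (κ / 8) : ℝ≥0)) := by
          gcongr
          exact hs θ hθ
      _ = ((2 * (c * (1 + C) + c⁻¹ * (c * (κ / 8))) : ℝ≥0) : ℝ≥0∞) := by push_cast; rfl
      _ = ((κ / 2 : ℝ≥0) : ℝ≥0∞) := by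
          congr 1
          rw [inv_mul_cancel_left₀ hc0.ne', hc]
          field_simp
          norm_num
      _ = κ / 2 := by simp
  refine ⟨_, fun n θ ω => (n : ℝ≥0∞)⁻¹ * ∑ i : Fin n, G (V θ i ω) + ∫⁻ x, G x ∂(lam θ),
    UnifTendstoZeroInProb.sum s fun p _ => UnifTendstoZeroInProb.sum s fun q _ =>
      h.unifTendstoZeroInProb_coord hPr hV p q, ?_⟩
  filter_upwards [eventually_gt_atTop 0] with n hn θ hθ
  have := hPr θ hθ
  have := h.prob θ hθ
  have hL2 : MemLp id 2 (lam θ) :=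
    memLp_two_of_lintegral (lintegral_enorm_sq_le h.pos.le (h.mom θ hθ))
  refine ⟨fun ω => traceNorm_average_sub_covOp_le hL2 b s hn.ne' _, ?_, ?_⟩
  · have hVm := (hV θ hθ).1
    have : Measurable fun ω => ∑ i : Fin n, G (V θ i ω) :=
      Finset.measurable_sum _ fun i _ => hGm.comp (hVm i)
    fun_prop
  · rw [lintegral_add_right _ measurable_const, lintegral_const, measure_univ, mul_one,
      ← ENNReal.add_halves (κ : ℝ≥0∞)]
    exact add_le_add (((hV θ hθ).lintegral_average_le hGm n).trans (hGint θ hθ)) (hGint θ hθ)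

end TraceLLN

lemma abs_indicator_one_le {T : Type*} (s : Set T) (x : T) :
    |s.indicator (fun _ => (1 : ℝ)) x| ≤ 1 := by
  by_cases hx : x ∈ s <;> simp [hx]

/-! ### Conditional independence as invariance under redrawing. -/

section CondIndep

variable {Ω α β γ : Type*} [mΩ : MeasurableSpace Ω] [MeasurableSpace α] [MeasurableSpace β]
  [mγ : MeasurableSpace γ] [StandardBorelSpace β] [Nonempty β] {μ : Measure Ω}
  [IsProbabilityMeasure μ] {X : Ω → α} {Y : Ω → β} {Z : Ω → γ}

/-- The conditional probability of `Y ∈ B` given `Z` is a function of `Z`, so in the factorized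
conditional expectation it may be moved back inside next to the indicator of `X ∈ A`. -/
lemma setIntegral_mul_eq_setIntegral_condDistrib (hX : Measurable X) (hY : Measurable Y)
    (hZ : Measurable Z)
    (h : ∀ (φ : α → ℝ) (ψ : β → ℝ), Measurable φ → Measurable ψ →
      (∃ c, ∀ x, |φ x| ≤ c) → (∃ c, ∀ y, |ψ y| ≤ c) →
      μ[fun ω => φ (X ω) * ψ (Y ω) | mγ.comap Z] =ᵐ[μ]
        μ[fun ω => φ (X ω) | mγ.comap Z] * μ[fun ω => ψ (Y ω) | mγ.comap Z])
    {A : Set α} {B : Set β} {C : Set γ} (hA : MeasurableSet A) (hB : MeasurableSet B)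
    (hC : MeasurableSet C) :
    μ.real (X ⁻¹' A ∩ Y ⁻¹' B ∩ Z ⁻¹' C) =
      ∫ ω in Z ⁻¹' C, (X ⁻¹' A).indicator (fun _ => (1 : ℝ)) ω *
        (condDistrib Y Z μ (Z ω)).real B ∂μ := by
  have hm : mγ.comap Z ≤ mΩ := hZ.comap_le
  set a : Ω → ℝ := (X ⁻¹' A).indicator fun _ => 1
  set b : Ω → ℝ := (Y ⁻¹' B).indicator fun _ => 1
  set k : Ω → ℝ := fun ω => (condDistrib Y Z μ (Z ω)).real B
  have hab : μ[a * b | mγ.comap Z] =ᵐ[μ] μ[a | mγ.comap Z] * μ[b | mγ.comap Z] :=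
    h (A.indicator fun _ => 1) (B.indicator fun _ => 1) (measurable_const.indicator hA)
      (measurable_const.indicator hB) ⟨1, abs_indicator_one_le A⟩ ⟨1, abs_indicator_one_le B⟩
  have hk : k =ᵐ[μ] μ[b | mγ.comap Z] := condDistrib_ae_eq_condExp hZ hY hB
  have hkm : StronglyMeasurable[mγ.comap Z] k :=
    (measurable_condDistrib hB).ennreal_toReal.stronglyMeasurable
  have ha : Integrable a μ := (integrable_const _).indicator (hX hA)
  have hkb : ∀ ω, |k ω| ≤ 1 := fun ω => by
    rw [abs_of_nonneg measureReal_nonneg]; exact measureReal_le_one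
  have hak : Integrable (a * k) μ :=
    Integrable.mul_bdd (c := 1) ha (hkm.mono hm).aestronglyMeasurable (ae_of_all _ hkb)
  have e2 : a * b = (X ⁻¹' A ∩ Y ⁻¹' B).indicator fun _ => 1 := by
    ext ω
    by_cases h1 : X ω ∈ A <;> by_cases h2 : Y ω ∈ B <;> simp [a, b, h1, h2]
  have habi : Integrable (a * b) μ := by
    rw [e2]
    exact (integrable_const _).indicator ((hX hA).inter (hY hB))
  have key : μ[a * b | mγ.comap Z] =ᵐ[μ] μ[a * k | mγ.comap Z] := by
    filter_upwards [hab, hk, condExp_mul_of_stronglyMeasurable_right hkm hak ha] with ω h1 h2 h3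
    rw [h1, h3, Pi.mul_apply, Pi.mul_apply, h2]
  have hCm : MeasurableSet[mγ.comap Z] (Z ⁻¹' C) := ⟨C, hC, rfl⟩
  have e1 : ∫ ω in Z ⁻¹' C, (a * b) ω ∂μ = ∫ ω in Z ⁻¹' C, (a * k) ω ∂μ := by
    rw [← setIntegral_condExp hm habi hCm, ← setIntegral_condExp hm hak hCm]
    exact integral_congr_ae (ae_restrict_of_ae key)
  refine Eq.trans ?_ e1
  rw [e2, integral_indicator_const _ ((hX hA).inter (hY hB)),
    measureReal_restrict_apply ((hX hA).inter (hY hB))]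
  simp

/-- Under conditional independence of `X` and `Y` given `Z`, redrawing `Y` from its conditional
distribution given `Z` does not change the law of `(X, Y, Z)`. -/
lemma lintegral_condDistrib_of_condIndep (hX : Measurable X) (hY : Measurable Y)
    (hZ : Measurable Z)
    (h : ∀ (φ : α → ℝ) (ψ : β → ℝ), Measurable φ → Measurable ψ →
      (∃ c, ∀ x, |φ x| ≤ c) → (∃ c, ∀ y, |ψ y| ≤ c) →
      μ[fun ω => φ (X ω) * ψ (Y ω) | mγ.comap Z] =ᵐ[μ]
        μ[fun ω => φ (X ω) | mγ.comap Z] * μ[fun ω => ψ (Y ω) | mγ.comap Z])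
    {F : α × β × γ → ℝ≥0∞} (hF : Measurable F) :
    ∫⁻ ω, F (X ω, Y ω, Z ω) ∂μ =
      ∫⁻ ω, ∫⁻ y, F (X ω, y, Z ω) ∂(condDistrib Y Z μ (Z ω)) ∂μ := by
  set κ : Kernel Ω β := (condDistrib Y Z μ).comap Z hZ
  have hr : Measurable fun p : Ω × β => (X p.1, p.2, Z p.1) := by fun_prop
  have hl : Measurable fun ω => (X ω, Y ω, Z ω) := by fun_prop
  have heq : μ.map (fun ω => (X ω, Y ω, Z ω)) =
      (μ ⊗ₘ κ).map (fun p : Ω × β => (X p.1, p.2, Z p.1)) := by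
    have := Measure.isProbabilityMeasure_map (μ := μ) hl.aemeasurable
    -- Boxes determine the law, and for boxes the claim is the preceding lemma.
    refine Measure.ext_prod₃ fun {A B C} hA hB hC => ?_
    have hS : MeasurableSet (A ×ˢ B ×ˢ C) := hA.prod (hB.prod hC)
    rw [Measure.map_apply hl hS, Measure.map_apply hr hS, Measure.compProd_apply (hr hS)]
    have e1 : (fun ω => (X ω, Y ω, Z ω)) ⁻¹' A ×ˢ B ×ˢ C = X ⁻¹' A ∩ Y ⁻¹' B ∩ Z ⁻¹' C := by
      ext ω; simp [and_assoc]
    have hk0 : Measurable fun ω => (condDistrib Y Z μ (Z ω)) B :=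
      (Kernel.measurable_coe _ hB).comp hZ
    have e2 : ∀ ω, κ ω (Prod.mk ω ⁻¹' ((fun p : Ω × β => (X p.1, p.2, Z p.1)) ⁻¹' A ×ˢ B ×ˢ C)) =
        (Z ⁻¹' C).indicator (fun ω => ENNReal.ofReal ((X ⁻¹' A).indicator (fun _ => (1 : ℝ)) ω *
          (condDistrib Y Z μ (Z ω)).real B)) ω := by
      intro ω
      by_cases h1 : X ω ∈ A <;> by_cases h2 : Z ω ∈ C <;>
        simp [κ, h1, h2, Set.preimage, Set.mem_prod]
    rw [lintegral_congr e2, lintegral_indicator (hZ hC), e1, ← ofReal_measureReal,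
      setIntegral_mul_eq_setIntegral_condDistrib hX hY hZ h hA hB hC,
      ofReal_integral_eq_lintegral_ofReal]
    · refine Integrable.mono' (integrable_const (1 : ℝ)) (Measurable.aestronglyMeasurable
        ((measurable_const.indicator (hX hA)).mul hk0.ennreal_toReal)) (ae_of_all _ fun ω => ?_)
      rw [norm_mul]
      refine mul_le_one₀ ?_ (norm_nonneg _) ?_
      · by_cases h1 : X ω ∈ A <;> simp [h1]
      · rw [Real.norm_of_nonneg measureReal_nonneg]; exact measureReal_le_one
    · refine ae_of_all _ fun ω => mul_nonneg ?_ measureReal_nonneg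
      exact Set.indicator_nonneg (fun _ _ => zero_le_one) _
  rw [← lintegral_map hF hl, heq, lintegral_map hF hr]
  exact Measure.lintegral_compProd (f := fun p : Ω × β => F (X p.1, p.2, Z p.1)) (hF.comp hr)

end CondIndep

/-! ### Redrawing one coordinate of an i.i.d. sample. -/

section Resampling

/-- Redrawing the middle component from the kernel `κ` given the last one leaves `P` invariant. -/
def ResampleInvariant {U F 𝒵 : Type*} [MeasurableSpace U] [MeasurableSpace F] [MeasurableSpace 𝒵]
    (P : Measure (U × F × 𝒵)) (κ : Kernel 𝒵 F) : Prop :=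
  ∀ G : U × F × 𝒵 → ℝ≥0∞, Measurable G →
    ∫⁻ w, G w ∂P = ∫⁻ w, ∫⁻ y, G (w.1, y, w.2.2) ∂(κ w.2.2) ∂P

/-- Integrating out coordinate `i` produces a function that ignores it, and averaging such a
function over coordinate `i` again changes nothing. -/
lemma lintegral_pi_update {T : Type*} [MeasurableSpace T] {P : Measure T} [IsProbabilityMeasure P]
    {n : ℕ} (i : Fin n) {G : (Fin n → T) → ℝ≥0∞} (hG : Measurable G) :
    ∫⁻ d, G d ∂(Measure.pi fun _ => P) =
      ∫⁻ d, ∫⁻ w, G (Function.update d i w) ∂P ∂(Measure.pi fun _ => P) := by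
  set g : (Fin n → T) → ℝ≥0∞ := fun d => ∫⁻ w, G (Function.update d i w) ∂P
  have hg : Measurable g := by
    have : Measurable fun p : (Fin n → T) × T => G (Function.update p.1 i p.2) :=
      hG.comp measurable_update'
    exact this.lintegral_prod_right'
  have h1 := lmarginal_erase' (μ := fun _ : Fin n => P) G hG (Finset.mem_univ i)
  have h2 := lmarginal_erase' (μ := fun _ : Fin n => P) g hg (Finset.mem_univ i)
  have h3 : (fun x => ∫⁻ w, g (Function.update x i w) ∂P) = g := by
    ext x; simp [g]
  rw [h3] at h2
  have h4 := h1.trans h2.symm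
  rw [lmarginal_univ, lmarginal_univ] at h4
  -- Marginals are functions, compared at a base point; without points both integrals vanish.
  rcases isEmpty_or_nonempty (Fin n → T) with he | ⟨⟨x⟩⟩
  · simp [Measure.eq_zero_of_isEmpty]
  · exact congrFun h4 x

variable {U F 𝒵 : Type*} [MeasurableSpace U] [MeasurableSpace 𝒵]
  [NormedAddCommGroup F] [InnerProductSpace ℝ F] [CompleteSpace F]
  [SecondCountableTopology F] [MeasurableSpace F] [BorelSpace F]

/-- Redrawing the middle component of the `i`th observation. -/
def redraw {n : ℕ} (i : Fin n) (p : (Fin n → U × F × 𝒵) × F) : Fin n → U × F × 𝒵 :=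
  Function.update p.1 i ((p.1 i).1, p.2, (p.1 i).2.2)

lemma measurable_redraw {n : ℕ} (i : Fin n) : Measurable (redraw (U := U) (F := F) (𝒵 := 𝒵) i) := by
  have h : Measurable fun p : (Fin n → U × F × 𝒵) × F =>
      (p.1, ((p.1 i).1, p.2, (p.1 i).2.2)) := by fun_prop
  exact measurable_update'.comp h

/-- Redraw the whole `i`th observation on both sides, then apply the invariance of a single
observation. -/
lemma ResampleInvariant.lintegral_pi {P : Measure (U × F × 𝒵)} [IsProbabilityMeasure P]
    {κ : Kernel 𝒵 F} [IsMarkovKernel κ] (h : ResampleInvariant P κ) {n : ℕ} (i : Fin n)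
    {G : (Fin n → U × F × 𝒵) → ℝ≥0∞} (hG : Measurable G) :
    ∫⁻ d, G d ∂(Measure.pi fun _ => P) =
      ∫⁻ d, ∫⁻ y, G (redraw i (d, y)) ∂(κ (d i).2.2) ∂(Measure.pi fun _ => P) := by
  have hz : Measurable fun d : Fin n → U × F × 𝒵 => (d i).2.2 := by fun_prop
  have hm : Measurable fun d : Fin n → U × F × 𝒵 =>
      ∫⁻ y, G (redraw i (d, y)) ∂(κ (d i).2.2) :=
    Measurable.lintegral_kernel_prod_right' (κ := κ.comap _ hz)
      (hG.comp (measurable_redraw i))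
  rw [lintegral_pi_update i hG, lintegral_pi_update i hm]
  refine lintegral_congr fun d => ?_
  rw [h (fun w => G (Function.update d i w)) (hG.comp (measurable_update d))]
  refine lintegral_congr fun w => ?_
  simp [redraw]

/-- An integrand that is a centred linear functional of a redrawn variable integrates to zero. -/
lemma integral_eq_zero_of_resample {D : Type*} [MeasurableSpace D] {M : Measure D}
    [IsProbabilityMeasure M] {K : Kernel D F} [IsMarkovKernel K] {res : D × F → D}
    (hres : Measurable res)
    (hM : ∀ G : D → ℝ≥0∞, Measurable G → ∫⁻ d, G d ∂M = ∫⁻ d, ∫⁻ y, G (res (d, y)) ∂(K d) ∂M)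
    {m h : D → F} (hm : ∀ᵐ d ∂M, Integrable id (K d) ∧ ∫ y, y ∂(K d) = m d) {G : D → ℝ}
    (hG : Integrable G M) (hGres : ∀ d y, G (res (d, y)) = ⟪h d, y - m d⟫) :
    ∫ d, G d ∂M = 0 := by
  -- `M` is itself the law of the redrawn data, so `y` may be integrated first, and `⟪h d, y - m d⟫`
  -- then averages to zero.
  have heq : M = (M ⊗ₘ K).map res := by
    refine Measure.ext_of_lintegral _ fun f hf => ?_
    rw [hM f hf, lintegral_map hf hres]
    exact (Measure.lintegral_compProd (f := fun p => f (res p)) (hf.comp hres)).symm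
  have hG' : Integrable (G ∘ res) (M ⊗ₘ K) := by
    rw [heq] at hG
    exact (integrable_map_measure hG.1 hres.aemeasurable).1 hG
  have hGm : AEStronglyMeasurable G ((M ⊗ₘ K).map res) := by rw [← heq]; exact hG.1
  have e1 : ∫ d, G d ∂M = ∫ p, (G ∘ res) p ∂(M ⊗ₘ K) := by
    conv_lhs => rw [heq]
    exact integral_map hres.aemeasurable hGm
  rw [e1, Measure.integral_compProd hG']
  refine integral_eq_zero_of_ae ?_
  filter_upwards [hm] with d hd
  simp only [Function.comp_apply, hGres, Pi.zero_apply]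
  have h1 : Integrable (fun y => y) (K d) := hd.1
  have hi : Integrable (fun y => y - m d) (K d) := h1.sub (integrable_const _)
  rw [integral_inner hi, integral_sub h1 (integrable_const _), hd.2]
  simp

end Resampling

/-! ### Orthogonal sums in `L²`. -/

section Orthogonal

variable {D H : Type*} [MeasurableSpace D] {ν : Measure D} [NormedAddCommGroup H]
  [InnerProductSpace ℝ H]

lemma _root_.MeasureTheory.MemLp.integrable_norm_sq {X : D → H} (hX : MemLp X 2 ν) :
    Integrable (fun d => ‖X d‖ ^ 2) ν :=
  (memLp_two_iff_integrable_sq_norm hX.1).1 hX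

lemma _root_.MeasureTheory.MemLp.integrable_inner {X Y : D → H} (hX : MemLp X 2 ν)
    (hY : MemLp Y 2 ν) : Integrable (fun d => ⟪X d, Y d⟫) ν := by
  refine (hX.integrable_norm_sq.add hY.integrable_norm_sq).mono' (hX.1.inner hY.1)
    (ae_of_all _ fun d => ?_)
  refine (norm_inner_le_norm (𝕜 := ℝ) _ _).trans ?_
  simp only [Pi.add_apply]
  nlinarith [sq_nonneg (‖X d‖ - ‖Y d‖), sq_nonneg ‖X d‖, sq_nonneg ‖Y d‖]

lemma memLp_two_of_lintegral_ne_top {X : D → H} (hm : AEStronglyMeasurable X ν)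
    (hX : ∫⁻ d, ‖X d‖ₑ ^ 2 ∂ν ≠ ∞) : MemLp X 2 ν := by
  refine ⟨hm, ?_⟩
  rw [eLpNorm_lt_top_iff_lintegral_rpow_enorm_lt_top (by norm_num) (by norm_num)]
  simpa using hX.lt_top

/-- Pythagoras for square integrable random elements with vanishing cross terms. -/
lemma lintegral_enorm_sum_sq_of_orthogonal {n : ℕ} {V : Fin n → D → H}
    (hV : ∀ i, MemLp (V i) 2 ν) (hij : ∀ i j, i ≠ j → ∫ d, ⟪V i d, V j d⟫ ∂ν = 0) :
    ∫⁻ d, ‖∑ i, V i d‖ₑ ^ 2 ∂ν = ∑ i, ∫⁻ d, ‖V i d‖ₑ ^ 2 ∂ν := by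
  classical
  have hsq : ∀ x : H, ‖x‖ₑ ^ 2 = ENNReal.ofReal (‖x‖ ^ 2) := fun x => by
    rw [ENNReal.ofReal_pow (norm_nonneg _), ofReal_norm]
  have hint : ∀ {X : D → H}, MemLp X 2 ν →
      ∫⁻ d, ‖X d‖ₑ ^ 2 ∂ν = ENNReal.ofReal (∫ d, ‖X d‖ ^ 2 ∂ν) := fun {X} hX => by
    rw [ofReal_integral_eq_lintegral_ofReal hX.integrable_norm_sq
      (ae_of_all _ fun _ => sq_nonneg _)]
    exact lintegral_congr fun d => hsq _
  have hcross : ∀ i j, Integrable (fun d => ⟪V i d, V j d⟫) ν := fun i j =>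
    (hV i).integrable_inner (hV j)
  rw [hint (memLp_finsetSum _ fun i _ => hV i)]
  simp_rw [hint (hV _)]
  rw [← ENNReal.ofReal_sum_of_nonneg fun i _ => integral_nonneg fun d => sq_nonneg _]
  congr 1
  simp_rw [← real_inner_self_eq_norm_sq, sum_inner, inner_sum]
  rw [integral_finsetSum _ fun i _ => integrable_finsetSum _ fun j _ => hcross i j]
  refine Finset.sum_congr rfl fun i _ => ?_
  rw [integral_finsetSum _ fun j _ => hcross i j]
  exact Finset.sum_eq_single i (fun j _ hj => hij i j hj.symm) (by simp)

end Orthogonal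

/-! ### Noise sums with coefficients that redrawing does not affect. -/

section Noise

variable {U F E 𝒵 : Type*} [MeasurableSpace U] [MeasurableSpace 𝒵]
  [NormedAddCommGroup F] [InnerProductSpace ℝ F] [CompleteSpace F]
  [SecondCountableTopology F] [MeasurableSpace F] [BorelSpace F]
  [NormedAddCommGroup E] [InnerProductSpace ℝ E] [CompleteSpace E]
  [SecondCountableTopology E] [MeasurableSpace E] [BorelSpace E]

@[simp] lemma redraw_snd_snd {n : ℕ} (i j : Fin n) (p : (Fin n → U × F × 𝒵) × F) :
    (redraw i p j).2.2 = (p.1 j).2.2 := by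
  by_cases h : j = i
  · subst h; simp [redraw]
  · simp [redraw, h]

@[simp] lemma redraw_fst {n : ℕ} (i j : Fin n) (p : (Fin n → U × F × 𝒵) × F) :
    (redraw i p j).1 = (p.1 j).1 := by
  by_cases h : j = i
  · subst h; simp [redraw]
  · simp [redraw, h]

@[simp] lemma redraw_snd_fst_self {n : ℕ} (i : Fin n) (p : (Fin n → U × F × 𝒵) × F) :
    (redraw i p i).2.1 = p.2 := by
  simp [redraw]

lemma redraw_of_ne {n : ℕ} {i j : Fin n} (h : j ≠ i) (p : (Fin n → U × F × 𝒵) × F) :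
    redraw i p j = p.1 j := by
  simp [redraw, h]

variable {P : Measure (U × F × 𝒵)} [IsProbabilityMeasure P] {κ : Kernel 𝒵 F} [IsMarkovKernel κ]
  {g : 𝒵 → F} {n : ℕ} {α : (Fin n → U × F × 𝒵) → Fin n → E} {c : ℝ≥0}

/-- The event that the weighted sum of the squared coefficients is at most `c`. -/
def weightedEvent (κ : Kernel 𝒵 F) (g : 𝒵 → F) (α : (Fin n → U × F × 𝒵) → Fin n → E) (c : ℝ≥0) :
    Set (Fin n → U × F × 𝒵) :=
  {d | ∑ i, ‖α d i‖ₑ ^ 2 * ∫⁻ y, ‖y - g (d i).2.2‖ₑ ^ 2 ∂(κ (d i).2.2) ≤ c}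

lemma measurable_condVar (hg : Measurable g) :
    Measurable fun z => ∫⁻ y, ‖y - g z‖ₑ ^ 2 ∂(κ z) :=
  Measurable.lintegral_kernel_prod_right' (f := fun p : 𝒵 × F => ‖p.2 - g p.1‖ₑ ^ 2)
    (by fun_prop)

lemma measurableSet_weightedEvent (hg : Measurable g) (hα : ∀ i, Measurable fun d => α d i) :
    MeasurableSet (weightedEvent κ g α c) := by
  refine measurableSet_le (Finset.measurable_sum _ fun i _ => ?_) measurable_const
  have := measurable_condVar (κ := κ) hg
  have h2 : Measurable fun d : Fin n → U × F × 𝒵 => (d i).2.2 := by fun_prop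
  exact ((hα i).enorm.pow_const 2).mul (this.comp h2)

/-- The event involves only the coefficients and the `z`'s, neither of which redrawing touches.
Truncating to it therefore preserves the orthogonality of the noise. -/
lemma redraw_mem_weightedEvent (hres : ∀ d i j y, α (redraw i (d, y)) j = α d j)
    (d : Fin n → U × F × 𝒵) (i : Fin n) (y : F) :
    redraw i (d, y) ∈ weightedEvent κ g α c ↔ d ∈ weightedEvent κ g α c := by
  simp [weightedEvent, hres]

/-- Redrawing the `i`th noise replaces its squared norm by the conditional variance; on the event
the resulting sum is at most `c`. -/
lemma setLIntegral_sum_noise_le (hP : ResampleInvariant P κ) (hg : Measurable g)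
    (hα : ∀ i, Measurable fun d => α d i) (hres : ∀ d i j y, α (redraw i (d, y)) j = α d j) :
    ∫⁻ d in weightedEvent κ g α c, ∑ i, ‖α d i‖ₑ ^ 2 * ‖(d i).2.1 - g (d i).2.2‖ₑ ^ 2
      ∂(Measure.pi fun _ => P) ≤ c := by
  have hA : MeasurableSet (weightedEvent κ g α c) := measurableSet_weightedEvent hg hα
  have hv := measurable_condVar (κ := κ) hg
  have hz : ∀ i : Fin n, Measurable fun d : Fin n → U × F × 𝒵 => (d i).2.2 := fun i => by fun_prop
  have hm : ∀ i : Fin n, Measurable fun d : Fin n → U × F × 𝒵 =>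
      ‖α d i‖ₑ ^ 2 * ‖(d i).2.1 - g (d i).2.2‖ₑ ^ 2 := fun i =>
    ((hα i).enorm.pow_const 2).mul (by fun_prop)
  have hm' : ∀ i : Fin n, Measurable fun d : Fin n → U × F × 𝒵 =>
      ‖α d i‖ₑ ^ 2 * ∫⁻ y, ‖y - g (d i).2.2‖ₑ ^ 2 ∂(κ (d i).2.2) := fun i =>
    ((hα i).enorm.pow_const 2).mul (hv.comp (hz i))
  have key : ∀ i, ∫⁻ d in weightedEvent κ g α c, ‖α d i‖ₑ ^ 2 * ‖(d i).2.1 - g (d i).2.2‖ₑ ^ 2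
      ∂(Measure.pi fun _ => P) = ∫⁻ d in weightedEvent κ g α c,
        ‖α d i‖ₑ ^ 2 * ∫⁻ y, ‖y - g (d i).2.2‖ₑ ^ 2 ∂(κ (d i).2.2) ∂(Measure.pi fun _ => P) := by
    intro i
    rw [← lintegral_indicator hA, ← lintegral_indicator hA,
      hP.lintegral_pi i ((hm i).indicator hA)]
    refine lintegral_congr fun d => ?_
    by_cases hd : d ∈ weightedEvent κ g α c
    · rw [Set.indicator_of_mem hd, ← lintegral_const_mul _ (by fun_prop)]
      refine lintegral_congr fun y => ?_
      rw [Set.indicator_of_mem ((redraw_mem_weightedEvent hres d i y).2 hd)]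
      simp [hres]
    · rw [Set.indicator_of_notMem hd]
      refine (lintegral_congr fun y => ?_).trans lintegral_zero
      exact Set.indicator_of_notMem (fun h => hd ((redraw_mem_weightedEvent hres d i y).1 h)) _
  rw [lintegral_finsetSum _ fun i _ => hm i, Finset.sum_congr rfl fun i _ => key i,
    ← lintegral_finsetSum _ fun i _ => hm' i]
  refine (setLIntegral_mono' hA (g := fun _ => (c : ℝ≥0∞)) fun d hd => hd).trans ?_
  rw [setLIntegral_const]
  exact mul_le_of_le_one_right zero_le prob_le_one

/-- Orthogonality reduces the square of the sum to the diagonal, which is bounded by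
`setLIntegral_sum_noise_le`. -/
lemma setLIntegral_enorm_sum_noise_sq_le (hP : ResampleInvariant P κ) (hg : Measurable g)
    (hκ : ∀ᵐ w ∂P, Integrable id (κ w.2.2) ∧ ∫ y, y ∂(κ w.2.2) = g w.2.2)
    (hα : ∀ i, Measurable fun d => α d i) (hres : ∀ d i j y, α (redraw i (d, y)) j = α d j) :
    ∫⁻ d in weightedEvent κ g α c, ‖∑ i, HS.outer (α d i) ((d i).2.1 - g (d i).2.2)‖ₑ ^ 2
      ∂(Measure.pi fun _ => P) ≤ c := by
  set A := weightedEvent κ g α c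
  have hA : MeasurableSet A := measurableSet_weightedEvent hg hα
  have hle := setLIntegral_sum_noise_le (c := c) hP hg hα hres
  have hξ : ∀ i : Fin n, Measurable fun d : Fin n → U × F × 𝒵 => (d i).2.1 - g (d i).2.2 :=
    fun i => by fun_prop
  have hm : ∀ i : Fin n, Measurable fun d : Fin n → U × F × 𝒵 =>
      ‖α d i‖ₑ ^ 2 * ‖(d i).2.1 - g (d i).2.2‖ₑ ^ 2 := fun i =>
    ((hα i).enorm.pow_const 2).mul ((hξ i).enorm.pow_const 2)
  rw [lintegral_finsetSum _ fun i _ => hm i] at hle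
  have hsq : ∀ (d : Fin n → U × F × 𝒵) (i : Fin n),
      ‖HS.outer (α d i) ((d i).2.1 - g (d i).2.2)‖ₑ ^ 2 =
        ‖α d i‖ₑ ^ 2 * ‖(d i).2.1 - g (d i).2.2‖ₑ ^ 2 := fun d i => by
    rw [HS.enorm_outer, mul_pow]
  have hV : ∀ i, MemLp (fun d => HS.outer (α d i) ((d i).2.1 - g (d i).2.2)) 2
      ((Measure.pi fun _ => P).restrict A) := fun i => by
    refine memLp_two_of_lintegral_ne_top (HS.continuous_outer.comp_stronglyMeasurable
      ((hα i).prodMk (hξ i)).stronglyMeasurable).aestronglyMeasurable ?_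
    simp_rw [hsq]
    -- The truncation to the event is what makes each summand square integrable.
    exact ne_top_of_le_ne_top ENNReal.coe_ne_top
      ((Finset.single_le_sum (f := fun i => ∫⁻ d in A, ‖α d i‖ₑ ^ 2 *
        ‖(d i).2.1 - g (d i).2.2‖ₑ ^ 2 ∂(Measure.pi fun _ => P)) (fun _ _ => zero_le)
        (Finset.mem_univ i)).trans hle)
  rw [lintegral_enorm_sum_sq_of_orthogonal hV]
  · simp_rw [hsq]
    exact hle
  intro i j hij
  rw [← integral_indicator hA]
  have hz : Measurable fun d : Fin n → U × F × 𝒵 => (d i).2.2 := by fun_prop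
  have hκ' : ∀ᵐ d ∂(Measure.pi fun _ : Fin n => P), Integrable id (κ (d i).2.2) ∧
      ∫ y, y ∂(κ (d i).2.2) = g (d i).2.2 :=
    (measurePreserving_eval (fun _ : Fin n => P) i).quasiMeasurePreserving.ae hκ
  -- Redraw the `i`th noise with the `j`th held fixed: the cross term is linear in the former.
  refine integral_eq_zero_of_resample (K := κ.comap _ hz) (res := redraw i)
    (m := fun d => g (d i).2.2)
    (h := fun d => A.indicator (fun d => ⟪α d i, α d j⟫ • ((d j).2.1 - g (d j).2.2)) d)
    (measurable_redraw i) (fun G hG => hP.lintegral_pi i hG) hκ'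
    ((integrable_indicator_iff hA).2 ((hV i).integrable_inner (hV j))) fun d y => ?_
  by_cases hd : d ∈ A
  · have hd' : redraw i (d, y) ∈ A := (redraw_mem_weightedEvent hres d i y).2 hd
    simp only [Set.indicator_of_mem hd, Set.indicator_of_mem hd', HS.inner_outer_outer, hres,
      redraw_snd_snd, redraw_snd_fst_self, redraw_of_ne hij.symm, inner_smul_left]
    simp [real_inner_comm]
  · have hd' : redraw i (d, y) ∉ A := fun h => hd ((redraw_mem_weightedEvent hres d i y).1 h)
    simp [hd, hd']

end Noise

/-! ### From moments on an event to convergence in probability. -/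

section UniformNoise

variable {Θ Ω : Type*} [MeasurableSpace Ω] {S : Set Θ} {Pr : Θ → Measure Ω}

/-- Convergence in probability from a bound on the first moment on the event that a control
variable is small. -/
lemma UnifTendstoZeroInProb.of_lintegral_control {D M : ℕ → Θ → Ω → ℝ≥0∞}
    (hM : UnifTendstoZeroInProb S Pr M)
    (hMm : ∀ n, ∀ θ ∈ S, Measurable (M n θ)) (hDm : ∀ n, ∀ θ ∈ S, Measurable (D n θ))
    (h : ∀ c : ℝ≥0, ∀ᶠ n in atTop, ∀ θ ∈ S, ∫⁻ ω in {ω | M n θ ω ≤ c}, D n θ ω ∂(Pr θ) ≤ c) :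
    UnifTendstoZeroInProb S Pr D := by
  classical
  -- The bound is infinite off the event and zero on it, so it matters only through the probability
  -- that the control exceeds `c`.
  refine of_approx fun c hc => ⟨fun n θ ω => if M n θ ω ≤ c then 0 else ∞,
    fun n θ => {ω | M n θ ω ≤ c}.indicator (D n θ), ?_, ?_⟩
  · intro δ hδ
    refine tendsto_of_tendsto_of_tendsto_of_le_of_le tendsto_const_nhds (hM c (by exact_mod_cast hc))
      (fun _ => zero_le) fun n => iSup₂_mono fun θ _ => measure_mono fun ω hω => ?_
    simp only [Set.mem_ofPred_eq] at hω ⊢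
    by_contra hlt
    rw [if_pos (by simpa using (not_le.1 hlt).le)] at hω
    exact absurd hω (by simpa using hδ)
  · filter_upwards [h c] with n hn θ hθ
    have hms : MeasurableSet {ω | M n θ ω ≤ c} := measurableSet_le (hMm n θ hθ) measurable_const
    refine ⟨fun ω => ?_, ((hDm n θ hθ).indicator hms).aemeasurable, ?_⟩
    · by_cases hω : M n θ ω ≤ c <;> simp [hω]
    · rw [lintegral_indicator hms]
      exact hn θ hθ

lemma IsIIDSample.map_eq_pi {T : Type*} [MeasurableSpace T] {μ : Measure Ω}
    [IsProbabilityMeasure μ] {W : ℕ → Ω → T} {P : Measure T} (hW : IsIIDSample μ W P) (n : ℕ) :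
    μ.map (fun ω (i : Fin n) => W i ω) = Measure.pi fun _ => P := by
  have h := (iIndepFun_iff_map_fun_eq_pi_map (f := fun (i : Fin n) => W i) (μ := μ)
    fun i => (hW.1 i).aemeasurable).1 (hW.iIndepFun_fin n)
  rw [h]
  congr 1
  ext1 i
  rw [hW.2.2]

/-- Transfer to the product measure; the budget `n * c` for sums becomes `c` for averages. -/
lemma setLIntegral_average_le {T : Type*} [MeasurableSpace T] {μ : Measure Ω}
    [IsProbabilityMeasure μ] {W : ℕ → Ω → T} {P : Measure T} (hW : IsIIDSample μ W P) {n : ℕ}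
    (hn : n ≠ 0) {M G : (Fin n → T) → ℝ≥0∞} (hM : Measurable M) (hG : Measurable G) {c : ℝ≥0}
    (h : ∫⁻ d in {d | M d ≤ (n * c : ℝ≥0)}, G d ∂(Measure.pi fun _ => P) ≤ (n * c : ℝ≥0)) :
    ∫⁻ ω in {ω | M (fun i : Fin n => W i ω) / n ≤ c}, (n : ℝ≥0∞)⁻¹ * G (fun i : Fin n => W i ω) ∂μ
      ≤ c := by
  have hd : Measurable fun ω (i : Fin n) => W i ω := measurable_pi_lambda _ fun i => hW.1 i
  have hn0 : (n : ℝ≥0∞) ≠ 0 := by simpa using hn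
  have hA : MeasurableSet {d | M d ≤ (n * c : ℝ≥0)} := measurableSet_le hM measurable_const
  have e : {ω | M (fun i : Fin n => W i ω) / n ≤ c} =
      (fun ω (i : Fin n) => W i ω) ⁻¹' {d | M d ≤ (n * c : ℝ≥0)} := by
    ext ω
    simp only [Set.mem_ofPred_eq, Set.mem_preimage]
    rw [ENNReal.div_le_iff hn0 (by simp), mul_comm]
    push_cast
    rfl
  rw [e, lintegral_const_mul' _ _ (by simpa using hn), ← setLIntegral_map hA hG hd, hW.map_eq_pi n]
  calc (n : ℝ≥0∞)⁻¹ * ∫⁻ d in {d | M d ≤ (n * c : ℝ≥0)}, G d ∂(Measure.pi fun _ => P)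
      ≤ (n : ℝ≥0∞)⁻¹ * (n * c : ℝ≥0) := by gcongr
    _ = c := by
      push_cast
      rw [← mul_assoc, ENNReal.inv_mul_cancel hn0 (by simp), one_mul]

variable {U F E 𝒵 : Type*} [MeasurableSpace U] [MeasurableSpace 𝒵]
  [NormedAddCommGroup F] [InnerProductSpace ℝ F] [CompleteSpace F]
  [SecondCountableTopology F] [MeasurableSpace F] [BorelSpace F]
  [NormedAddCommGroup E] [InnerProductSpace ℝ E] [CompleteSpace E]
  [SecondCountableTopology E] [MeasurableSpace E] [BorelSpace E]

/-- If the weighted average of the squared coefficients tends to zero, then so do the average of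
the squared noise terms and the normalized squared norm of their sum. -/
theorem UnifTendstoZeroInProb.noise {P : Θ → Measure (U × F × 𝒵)} {κ : Θ → Kernel 𝒵 F}
    [∀ θ, IsMarkovKernel (κ θ)] {g : Θ → 𝒵 → F} {W : ℕ → Ω → U × F × 𝒵}
    {α : (n : ℕ) → Θ → (Fin n → U × F × 𝒵) → Fin n → E}
    (hPr : ∀ θ ∈ S, IsProbabilityMeasure (Pr θ)) (hW : ∀ θ ∈ S, IsIIDSample (Pr θ) W (P θ))
    (hP : ∀ θ ∈ S, ResampleInvariant (P θ) (κ θ)) (hg : ∀ θ ∈ S, Measurable (g θ))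
    (hκ : ∀ θ ∈ S, ∀ᵐ w ∂(P θ), Integrable id (κ θ w.2.2) ∧ ∫ y, y ∂(κ θ w.2.2) = g θ w.2.2)
    (hα : ∀ n, ∀ θ ∈ S, ∀ i, Measurable fun d => α n θ d i)
    (hres : ∀ n θ d i j y, α n θ (redraw i (d, y)) j = α n θ d j)
    (h : UnifTendstoZeroInProb S Pr fun n θ ω => (∑ i, ‖α n θ (fun i => W i ω) i‖ₑ ^ 2 *
      ∫⁻ y, ‖y - g θ (W i ω).2.2‖ₑ ^ 2 ∂(κ θ (W i ω).2.2)) / n) :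
    (UnifTendstoZeroInProb S Pr fun n θ ω => (n : ℝ≥0∞)⁻¹ *
      ∑ i, ‖α n θ (fun i => W i ω) i‖ₑ ^ 2 * ‖(W i ω).2.1 - g θ (W i ω).2.2‖ₑ ^ 2) ∧
    UnifTendstoZeroInProb S Pr fun n θ ω => (n : ℝ≥0∞)⁻¹ *
      ‖∑ i, HS.outer (α n θ (fun i => W i ω) i) ((W i ω).2.1 - g θ (W i ω).2.2)‖ₑ ^ 2 := by
  have hd : ∀ n, ∀ θ ∈ S, Measurable fun ω (i : Fin n) => W i ω := fun n θ hθ =>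
    measurable_pi_lambda _ fun i => (hW θ hθ).1 i
  have hMm : ∀ n, ∀ θ ∈ S, Measurable fun d : Fin n → U × F × 𝒵 =>
      ∑ i, ‖α n θ d i‖ₑ ^ 2 * ∫⁻ y, ‖y - g θ (d i).2.2‖ₑ ^ 2 ∂(κ θ (d i).2.2) := by
    intro n θ hθ
    refine Finset.measurable_sum _ fun i _ => ((hα n θ hθ i).enorm.pow_const 2).mul ?_
    exact (measurable_condVar (κ := κ θ) (hg θ hθ)).comp
      (g := fun z => ∫⁻ y, ‖y - g θ z‖ₑ ^ 2 ∂(κ θ z)) (f := fun d : Fin n → U × F × 𝒵 => (d i).2.2)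
      (by fun_prop)
  have hξ : ∀ n, ∀ θ ∈ S, ∀ i, Measurable fun d : Fin n → U × F × 𝒵 =>
      (d i).2.1 - g θ (d i).2.2 := fun n θ hθ i => by
    have := hg θ hθ
    fun_prop
  have hG1 : ∀ n, ∀ θ ∈ S, Measurable fun d : Fin n → U × F × 𝒵 =>
      ∑ i, ‖α n θ d i‖ₑ ^ 2 * ‖(d i).2.1 - g θ (d i).2.2‖ₑ ^ 2 := fun n θ hθ =>
    Finset.measurable_sum _ fun i _ =>
      ((hα n θ hθ i).enorm.pow_const 2).mul ((hξ n θ hθ i).enorm.pow_const 2)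
  have hG2 : ∀ n, ∀ θ ∈ S, Measurable fun d : Fin n → U × F × 𝒵 =>
      ‖∑ i, HS.outer (α n θ d i) ((d i).2.1 - g θ (d i).2.2)‖ₑ ^ 2 := by
    intro n θ hθ
    have : StronglyMeasurable fun d : Fin n → U × F × 𝒵 =>
        ∑ i, HS.outer (α n θ d i) ((d i).2.1 - g θ (d i).2.2) :=
      Finset.stronglyMeasurable_fun_sum _ fun i _ => HS.continuous_outer.comp_stronglyMeasurable
        ((hα n θ hθ i).prodMk (hξ n θ hθ i)).stronglyMeasurable
    exact this.enorm.pow_const 2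
  have hM' : ∀ n, ∀ θ ∈ S, Measurable fun ω => (∑ i : Fin n, ‖α n θ (fun i => W i ω) i‖ₑ ^ 2 *
      ∫⁻ y, ‖y - g θ (W i ω).2.2‖ₑ ^ 2 ∂(κ θ (W i ω).2.2)) / (n : ℝ≥0∞) := fun n θ hθ =>
    ((hMm n θ hθ).comp (hd n θ hθ)).div_const _
  refine ⟨of_lintegral_control h hM' (fun n θ hθ =>
      ((hG1 n θ hθ).comp (hd n θ hθ)).const_mul _) fun c => ?_,
    of_lintegral_control h hM' (fun n θ hθ =>
      ((hG2 n θ hθ).comp (hd n θ hθ)).const_mul _) fun c => ?_⟩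
  · filter_upwards [eventually_ne_atTop 0] with n hn θ hθ
    have := hPr θ hθ
    have := (hW θ hθ).isProbabilityMeasure
    exact setLIntegral_average_le (hW θ hθ) hn (hMm n θ hθ) (hG1 n θ hθ)
      (setLIntegral_sum_noise_le (hP θ hθ) (hg θ hθ) (hα n θ hθ) (hres n θ))
  · filter_upwards [eventually_ne_atTop 0] with n hn θ hθ
    have := hPr θ hθ
    have := (hW θ hθ).isProbabilityMeasure
    exact setLIntegral_average_le (hW θ hθ) hn (hMm n θ hθ) (hG2 n θ hθ)
      (setLIntegral_enorm_sum_noise_sq_le (hP θ hθ) (hg θ hθ) (hκ θ hθ) (hα n θ hθ) (hres n θ))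

end UniformNoise

/-! ### Stability of both limit theorems under perturbation of the summands. -/

section Perturbation

variable {H : Type*} [NormedAddCommGroup H] [InnerProductSpace ℝ H] [CompleteSpace H]

lemma enorm_sqrt_natCast_inv_sq {n : ℕ} (hn : n ≠ 0) : ‖(√(n : ℝ))⁻¹‖ₑ ^ 2 = (n : ℝ≥0∞)⁻¹ := by
  have hn' : (0 : ℝ) < n := by positivity
  rw [Real.enorm_of_nonneg (by positivity), ← ENNReal.ofReal_pow (by positivity), inv_pow,
    Real.sq_sqrt hn'.le, ENNReal.ofReal_inv_of_pos hn']
  simp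

lemma ENNReal_add_sq_le (a b : ℝ≥0∞) : (a + b) ^ 2 ≤ 2 * a ^ 2 + 2 * b ^ 2 := by
  rw [← mul_add]
  have h := ENNReal.rpow_add_le_mul_rpow_add_rpow a b (p := 2) (by norm_num)
  norm_num at h
  exact h

/-- The sum of the centred outer squares. -/
lemma sum_outer_sub_mean {n : ℕ} (hn : n ≠ 0) (R : Fin n → H) :
    ∑ i, outer (R i - (n : ℝ)⁻¹ • ∑ j, R j) (R i - (n : ℝ)⁻¹ • ∑ j, R j) =
      ∑ i, outer (R i) (R i) -
        (n : ℝ) • outer ((n : ℝ)⁻¹ • ∑ j, R j) ((n : ℝ)⁻¹ • ∑ j, R j) := by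
  set m := (n : ℝ)⁻¹ • ∑ j, R j with hm
  have hs : ∑ j, R j = (n : ℝ) • m := by
    rw [hm, smul_smul, mul_inv_cancel₀ (by exact_mod_cast hn), one_smul]
  clear_value m
  have e : ∀ i, outer (R i - m) (R i - m) =
      outer (R i) (R i) - outer m (R i) - outer (R i) m + outer m m := fun i => by
    rw [outer_sub_left, outer_sub_right, outer_sub_right]
    abel
  simp_rw [e]
  rw [Finset.sum_add_distrib, Finset.sum_sub_distrib, Finset.sum_sub_distrib, ← outer_sum_left,
    ← outer_sum_right, hs, outer_smul_left, outer_smul_right, Finset.sum_const, Finset.card_univ,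
    Fintype.card_fin, ← Nat.cast_smul_eq_nsmul ℝ]
  abel

/-- Four sources of error: perturbation, law of large numbers, the normalization by `n - 1` and the
empirical mean. -/
lemma empirical_cov_sub_eq {n : ℕ} (hn : 2 ≤ n) (R V : Fin n → H) (C : H →L[ℝ] H) :
    ((n : ℝ) - 1)⁻¹ • ∑ i, outer (R i - (n : ℝ)⁻¹ • ∑ j, R j) (R i - (n : ℝ)⁻¹ • ∑ j, R j) - C =
      ((n : ℝ) / (n - 1)) • ((n : ℝ)⁻¹ • ∑ i, (outer (R i) (R i) - outer (V i) (V i))) +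
      ((n : ℝ) / (n - 1)) • ((n : ℝ)⁻¹ • ∑ i, outer (V i) (V i) - C) + ((n : ℝ) - 1)⁻¹ • C -
      ((n : ℝ) / (n - 1)) • outer ((n : ℝ)⁻¹ • ∑ j, R j) ((n : ℝ)⁻¹ • ∑ j, R j) := by
  rw [sum_outer_sub_mean (by lia), Finset.sum_sub_distrib]
  have h0 : (n : ℝ) ≠ 0 := by positivity
  have h1 : (n : ℝ) - 1 ≠ 0 := by
    have : (2 : ℝ) ≤ n := by exact_mod_cast hn
    intro h; linarith
  match_scalars <;> field_simp <;> ring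

lemma traceNorm_empirical_cov_sub_le {n : ℕ} (hn : 2 ≤ n) (R V : Fin n → H) (C : H →L[ℝ] H) :
    traceNorm (((n : ℝ) - 1)⁻¹ •
      ∑ i, outer (R i - (n : ℝ)⁻¹ • ∑ j, R j) (R i - (n : ℝ)⁻¹ • ∑ j, R j) - C) ≤
      2 * ((n : ℝ≥0∞)⁻¹ * ∑ i, ‖R i - V i‖ₑ * (‖R i‖ₑ + ‖V i‖ₑ)) +
      2 * traceNorm ((n : ℝ)⁻¹ • ∑ i, outer (V i) (V i) - C) +
      ((n - 1 : ℕ) : ℝ≥0∞)⁻¹ * traceNorm C + 2 * ‖(n : ℝ)⁻¹ • ∑ j, R j‖ₑ ^ 2 := by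
  have h2 : (2 : ℝ) ≤ n := by exact_mod_cast hn
  have e1 : ((n - 1 : ℕ) : ℝ) = (n : ℝ) - 1 := by
    rw [Nat.cast_sub (by lia)]; simp
  have c1 : ‖((n : ℝ) - 1)⁻¹‖ₑ = ((n - 1 : ℕ) : ℝ≥0∞)⁻¹ := by
    rw [← e1, enorm_natCast_inv _ (by lia)]
  have c2 : ‖(n : ℝ) / (n - 1)‖ₑ ≤ 2 := by
    have hle : (n : ℝ) / (n - 1) ≤ 2 := by
      rw [div_le_iff₀ (by linarith)]; linarith
    rw [Real.enorm_of_nonneg (div_nonneg (by linarith) (by linarith))]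
    exact (ENNReal.ofReal_le_ofReal hle).trans (by simp)
  rw [empirical_cov_sub_eq hn R V C]
  refine (traceNorm_sub_le _ _).trans (add_le_add ((traceNorm_add_le _ _).trans (add_le_add
    ((traceNorm_add_le _ _).trans (add_le_add ?_ ?_)) ?_)) ?_)
  · refine (traceNorm_smul_le _ _).trans (mul_le_mul' c2 ((traceNorm_smul_le _ _).trans ?_))
    rw [enorm_natCast_inv _ (by lia)]
    gcongr
    exact (traceNorm_sum_le _ _).trans (Finset.sum_le_sum fun i _ => traceNorm_outer_self_sub_le _ _)
  · exact (traceNorm_smul_le _ _).trans (mul_le_mul' c2 le_rfl)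
  · exact (traceNorm_smul_le _ _).trans (mul_le_mul' c1.le le_rfl)
  · refine (traceNorm_smul_le _ _).trans (mul_le_mul' c2 ?_)
    rw [sq]
    exact traceNorm_outer_le _ _

variable [SecondCountableTopology H] [MeasurableSpace H] [BorelSpace H]
  {Θ Ω ι : Type*} [MeasurableSpace Ω] {S : Set Θ} {Pr : Θ → Measure Ω}
  {V : Θ → ℕ → Ω → H} {lam : Θ → Measure H} {η : ℝ} {C : ℝ≥0} {b : HilbertBasis ι ℝ H}
  {R : (n : ℕ) → Ω → Fin n → H}

/-- A uniform Slutsky lemma: closeness in probability bounds the bounded Lipschitz distance of the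
laws, and the triangle inequality does the rest. -/
lemma UnifTendstoInDistribution.of_sub {B : Type*} [NormedAddCommGroup B] [MeasurableSpace B]
    [BorelSpace B] [SecondCountableTopology B] {T : ℕ → Ω → B} {T' : ℕ → Θ → Ω → B}
    {N : Θ → Measure B} (hPr : ∀ θ ∈ S, IsProbabilityMeasure (Pr θ))
    (hT : ∀ n, ∀ θ ∈ S, Measurable (T n)) (hT' : ∀ n, ∀ θ ∈ S, Measurable (T' n θ))
    (hN : Tendsto (fun n => ⨆ θ ∈ S, dBL ((Pr θ).map (T' n θ)) (N θ)) atTop (𝓝 0))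
    (h : UnifTendstoZeroInProb S Pr fun n θ ω => ‖T n ω - T' n θ ω‖ₑ) :
    UnifTendstoInDistribution S Pr T N := by
  rw [UnifTendstoInDistribution, ENNReal.tendsto_nhds_zero]
  intro ε hε
  obtain ⟨δ, hδ0, hδ⟩ := ENNReal.lt_iff_exists_nnreal_btwn.1 (ENNReal.half_pos hε.ne')
  have hδ0' : (0 : ℝ) < δ := by simpa using hδ0
  have h1 := (ENNReal.Tendsto.const_mul (a := 2) (h δ hδ0') (Or.inr (by simp))).add hN
  rw [mul_zero, add_zero] at h1
  filter_upwards [ENNReal.tendsto_nhds_zero.1 h1 (ε / 2) (ENNReal.half_pos hε.ne')] with n hn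
  refine iSup₂_le fun θ hθ => ?_
  have := hPr θ hθ
  calc dBL ((Pr θ).map (T n)) (N θ)
      ≤ (ENNReal.ofReal δ + 2 * Pr θ {ω | ENNReal.ofReal δ ≤ ‖T n ω - T' n θ ω‖ₑ}) +
        dBL ((Pr θ).map (T' n θ)) (N θ) :=
        (dBL_triangle _ ((Pr θ).map (T' n θ)) _).trans
          (add_le_add (dBL_map_le (hT n θ hθ) (hT' n θ hθ) δ) le_rfl)
    _ ≤ ENNReal.ofReal δ + (2 * (⨆ θ ∈ S, Pr θ {ω | ENNReal.ofReal δ ≤ ‖T n ω - T' n θ ω‖ₑ}) +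
        ⨆ θ ∈ S, dBL ((Pr θ).map (T' n θ)) (N θ)) := by
        rw [add_assoc]
        gcongr
        · exact le_iSup₂ (f := fun θ (_ : θ ∈ S) =>
            Pr θ {ω | ENNReal.ofReal δ ≤ ‖T n ω - T' n θ ω‖ₑ}) θ hθ
        · exact le_iSup₂ (f := fun θ (_ : θ ∈ S) => dBL ((Pr θ).map (T' n θ)) (N θ)) θ hθ
    _ ≤ ε / 2 + ε / 2 := by
        gcongr
        simpa using hδ.le
    _ = ε := ENNReal.add_halves ε

/-- The uniform central limit theorem for perturbed summands. -/
theorem UnifCentredMoments.exists_gaussian_limit_of_perturbed [Countable ι]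
    (h : UnifCentredMoments S lam η C b) (hPr : ∀ θ ∈ S, IsProbabilityMeasure (Pr θ))
    (hV : ∀ θ ∈ S, IsIIDSample (Pr θ) (V θ) (lam θ))
    (hR : ∀ n, ∀ θ ∈ S, ∀ i, Measurable fun ω => R n ω i)
    (hD : UnifTendstoZeroInProb S Pr fun n θ ω =>
      (n : ℝ≥0∞)⁻¹ * ‖∑ i : Fin n, (R n ω i - V θ i ω)‖ₑ ^ 2) :
    ∃ N : Θ → Measure H, (∀ θ ∈ S, IsCenteredGaussian (covOp (lam θ)) (N θ)) ∧
      UnifTendstoInDistribution S Pr (fun n ω => √(n : ℝ) • (n : ℝ)⁻¹ • ∑ i, R n ω i) N := by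
  obtain ⟨N, hN, hlim⟩ := h.exists_gaussian_limit hPr hV
  refine ⟨N, hN, .of_sub (T' := fun n θ => normSum (V θ) n) hPr (fun n θ hθ => ?_)
    (fun n θ hθ => measurable_normSum (hV θ hθ).1 n) hlim (.of_sq (hD.of_le_eventually ?_))⟩
  · exact ((Finset.measurable_sum _ fun i _ => hR n θ hθ i).const_smul (n : ℝ)⁻¹).const_smul _
  · filter_upwards [eventually_ne_atTop 0] with n hn θ _ ω
    have hn' : (0 : ℝ) < n := by positivity
    have e : √(n : ℝ) * (n : ℝ)⁻¹ = (√(n : ℝ))⁻¹ := by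
      rw [← div_eq_mul_inv, Real.sqrt_div_self]
    rw [normSum, smul_smul, e, ← smul_sub, ← Finset.sum_sub_distrib, enorm_smul, mul_pow,
      enorm_sqrt_natCast_inv_sq hn]

/-- Consistency in trace norm of the empirical covariance of perturbed summands. -/
theorem UnifCentredMoments.empirical_cov_of_perturbed [Countable ι]
    (h : UnifCentredMoments S lam η C b) (hPr : ∀ θ ∈ S, IsProbabilityMeasure (Pr θ))
    (hV : ∀ θ ∈ S, IsIIDSample (Pr θ) (V θ) (lam θ))
    (hD : UnifTendstoZeroInProb S Pr fun n θ ω =>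
      (n : ℝ≥0∞)⁻¹ * ‖∑ i : Fin n, (R n ω i - V θ i ω)‖ₑ ^ 2)
    (hQ : UnifTendstoZeroInProb S Pr fun n θ ω =>
      (n : ℝ≥0∞)⁻¹ * ∑ i : Fin n, ‖R n ω i - V θ i ω‖ₑ ^ 2) :
    UnifTendstoZeroInProb S Pr fun n θ ω => traceNorm (((n : ℝ) - 1)⁻¹ •
      ∑ i, outer (R n ω i - (n : ℝ)⁻¹ • ∑ j, R n ω j) (R n ω i - (n : ℝ)⁻¹ • ∑ j, R n ω j) -
        covOp (lam θ)) := by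
  have hmom : ∀ θ ∈ S, ∫⁻ x, ‖x‖ₑ ^ 2 ∂(lam θ) ≤ (1 + C : ℝ≥0) := fun θ hθ => by
    have := h.prob θ hθ
    exact lintegral_enorm_sq_le h.pos.le (h.mom θ hθ)
  have hinv : Tendsto (fun n : ℕ => (n : ℝ≥0∞)⁻¹) atTop (𝓝 0) :=
    ENNReal.tendsto_inv_nat_nhds_zero
  have h1 : UnifTendstoZeroInProb S Pr fun n θ ω =>
      (n : ℝ≥0∞)⁻¹ * ∑ i : Fin n, ‖R n ω i - V θ i ω‖ₑ * (‖R n ω i‖ₑ + ‖V θ i ω‖ₑ) := by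
    refine UnifTendstoZeroInProb.of_approx fun κ hκ => ?_
    -- Young's weight, with `2 c (1 + C) = κ`: the part in `‖V‖²` has mean at most `κ` and the rest
    -- is a multiple of `‖R - V‖²`.
    set c : ℝ≥0 := κ / (2 * (1 + C)) with hc
    have hc0 : 0 < c := by positivity
    refine ⟨_, fun n θ ω => (n : ℝ≥0∞)⁻¹ * ∑ i : Fin n, (2 * c : ℝ≥0) * ‖V θ i ω‖ₑ ^ 2,
      hQ.const_mul (2 * c⁻¹ + 1), Eventually.of_forall fun n θ hθ => ⟨fun ω => ?_, ?_, ?_⟩⟩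
    · rw [mul_left_comm, ← mul_add]
      refine mul_le_mul_right ?_ _
      rw [Finset.mul_sum, ← Finset.sum_add_distrib]
      refine Finset.sum_le_sum fun i _ => ?_
      have t1 : ‖R n ω i‖ₑ ≤ ‖V θ i ω‖ₑ + ‖R n ω i - V θ i ω‖ₑ := by
        simpa using enorm_add_le (V θ i ω) (R n ω i - V θ i ω)
      have t2 := ENNReal_mul_le_add_sq ‖V θ i ω‖ₑ ‖R n ω i - V θ i ω‖ₑ hc0
      calc ‖R n ω i - V θ i ω‖ₑ * (‖R n ω i‖ₑ + ‖V θ i ω‖ₑ)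
          ≤ ‖R n ω i - V θ i ω‖ₑ * (‖V θ i ω‖ₑ + ‖R n ω i - V θ i ω‖ₑ + ‖V θ i ω‖ₑ) := by gcongr
        _ = 2 * (‖V θ i ω‖ₑ * ‖R n ω i - V θ i ω‖ₑ) + ‖R n ω i - V θ i ω‖ₑ ^ 2 := by ring
        _ ≤ 2 * (c * ‖V θ i ω‖ₑ ^ 2 + (c⁻¹ : ℝ≥0) * ‖R n ω i - V θ i ω‖ₑ ^ 2) +
            ‖R n ω i - V θ i ω‖ₑ ^ 2 := by gcongr
        _ = _ := by push_cast; ring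
    · refine ((Finset.measurable_sum _ fun i _ => ?_).const_mul _).aemeasurable
      exact (((hV θ hθ).1 i).enorm.pow_const 2).const_mul _
    · have := hPr θ hθ
      refine ((hV θ hθ).lintegral_average_le (G := fun x => (2 * c : ℝ≥0) * ‖x‖ₑ ^ 2)
        (by fun_prop) n).trans ?_
      rw [lintegral_const_mul _ (by fun_prop)]
      refine (mul_le_mul_right (hmom θ hθ) _).trans ?_
      rw [← ENNReal.coe_mul, ENNReal.coe_le_coe, hc]
      refine le_of_eq ?_
      field_simp
  have h4 : UnifTendstoZeroInProb S Pr fun n _ ω => ‖(n : ℝ)⁻¹ • ∑ j, R n ω j‖ₑ ^ 2 := by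
    have hE : UnifTendstoZeroInProb S Pr fun n θ ω =>
        (n : ℝ≥0∞)⁻¹ * ‖normSum (V θ) n ω‖ₑ ^ 2 := by
      have ht : Tendsto (fun n : ℕ => (n : ℝ≥0∞)⁻¹ * (1 + C : ℝ≥0)) atTop (𝓝 0) := by
        have := ENNReal.Tendsto.mul_const (b := ((1 + C : ℝ≥0) : ℝ≥0∞)) hinv (Or.inr ENNReal.coe_ne_top)
        rwa [zero_mul] at this
      refine .of_lintegral ht ?_
      filter_upwards [eventually_ne_atTop 0] with n hn θ hθ
      have := hPr θ hθ
      have := h.prob θ hθ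
      have hm := measurable_normSum (hV θ hθ).1 n
      refine ⟨((hm.enorm.pow_const 2).const_mul _).aemeasurable, ?_⟩
      rw [lintegral_const_mul _ (hm.enorm.pow_const 2)]
      gcongr
      exact (lintegral_normSum_sq_le b (hV θ hθ) (memLp_two_of_lintegral (hmom θ hθ))
        (h.mean θ hθ) n).trans (hmom θ hθ)
    -- The empirical mean is `√n⁻¹` times a normalized sum with bounded second moment, plus the mean
    -- of the perturbations; the spare factor `n⁻¹` on the latter is dropped.
    refine ((hE.const_mul 2).add (hD.const_mul 2)).of_le_eventually ?_
    filter_upwards [eventually_ne_atTop 0] with n hn θ _ ω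
    have hn1 : (n : ℝ≥0∞)⁻¹ ≤ 1 := ENNReal.inv_le_one.2 (by exact_mod_cast Nat.one_le_iff_ne_zero.2 hn)
    have e1 : ∑ j, R n ω j = ∑ j : Fin n, V θ j ω + ∑ j : Fin n, (R n ω j - V θ j ω) := by
      rw [← Finset.sum_add_distrib]
      exact Finset.sum_congr rfl fun i _ => by abel
    have e2 : ‖normSum (V θ) n ω‖ₑ ^ 2 = (n : ℝ≥0∞)⁻¹ * ‖∑ j : Fin n, V θ j ω‖ₑ ^ 2 := by
      rw [normSum, enorm_smul, mul_pow, enorm_sqrt_natCast_inv_sq hn]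
    rw [e2, enorm_smul, mul_pow, enorm_natCast_inv _ hn, e1]
    calc (n : ℝ≥0∞)⁻¹ ^ 2 * ‖∑ j : Fin n, V θ j ω + ∑ j : Fin n, (R n ω j - V θ j ω)‖ₑ ^ 2
        ≤ (n : ℝ≥0∞)⁻¹ ^ 2 * (2 * ‖∑ j : Fin n, V θ j ω‖ₑ ^ 2 +
          2 * ‖∑ j : Fin n, (R n ω j - V θ j ω)‖ₑ ^ 2) := by
          gcongr
          refine le_trans ?_ (ENNReal_add_sq_le _ _)
          gcongr
          exact enorm_add_le _ _
      _ = 2 * ((n : ℝ≥0∞)⁻¹ * ((n : ℝ≥0∞)⁻¹ * ‖∑ j : Fin n, V θ j ω‖ₑ ^ 2)) +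
          (n : ℝ≥0∞)⁻¹ * (2 * ((n : ℝ≥0∞)⁻¹ * ‖∑ j : Fin n, (R n ω j - V θ j ω)‖ₑ ^ 2)) := by ring
      _ ≤ _ := by
          push_cast
          exact add_le_add le_rfl (mul_le_of_le_one_left zero_le hn1)
  have h3 : UnifTendstoZeroInProb S Pr fun n θ _ =>
      ((n - 1 : ℕ) : ℝ≥0∞)⁻¹ * traceNorm (covOp (lam θ)) := by
    have ht : Tendsto (fun n : ℕ => ((n - 1 : ℕ) : ℝ≥0∞)⁻¹ * (1 + C : ℝ≥0)) atTop (𝓝 0) := by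
      have := ENNReal.Tendsto.mul_const (b := ((1 + C : ℝ≥0) : ℝ≥0∞))
        (hinv.comp (tendsto_sub_atTop_nat 1)) (Or.inr ENNReal.coe_ne_top)
      rwa [zero_mul] at this
    refine .of_lintegral ht (Eventually.of_forall fun n θ hθ => ⟨aemeasurable_const, ?_⟩)
    have := hPr θ hθ
    have := h.prob θ hθ
    rw [lintegral_const, measure_univ, mul_one]
    gcongr
    exact traceNorm_covOp_le (hmom θ hθ)
  refine ((((h1.const_mul 2).add ((h.unifTendstoZeroInProb_traceNorm hPr hV).const_mul 2)).add
    h3).add (h4.const_mul 2)).of_le_eventually ?_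
  filter_upwards [eventually_ge_atTop 2] with n hn θ _ ω
  exact traceNorm_empirical_cov_sub_le hn (R n ω) (fun i => V θ i ω) _

end Perturbation

/-! ### Expansion of the products of residuals. -/

section ErrorTerms

variable {E F : Type*}
  [NormedAddCommGroup E] [InnerProductSpace ℝ E] [CompleteSpace E]
  [NormedAddCommGroup F] [InnerProductSpace ℝ F] [CompleteSpace F] {n : ℕ}

/-- The squared norm is `∑ ⟪u_i, u_j⟫ ⟪v_i, v_j⟫`, symmetric in the two families. Noise in the first
factor can thus be moved to the second, as the noise estimate requires. -/
lemma enorm_sum_outer_comm (u : Fin n → E) (v : Fin n → F) :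
    ‖∑ i, HS.outer (u i) (v i)‖ₑ = ‖∑ i, HS.outer (v i) (u i)‖ₑ := by
  have h : ‖∑ i, HS.outer (u i) (v i)‖ ^ 2 = ‖∑ i, HS.outer (v i) (u i)‖ ^ 2 := by
    simp_rw [← real_inner_self_eq_norm_sq, sum_inner, inner_sum, HS.inner_outer_outer, mul_comm]
  rw [← ofReal_norm, ← ofReal_norm, (sq_eq_sq₀ (norm_nonneg _) (norm_nonneg _)).1 h]

lemma enorm_add_add_sq_le {G : Type*} [NormedAddCommGroup G] (x y z : G) :
    ‖x + y + z‖ₑ ^ 2 ≤ 4 * ‖x‖ₑ ^ 2 + 4 * ‖y‖ₑ ^ 2 + 2 * ‖z‖ₑ ^ 2 := by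
  calc ‖x + y + z‖ₑ ^ 2 ≤ (‖x‖ₑ + ‖y‖ₑ + ‖z‖ₑ) ^ 2 := by
        gcongr
        exact (enorm_add_le (x + y) z).trans (add_le_add (enorm_add_le x y) le_rfl)
    _ ≤ 2 * (2 * ‖x‖ₑ ^ 2 + 2 * ‖y‖ₑ ^ 2) + 2 * ‖z‖ₑ ^ 2 := by
        refine (ENNReal_add_sq_le _ _).trans ?_
        gcongr
        exact ENNReal_add_sq_le _ _
    _ = _ := by ring

lemma outer_add_add_sub (a e : E) (b x : F) :
    HS.outer (e + a) (x + b) - HS.outer e x =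
      HS.outer a x + HS.outer e b + HS.outer a b := by
  rw [HS.outer_add_left, HS.outer_add_right, HS.outer_add_right]
  abel

/-- Cauchy–Schwarz; this is where the product of the two prediction errors enters. -/
lemma enorm_sum_outer_sq_le (a : Fin n → E) (b : Fin n → F) :
    ‖∑ i, HS.outer (a i) (b i)‖ₑ ^ 2 ≤ (∑ i, ‖a i‖ₑ ^ 2) * ∑ i, ‖b i‖ₑ ^ 2 := by
  calc ‖∑ i, HS.outer (a i) (b i)‖ₑ ^ 2 ≤ (∑ i, ‖a i‖ₑ * ‖b i‖ₑ) ^ 2 := by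
        gcongr
        refine (enorm_sum_le _ _).trans (le_of_eq ?_)
        simp_rw [HS.enorm_outer]
    _ ≤ _ := by
        have h := Finset.sum_mul_sq_le_sq_mul_sq Finset.univ (fun i => ‖a i‖₊) fun i => ‖b i‖₊
        simp_rw [enorm_eq_nnnorm]
        exact_mod_cast h

/-- The sum of the outer products of perturbed vectors. -/
lemma enorm_sum_outer_perturbed_sq_le (a e : Fin n → E) (b x : Fin n → F) :
    ‖∑ i, (HS.outer (e i + a i) (x i + b i) - HS.outer (e i) (x i))‖ₑ ^ 2 ≤
      4 * ‖∑ i, HS.outer (a i) (x i)‖ₑ ^ 2 + 4 * ‖∑ i, HS.outer (b i) (e i)‖ₑ ^ 2 +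
        2 * ((∑ i, ‖a i‖ₑ ^ 2) * ∑ i, ‖b i‖ₑ ^ 2) := by
  simp_rw [outer_add_add_sub, Finset.sum_add_distrib]
  refine (enorm_add_add_sq_le _ _ _).trans ?_
  rw [enorm_sum_outer_comm e b]
  gcongr
  exact enorm_sum_outer_sq_le a b

/-- The same three-term expansion taken summand by summand, with `∑ ‖a_i‖² ‖b_i‖²` bounded by the
product of the sums. -/
lemma sum_enorm_outer_perturbed_sq_le (a e : Fin n → E) (b x : Fin n → F) :
    ∑ i, ‖HS.outer (e i + a i) (x i + b i) - HS.outer (e i) (x i)‖ₑ ^ 2 ≤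
      4 * ∑ i, ‖a i‖ₑ ^ 2 * ‖x i‖ₑ ^ 2 + 4 * ∑ i, ‖b i‖ₑ ^ 2 * ‖e i‖ₑ ^ 2 +
        2 * ((∑ i, ‖a i‖ₑ ^ 2) * ∑ i, ‖b i‖ₑ ^ 2) := by
  have h : ∑ i, ‖a i‖ₑ ^ 2 * ‖b i‖ₑ ^ 2 ≤ (∑ i, ‖a i‖ₑ ^ 2) * ∑ i, ‖b i‖ₑ ^ 2 := by
    rw [Finset.sum_mul]
    refine Finset.sum_le_sum fun i _ => mul_le_mul_right ?_ _
    exact Finset.single_le_sum (f := fun i => ‖b i‖ₑ ^ 2) (fun _ _ => zero_le) (Finset.mem_univ i)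
  calc ∑ i, ‖HS.outer (e i + a i) (x i + b i) - HS.outer (e i) (x i)‖ₑ ^ 2
      ≤ ∑ i, (4 * (‖a i‖ₑ ^ 2 * ‖x i‖ₑ ^ 2) + 4 * (‖b i‖ₑ ^ 2 * ‖e i‖ₑ ^ 2) +
          2 * (‖a i‖ₑ ^ 2 * ‖b i‖ₑ ^ 2)) := by
        refine Finset.sum_le_sum fun i _ => ?_
        rw [outer_add_add_sub]
        refine (enorm_add_add_sq_le _ _ _).trans (le_of_eq ?_)
        simp_rw [HS.enorm_outer, mul_pow]
        ring
    _ = 4 * ∑ i, ‖a i‖ₑ ^ 2 * ‖x i‖ₑ ^ 2 + 4 * ∑ i, ‖b i‖ₑ ^ 2 * ‖e i‖ₑ ^ 2 +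
        2 * ∑ i, ‖a i‖ₑ ^ 2 * ‖b i‖ₑ ^ 2 := by
        rw [Finset.sum_add_distrib, Finset.sum_add_distrib, Finset.mul_sum, Finset.mul_sum,
          Finset.mul_sum]
    _ ≤ _ := by gcongr

end ErrorTerms

/-! ### The errors in the model: redrawing, centring, moments and tails. -/

section ModelFacts

variable {HX HY 𝒵 : Type*}
  [NormedAddCommGroup HX] [InnerProductSpace ℝ HX] [CompleteSpace HX]
  [SecondCountableTopology HX] [MeasurableSpace HX] [BorelSpace HX]
  [NormedAddCommGroup HY] [InnerProductSpace ℝ HY] [CompleteSpace HY]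
  [SecondCountableTopology HY] [MeasurableSpace HY] [BorelSpace HY]
  [MeasurableSpace 𝒵] (P : ProbabilityMeasure (HX × HY × 𝒵))

/-- The conditional distribution of `X` given `Z`. -/
abbrev kernelX : Kernel 𝒵 HX :=
  condDistrib (fun w : HX × HY × 𝒵 => w.1) (fun w => w.2.2) (P : Measure _)

/-- The conditional distribution of `Y` given `Z`. -/
abbrev kernelY : Kernel 𝒵 HY :=
  condDistrib (fun w : HX × HY × 𝒵 => w.2.1) (fun w => w.2.2) (P : Measure _)

lemma measurable_fReg : Measurable (fReg P) :=
  (StronglyMeasurable.integral_kernel (κ := kernelX P) (f := fun x : HX => x)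
    stronglyMeasurable_id).measurable

lemma measurable_gReg : Measurable (gReg P) :=
  (StronglyMeasurable.integral_kernel (κ := kernelY P) (f := fun y : HY => y)
    stronglyMeasurable_id).measurable

lemma measurable_eps : Measurable (eps P) := by
  have := measurable_fReg P
  unfold eps
  fun_prop

lemma measurable_xi : Measurable (xi P) := by
  have := measurable_gReg P
  unfold xi
  fun_prop

/-- Exchanging the roles of `X` and `Y`. -/
def swapXY (w : HX × HY × 𝒵) : HY × HX × 𝒵 := (w.2.1, w.1, w.2.2)

lemma measurable_swapXY : Measurable (swapXY (HX := HX) (HY := HY) (𝒵 := 𝒵)) := by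
  unfold swapXY
  fun_prop

variable {P}

lemma ae_integrable_condDistrib {T G : Type*} [MeasurableSpace T] [NormedAddCommGroup G]
    [CompleteSpace G] [SecondCountableTopology G] [MeasurableSpace G] [BorelSpace G]
    {μ : Measure T} [IsProbabilityMeasure μ] {Y : T → G} {Z : T → 𝒵} (hZ : Measurable Z)
    (hYm : Measurable Y) (hY : Integrable Y μ) :
    ∀ᵐ z ∂(μ.map Z), Integrable id (condDistrib Y Z μ z) := by
  have h : Integrable (fun p : 𝒵 × G => p.2) (μ.map fun w => (Z w, Y w)) :=
    (integrable_map_measure measurable_snd.aestronglyMeasurable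
      (hZ.prodMk hYm).aemeasurable).2 hY
  exact Integrable.condDistrib_ae_map hYm.aemeasurable h

lemma resampleInvariant_kernelY (h : CondIndepGiven (P : Measure (HX × HY × 𝒵))) :
    ResampleInvariant (P : Measure (HX × HY × 𝒵)) (kernelY P) := fun _ hG =>
  lintegral_condDistrib_of_condIndep (X := fun w : HX × HY × 𝒵 => w.1) (Y := fun w => w.2.1)
    (Z := fun w => w.2.2) (by fun_prop) (by fun_prop) (by fun_prop) h hG

/-- Conditional independence is symmetric; exchanging `X` and `Y` puts the redrawn variable in the
middle, so one noise theorem serves both regressions. -/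
lemma resampleInvariant_kernelX (h : CondIndepGiven (P : Measure (HX × HY × 𝒵))) :
    ResampleInvariant ((P : Measure (HX × HY × 𝒵)).map swapXY) (kernelX P) := by
  intro G hG
  have hm : Measurable fun w : HY × HX × 𝒵 => ∫⁻ x, G (w.1, x, w.2.2) ∂(kernelX P w.2.2) :=
    Measurable.lintegral_kernel_prod_right' (κ := (kernelX P).comap _ measurable_snd.snd)
      (f := fun p : (HY × HX × 𝒵) × HX => G (p.1.1, p.2, p.1.2.2)) (by fun_prop)
  rw [lintegral_map hG measurable_swapXY, lintegral_map hm measurable_swapXY]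
  refine lintegral_condDistrib_of_condIndep (μ := (P : Measure (HX × HY × 𝒵)))
    (X := fun w : HX × HY × 𝒵 => w.2.1) (Y := fun w => w.1)
    (Z := fun w => w.2.2) (by fun_prop) (by fun_prop) (by fun_prop) ?_ hG
  intro φ ψ hφ hψ h1 h2
  have := h ψ φ hψ hφ h2 h1
  rw [mul_comm]
  simpa only [mul_comm] using this

lemma ae_kernelY (hY : Integrable (fun w => w.2.1) (P : Measure (HX × HY × 𝒵))) :
    ∀ᵐ w ∂(P : Measure (HX × HY × 𝒵)), Integrable id (kernelY P w.2.2) ∧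
      ∫ y, y ∂(kernelY P w.2.2) = gReg P w.2.2 := by
  have h := ae_of_ae_map (by fun_prop) (ae_integrable_condDistrib
    (Z := fun w : HX × HY × 𝒵 => w.2.2) (by fun_prop) (by fun_prop) hY)
  filter_upwards [h] with w hw
  exact ⟨hw, rfl⟩

lemma ae_kernelX (hX : Integrable (fun w => w.1) (P : Measure (HX × HY × 𝒵))) :
    ∀ᵐ w ∂((P : Measure (HX × HY × 𝒵)).map swapXY), Integrable id (kernelX P w.2.2) ∧
      ∫ x, x ∂(kernelX P w.2.2) = fReg P w.2.2 := by
  have h0 := ae_integrable_condDistrib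
    (Z := fun w : HX × HY × 𝒵 => w.2.2) (by fun_prop) (by fun_prop) hX
  have e : (P : Measure (HX × HY × 𝒵)).map (fun w => w.2.2) =
      ((P : Measure (HX × HY × 𝒵)).map swapXY).map (fun w => w.2.2) := by
    rw [Measure.map_map (by fun_prop) measurable_swapXY]
    rfl
  rw [e] at h0
  filter_upwards [ae_of_ae_map (by fun_prop) h0] with w hw
  exact ⟨hw, rfl⟩

variable (P) in
/-- The distribution of the outer product of the errors. -/
def errLaw : Measure (HS HX HY) :=
  (P : Measure (HX × HY × 𝒵)).map fun w => HS.outer (eps P w) (xi P w)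

lemma stronglyMeasurable_outer_errors :
    StronglyMeasurable fun w : HX × HY × 𝒵 => HS.outer (eps P w) (xi P w) :=
  HS.continuous_outer.comp_stronglyMeasurable
    ((measurable_eps P).prodMk (measurable_xi P)).stronglyMeasurable

lemma covOp_errLaw [SecondCountableTopology (HS HX HY)] : covOp (errLaw P) = covP P :=
  integral_map stronglyMeasurable_outer_errors.measurable.aemeasurable
    continuous_outer_self.stronglyMeasurable.aestronglyMeasurable

lemma lintegral_errLaw {f : HS HX HY → ℝ≥0∞} (hf : Measurable f) :
    ∫⁻ x, f x ∂(errLaw P) = ∫⁻ w, f (HS.outer (eps P w) (xi P w)) ∂(P : Measure (HX × HY × 𝒵)) :=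
  lintegral_map hf stronglyMeasurable_outer_errors.measurable

instance : IsProbabilityMeasure (errLaw P) :=
  Measure.isProbabilityMeasure_map stronglyMeasurable_outer_errors.measurable.aemeasurable

/-- The pairing of `t` with `ε ⊗ ξ` is `⟪t ε, ξ⟫`, linear in `ξ = y - g_P(z)`, so redrawing `y`
gives zero. Integrability of `ε` and `ξ` separately would not justify this; second moments of the
product do. -/
lemma integral_inner_errLaw (h : CondIndepGiven (P : Measure (HX × HY × 𝒵)))
    (hY : Integrable (fun w => w.2.1) (P : Measure (HX × HY × 𝒵)))
    [SecondCountableTopology (HS HX HY)] (hL : MemLp id 2 (errLaw P)) (t : HS HX HY) :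
    ∫ x, ⟪t, x⟫ ∂(errLaw P) = 0 := by
  have hm : Measurable fun x : HS HX HY => ⟪t, x⟫ := by fun_prop
  have hV : Measurable fun w : HX × HY × 𝒵 => HS.outer (eps P w) (xi P w) :=
    stronglyMeasurable_outer_errors.measurable
  have hi : Integrable (fun x => ⟪t, x⟫) (errLaw P) := (memLp_inner hL t).integrable one_le_two
  rw [errLaw, integral_map hV.aemeasurable hm.aestronglyMeasurable]
  refine integral_eq_zero_of_resample (K := (kernelY P).comap _ measurable_snd.snd)
    (res := fun p : (HX × HY × 𝒵) × HY => (p.1.1, p.2, p.1.2.2))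
    (m := fun w => gReg P w.2.2) (h := fun w => t.toCLM (eps P w)) (by fun_prop)
    (fun G hG => resampleInvariant_kernelY h G hG) (ae_kernelY hY)
    ((integrable_map_measure hm.aestronglyMeasurable hV.aemeasurable).1 hi) fun w y => ?_
  rw [HS.inner_outer_right]
  rfl

lemma rpow_le_one_add_rpow {r s : ℝ} (hr : 0 ≤ r) (hrs : r ≤ s) (x : ℝ≥0∞) :
    x ^ r ≤ 1 + x ^ s := by
  rcases le_total x 1 with hx | hx
  · exact (ENNReal.rpow_le_one hx hr).trans le_self_add
  · exact (ENNReal.rpow_le_rpow_of_exponent_le hx hrs).trans le_add_self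

/-- The outer products of the errors satisfy the moment and tail conditions uniformly. -/
lemma unifCentredMoments_errLaw {𝒬 : Set (ProbabilityMeasure (HX × HY × 𝒵))}
    [SecondCountableTopology (HS HX HY)] {dX dY : ℕ∞} {eX : HilbertBasis (Idx dX) ℝ HX}
    {eY : HilbertBasis (Idx dY) ℝ HY} {B : HilbertBasis (Idx dX × Idx dY) ℝ (HS HX HY)}
    (hB : ∀ p, B p = HS.outer (eX p.1) (eY p.2))
    (hY : ∀ P ∈ 𝒬, Integrable (fun w => w.2.1) (P : Measure (HX × HY × 𝒵)))
    (hnull : ∀ P ∈ 𝒬, CondIndepGiven (P : Measure (HX × HY × 𝒵)))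
    {η : ℝ} (hη : 0 < η) {C : ℝ≥0}
    (hmom : ∀ P ∈ 𝒬, ∫⁻ w, ‖eps P w‖ₑ ^ (2 + η) * ‖xi P w‖ₑ ^ (2 + η)
      ∂(P : Measure (HX × HY × 𝒵)) ≤ C)
    (htail : Tendsto (fun K : ℕ => ⨆ P ∈ 𝒬,
      ∑' p : {p : Idx dX × Idx dY // K ≤ (p.1 : ℕ) + (p.2 : ℕ)},
        ∫⁻ w, ‖⟪eX p.1.1, eps P w⟫‖ₑ ^ 2 * ‖⟪eY p.1.2, xi P w⟫‖ₑ ^ 2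
          ∂(P : Measure (HX × HY × 𝒵))) atTop (𝓝 0)) :
    UnifCentredMoments 𝒬 errLaw (min η 1) (1 + C) B := by
  -- The exponent is lowered to `min η 1`, as the Taylor bound requires, at the price of `1` in the
  -- constant.
  have hmom' : ∀ P ∈ 𝒬, ∫⁻ x, ‖x‖ₑ ^ (2 + min η 1) ∂(errLaw P) ≤ (1 + C : ℝ≥0) := by
    intro P hP
    rw [lintegral_errLaw (by fun_prop)]
    calc ∫⁻ w, ‖HS.outer (eps P w) (xi P w)‖ₑ ^ (2 + min η 1) ∂(P : Measure (HX × HY × 𝒵))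
        ≤ ∫⁻ w, (1 + ‖eps P w‖ₑ ^ (2 + η) * ‖xi P w‖ₑ ^ (2 + η))
            ∂(P : Measure (HX × HY × 𝒵)) := by
          refine lintegral_mono fun w => ?_
          rw [HS.enorm_outer, ← ENNReal.mul_rpow_of_nonneg _ _ (by positivity)]
          exact rpow_le_one_add_rpow (by positivity) (by gcongr; exact min_le_left _ _) _
      _ ≤ _ := by
          rw [lintegral_add_left measurable_const, lintegral_const, measure_univ, mul_one]
          push_cast
          gcongr
          exact hmom P hP
  refine ⟨fun P _ => inferInstance, lt_min hη one_pos, min_le_right _ _, fun P hP t => ?_, hmom',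
    fun δ hδ => ?_⟩
  · exact integral_inner_errLaw (hnull P hP) (hY P hP) (memLp_two_of_lintegral
      (lintegral_enorm_sq_le (lt_min hη one_pos).le (hmom' P hP))) t
  · obtain ⟨K, hK⟩ := (ENNReal.tendsto_nhds_zero.1 htail δ hδ).exists
    -- Only finitely many pairs satisfy `i + j < K`; they span the projection, and Parseval in the
    -- basis `e_i ⊗ f_j` identifies its error with the assumed tail.
    have hfin : {p : Idx dX × Idx dY | (p.1 : ℕ) + (p.2 : ℕ) < K}.Finite := by
      refine Set.Finite.of_finite_image (f := fun p => ((p.1 : ℕ), (p.2 : ℕ)))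
        (((Set.finite_lt_nat K).prod (Set.finite_lt_nat K)).subset ?_) ?_
      · rintro _ ⟨p, hp, rfl⟩
        simp only [Set.mem_ofPred_eq] at hp
        exact ⟨by simp only [Set.mem_ofPred_eq]; lia, by simp only [Set.mem_ofPred_eq]; lia⟩
      · intro p _ q _ hpq
        simp only [Prod.mk.injEq] at hpq
        exact Prod.ext (Subtype.ext hpq.1) (Subtype.ext hpq.2)
    refine ⟨hfin.toFinset, fun P hP => le_trans (le_of_eq ?_) ((le_iSup₂ (f := fun P (_ : P ∈ 𝒬) =>
      ∑' p : {p : Idx dX × Idx dY // K ≤ (p.1 : ℕ) + (p.2 : ℕ)},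
        ∫⁻ w, ‖⟪eX p.1.1, eps P w⟫‖ₑ ^ 2 * ‖⟪eY p.1.2, xi P w⟫‖ₑ ^ 2
          ∂(P : Measure (HX × HY × 𝒵))) P hP).trans hK)⟩
    have hmeas : ∀ p : {p // p ∉ hfin.toFinset}, Measurable fun x : HS HX HY => ‖⟪B p, x⟫‖ₑ ^ 2 :=
      fun p => by fun_prop
    simp_rw [enorm_sub_basisProj_sq]
    rw [lintegral_tsum fun p => (hmeas p).aemeasurable]
    rw [← (Equiv.subtypeEquivRight (p := fun p => p ∉ hfin.toFinset)
      (q := fun p : Idx dX × Idx dY => K ≤ (p.1 : ℕ) + (p.2 : ℕ)) fun p => by simp).tsum_eq]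
    refine tsum_congr fun p => ?_
    rw [lintegral_errLaw (hmeas p)]
    refine lintegral_congr fun w => ?_
    rw [hB, HS.inner_outer_outer, enorm_mul, mul_pow]
    rfl

end ModelFacts

/-! ### Products of residuals against products of errors. -/

section Residuals

variable {HX HY 𝒵 Ω : Type*}
  [NormedAddCommGroup HX] [InnerProductSpace ℝ HX] [CompleteSpace HX]
  [SecondCountableTopology HX] [MeasurableSpace HX] [BorelSpace HX]
  [NormedAddCommGroup HY] [InnerProductSpace ℝ HY] [CompleteSpace HY]
  [SecondCountableTopology HY] [MeasurableSpace HY] [BorelSpace HY]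
  [MeasurableSpace 𝒵] [MeasurableSpace Ω] {𝒬 : Set (ProbabilityMeasure (HX × HY × 𝒵))}
  {Pr : ProbabilityMeasure (HX × HY × 𝒵) → Measure Ω} {W : ℕ → Ω → HX × HY × 𝒵}
  {fhat : RegressionMethod 𝒵 HX} {ghat : RegressionMethod 𝒵 HY}

lemma measurable_scrR [SecondCountableTopology (HS HX HY)] (hfhat : fhat.IsMeasurable)
    (hghat : ghat.IsMeasurable) (hW : ∀ i, Measurable (W i)) (n : ℕ) (i : Fin n) :
    Measurable fun ω => scrR fhat ghat W n ω i := by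
  have hx : Measurable (xData W n) := measurable_pi_lambda _ fun j => (hW j).fst
  have hy : Measurable (yData W n) := measurable_pi_lambda _ fun j => (hW j).snd.fst
  have hz : Measurable (zData W n) := measurable_pi_lambda _ fun j => (hW j).snd.snd
  have h1 : Measurable fun ω => resid fhat n (xData W n ω) (zData W n ω) i :=
    (hW i).fst.sub ((hfhat n i).comp (hx.prodMk hz))
  have h2 : Measurable fun ω => resid ghat n (yData W n ω) (zData W n ω) i :=
    (hW i).snd.fst.sub ((hghat n i).comp (hy.prodMk hz))
  exact HS.continuous_outer.measurable.comp (h1.prodMk h2)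

/-- The prediction errors of a regression method as a function of the whole sample. -/
def predError {U F E : Type*} [NormedAddCommGroup E] (r : RegressionMethod 𝒵 E) (h : 𝒵 → E) (n : ℕ)
    (φ : U → E) (d : Fin n → U × F × 𝒵) (i : Fin n) : E :=
  h (d i).2.2 - r n (fun j => φ (d j).1) (fun j => (d j).2.2) (d i).2.2

lemma measurable_predError {E F : Type*} [NormedAddCommGroup E] [SecondCountableTopology E]
    [MeasurableSpace E] [BorelSpace E] [MeasurableSpace F] {r : RegressionMethod 𝒵 E}
    (hr : r.IsMeasurable) {h : 𝒵 → E} (hh : Measurable h) (n : ℕ) (i : Fin n) :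
    Measurable fun d : Fin n → E × F × 𝒵 => predError r h n id d i := by
  have hm : Measurable fun d : Fin n → E × F × 𝒵 =>
      ((fun j => (d j).1 : Fin n → E), (fun j => (d j).2.2 : Fin n → 𝒵)) := by fun_prop
  have hz : Measurable fun d : Fin n → E × F × 𝒵 => h (d i).2.2 := by fun_prop
  exact hz.sub ((hr n i).comp hm)

/-- The average squared deviation of the products of residuals from the products of errors, and
the normalized squared norm of the sum of these deviations, tend to zero. -/
theorem unifTendstoZeroInProb_residual_errors
    (hPr : ∀ P ∈ 𝒬, IsProbabilityMeasure (Pr P))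
    (hW : ∀ P ∈ 𝒬, IsIIDSample (Pr P) W (P : Measure (HX × HY × 𝒵)))
    (hfhat : fhat.IsMeasurable) (hghat : ghat.IsMeasurable)
    (hX : ∀ P ∈ 𝒬, Integrable (fun w => w.1) (P : Measure (HX × HY × 𝒵)))
    (hY : ∀ P ∈ 𝒬, Integrable (fun w => w.2.1) (P : Measure (HX × HY × 𝒵)))
    (hnull : ∀ P ∈ 𝒬, CondIndepGiven (P : Measure (HX × HY × 𝒵)))
    (h_prod : UnifTendstoZeroInProb 𝒬 Pr fun n P ω =>
      n * mspe fhat (fReg P) n (xData W n ω) (zData W n ω) *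
        mspe ghat (gReg P) n (yData W n ω) (zData W n ω))
    (h_wf : UnifTendstoZeroInProb 𝒬 Pr fun n P ω =>
      wmspe fhat (fReg P) (vVar P) n (xData W n ω) (zData W n ω))
    (h_wg : UnifTendstoZeroInProb 𝒬 Pr fun n P ω =>
      wmspe ghat (gReg P) (uVar P) n (yData W n ω) (zData W n ω)) :
    (UnifTendstoZeroInProb 𝒬 Pr fun n P ω => (n : ℝ≥0∞)⁻¹ * ∑ i : Fin n,
      ‖scrR fhat ghat W n ω i - HS.outer (eps P (W i ω)) (xi P (W i ω))‖ₑ ^ 2) ∧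
    UnifTendstoZeroInProb 𝒬 Pr fun n P ω => (n : ℝ≥0∞)⁻¹ * ‖∑ i : Fin n,
      (scrR fhat ghat W n ω i - HS.outer (eps P (W i ω)) (xi P (W i ω)))‖ₑ ^ 2 := by
  obtain ⟨f1, f2⟩ := UnifTendstoZeroInProb.noise
    (P := fun P : ProbabilityMeasure (HX × HY × 𝒵) => (P : Measure (HX × HY × 𝒵)))
    (κ := kernelY) (g := gReg) (W := W) (α := fun n P d i => predError fhat (fReg P) n id d i) hPr hW
    (fun P hP => resampleInvariant_kernelY (hnull P hP)) (fun P _ => measurable_gReg P)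
    (fun P hP => ae_kernelY (hY P hP))
    (fun n P _ i => measurable_predError hfhat (measurable_fReg P) n i)
    (fun n P d i j y => by simp [predError]) h_wf
  -- The same estimate with `X` and `Y` exchanged.
  obtain ⟨g1, g2⟩ := UnifTendstoZeroInProb.noise
    (P := fun P : ProbabilityMeasure (HX × HY × 𝒵) =>
      (P : Measure (HX × HY × 𝒵)).map swapXY)
    (κ := kernelX) (g := fReg) (W := fun i ω => swapXY (W i ω))
    (α := fun n P d i => predError ghat (gReg P) n id d i) hPr
    (fun P hP => by
      have := hPr P hP
      exact (hW P hP).comp measurable_swapXY)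
    (fun P hP => resampleInvariant_kernelX (hnull P hP)) (fun P _ => measurable_fReg P)
    (fun P hP => ae_kernelX (hX P hP))
    (fun n P _ i => measurable_predError hghat (measurable_gReg P) n i)
    (fun n P d i j y => by simp [predError]) h_wg
  set a : (n : ℕ) → ProbabilityMeasure (HX × HY × 𝒵) → Ω → Fin n → HX := fun n P ω i =>
    fReg P (W i ω).2.2 - fhat n (xData W n ω) (zData W n ω) (W i ω).2.2
  set b : (n : ℕ) → ProbabilityMeasure (HX × HY × 𝒵) → Ω → Fin n → HY := fun n P ω i =>
    gReg P (W i ω).2.2 - ghat n (yData W n ω) (zData W n ω) (W i ω).2.2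
  have hR : ∀ n P ω (i : Fin n), scrR fhat ghat W n ω i =
      HS.outer (eps P (W i ω) + a n P ω i) (xi P (W i ω) + b n P ω i) := fun n P ω i => by
    simp only [scrR, resid, eps, xi, a, b, sub_add_sub_cancel]
    rfl
  -- The normalization leaves `n M^f M^g`, the quantity assumed to vanish.
  have hprod : ∀ n : ℕ, n ≠ 0 → ∀ P ω, (n : ℝ≥0∞)⁻¹ *
      ((∑ i, ‖a n P ω i‖ₑ ^ 2) * ∑ i, ‖b n P ω i‖ₑ ^ 2) =
      n * mspe fhat (fReg P) n (xData W n ω) (zData W n ω) *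
        mspe ghat (gReg P) n (yData W n ω) (zData W n ω) := fun n hn P ω => by
    have hn0 : (n : ℝ≥0∞) ≠ 0 := by simpa using hn
    rw [mspe, mspe, ENNReal.mul_div_cancel hn0 (by simp), div_eq_mul_inv]
    change _ = (∑ i, ‖a n P ω i‖ₑ ^ 2) * ((∑ i, ‖b n P ω i‖ₑ ^ 2) * (n : ℝ≥0∞)⁻¹)
    ring
  constructor
  · refine (((f1.const_mul 4).add (g1.const_mul 4)).add (h_prod.const_mul 2)).of_le_eventually ?_
    filter_upwards [eventually_ne_atTop 0] with n hn P _ ω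
    rw [← hprod n hn P ω]
    simp_rw [hR n P]
    refine (mul_le_mul_right (sum_enorm_outer_perturbed_sq_le (a n P ω)
      (fun i : Fin n => eps P (W i ω)) (b n P ω) fun i : Fin n => xi P (W i ω)) _).trans
      (le_of_eq ?_)
    push_cast
    rw [mul_add, mul_add, mul_left_comm _ 4, mul_left_comm _ 4, mul_left_comm _ 2]
    rfl
  · refine (((f2.const_mul 4).add (g2.const_mul 4)).add (h_prod.const_mul 2)).of_le_eventually ?_
    filter_upwards [eventually_ne_atTop 0] with n hn P _ ω
    rw [← hprod n hn P ω]
    simp_rw [hR n P]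
    refine (mul_le_mul_right (enorm_sum_outer_perturbed_sq_le (a n P ω)
      (fun i : Fin n => eps P (W i ω)) (b n P ω) fun i : Fin n => xi P (W i ω)) _).trans
      (le_of_eq ?_)
    push_cast
    rw [mul_add, mul_add, mul_left_comm _ 4, mul_left_comm _ 4, mul_left_comm _ 2]
    rfl

end Residuals

end GHCM

end

/-! ### The main theorem. -/

theorem mainTheorem2
    {HX HY 𝒵 Ω : Type*}
    [NormedAddCommGroup HX] [InnerProductSpace ℝ HX] [CompleteSpace HX]
    [SecondCountableTopology HX] [MeasurableSpace HX] [BorelSpace HX]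
    [NormedAddCommGroup HY] [InnerProductSpace ℝ HY] [CompleteSpace HY]
    [SecondCountableTopology HY] [MeasurableSpace HY] [BorelSpace HY]
    [MeasurableSpace 𝒵] [MeasurableSpace Ω]
    (𝒫₀ : Set (ProbabilityMeasure (HX × HY × 𝒵)))
    -- the data: under `Pr P` the `W i = (x_i, y_i, z_i)` are i.i.d. with distribution `P`
    (Pr : ProbabilityMeasure (HX × HY × 𝒵) → Measure Ω)
    (W : ℕ → Ω → HX × HY × 𝒵)
    (hW : ∀ P ∈ 𝒫₀, GHCM.IsIIDSample (Pr P) W (P : Measure (HX × HY × 𝒵)))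
    -- the two regression methods
    (fhat : GHCM.RegressionMethod 𝒵 HX) (ghat : GHCM.RegressionMethod 𝒵 HY)
    (hfhat : fhat.IsMeasurable) (hghat : ghat.IsMeasurable)
    -- the regression functions exist, and the null hypothesis holds
    (hX : ∀ P ∈ 𝒫₀, Integrable (fun w => w.1) (P : Measure (HX × HY × 𝒵)))
    (hY : ∀ P ∈ 𝒫₀, Integrable (fun w => w.2.1) (P : Measure (HX × HY × 𝒵)))
    (hnull : ∀ P ∈ 𝒫₀, GHCM.CondIndepGiven (P : Measure (HX × HY × 𝒵)))
    -- the product of the prediction errors tends to zero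
    (h_prod : GHCM.UnifTendstoZeroInProb 𝒫₀ Pr fun n P ω =>
      n * GHCM.mspe fhat (GHCM.fReg P) n (GHCM.xData W n ω) (GHCM.zData W n ω) *
        GHCM.mspe ghat (GHCM.gReg P) n (GHCM.yData W n ω) (GHCM.zData W n ω))
    -- the weighted prediction errors tend to zero
    (h_wf : GHCM.UnifTendstoZeroInProb 𝒫₀ Pr fun n P ω =>
      GHCM.wmspe fhat (GHCM.fReg P) (GHCM.vVar P) n (GHCM.xData W n ω) (GHCM.zData W n ω))
    (h_wg : GHCM.UnifTendstoZeroInProb 𝒫₀ Pr fun n P ω =>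
      GHCM.wmspe ghat (GHCM.gReg P) (GHCM.uVar P) n (GHCM.yData W n ω) (GHCM.zData W n ω))
    -- moment conditions
    (h_mom_inf : 0 < (⨅ P ∈ 𝒫₀,
      ∫⁻ w, ‖GHCM.eps P w‖ₑ ^ 2 * ‖GHCM.xi P w‖ₑ ^ 2 ∂(P : Measure (HX × HY × 𝒵))))
    (h_mom_sup : ∃ η : ℝ, 0 < η ∧ ∃ C : ℝ≥0, ∀ P ∈ 𝒫₀,
      ∫⁻ w, ‖GHCM.eps P w‖ₑ ^ (2 + η) * ‖GHCM.xi P w‖ₑ ^ (2 + η)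
        ∂(P : Measure (HX × HY × 𝒵)) ≤ C)
    -- uniform tail condition in some orthonormal bases
    (h_tail : ∃ (dX dY : ℕ∞) (eX : HilbertBasis (GHCM.Idx dX) ℝ HX)
      (eY : HilbertBasis (GHCM.Idx dY) ℝ HY),
      Tendsto (fun K : ℕ => ⨆ P ∈ 𝒫₀,
        ∑' p : {p : GHCM.Idx dX × GHCM.Idx dY // K ≤ (p.1 : ℕ) + (p.2 : ℕ)},
          ∫⁻ w, ‖⟪eX p.1.1, GHCM.eps P w⟫‖ₑ ^ 2 * ‖⟪eY p.1.2, GHCM.xi P w⟫‖ₑ ^ 2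
            ∂(P : Measure (HX × HY × 𝒵))) atTop (𝓝 0)) :
    (∃ N : ProbabilityMeasure (HX × HY × 𝒵) → Measure (GHCM.HS HX HY),
      (∀ P ∈ 𝒫₀, GHCM.IsCenteredGaussian (GHCM.covP P) (N P)) ∧
      GHCM.UnifTendstoInDistribution 𝒫₀ Pr (GHCM.scrT fhat ghat W) N) ∧
    GHCM.UnifTendstoZeroInProb 𝒫₀ Pr (fun n P ω =>
      GHCM.traceNorm (GHCM.scrChat fhat ghat W n ω - GHCM.covP P)) := by
  obtain ⟨η, hη, C, hmom⟩ := h_mom_sup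
  obtain ⟨dX, dY, eX, eY, htail⟩ := h_tail
  obtain ⟨B, hB⟩ := GHCM.HS.exists_hilbertBasis_outer eX eY
  -- The index sets are sets of natural numbers, so the basis of outer products is countable.
  have : SecondCountableTopology (GHCM.HS HX HY) := GHCM.secondCountableTopology_of_hilbertBasis B
  have hU := GHCM.unifCentredMoments_errLaw hB hY hnull hη hmom htail
  -- `Pr P` has the same total mass as its image `P`.
  have hPr : ∀ P ∈ 𝒫₀, IsProbabilityMeasure (Pr P) := fun P hP => by
    have h : IsProbabilityMeasure ((Pr P).map (W 0)) := by
      rw [(hW P hP).2.2 0]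
      infer_instance
    exact Measure.isProbabilityMeasure_of_map (W 0)
  have hV : ∀ P ∈ 𝒫₀, GHCM.IsIIDSample (Pr P)
      (fun i ω => GHCM.HS.outer (GHCM.eps P (W i ω)) (GHCM.xi P (W i ω))) (GHCM.errLaw P) :=
    fun P hP => by
      have := hPr P hP
      exact (hW P hP).comp GHCM.stronglyMeasurable_outer_errors.measurable
  obtain ⟨hQ, hD⟩ := GHCM.unifTendstoZeroInProb_residual_errors hPr hW hfhat hghat hX hY hnull
    h_prod h_wf h_wg
  obtain ⟨N, hN, hlim⟩ := hU.exists_gaussian_limit_of_perturbed hPr hV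
    (R := GHCM.scrR fhat ghat W)
    (fun n P hP i => GHCM.measurable_scrR hfhat hghat (hW P hP).1 n i) hD
  refine ⟨⟨N, fun P hP => GHCM.covOp_errLaw (P := P) ▸ hN P hP, hlim⟩, ?_⟩
  have h := hU.empirical_cov_of_perturbed hPr hV (R := GHCM.scrR fhat ghat W) hD hQ
  simp_rw [GHCM.covOp_errLaw] at h
  exact h
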